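/- Let $0\le m<n$ be integers and let $E$ be a smooth manifold of dimension $n$. For a manifold $M$ let $T_mM\cong TM\otimes\mathbb R^{m*}$ be the manifold of first order $m$-velocities $j_0\gamma$ in $M$ (the pairs $(\gamma(0),D\gamma(0))$ for maps $\gamma$ from a neighbourhood of $0\in\mathbb R^m$ to $M$), let $F_mM\subset T_mM$ be the open submanifold of regular velocities ($\gamma$ an immersion at $0$), let $J^mM$ be the manifold of first order $m$-dimensional contact elements of $M$ (the Grassmann bundle of $m$-dimensional subspaces $P\subset T_xM$, $x\in M$) and let $\rho:F_mM\to J^mM$, $j_0\gamma\mapsto[j_0\gamma]=(\gamma(0),\operatorname{im}D\gamma(0))$ be the projection. For $\tau:T_mE\to E$, a double velocity $w=j_0\tilde\gamma\in T_mT_mE$ is *semiholonomic* if $T_m\tau(w)=j_0(\tau\circ\tilde\gamma)$ equals $\tilde\gamma(0)$, and *holonomic* if it can be written as $w=j_0\bigl(t\mapsto j_0(s\mapsto\gamma(s+t))\bigr)$ for a smooth map $\gamma$ from a neighbourhood of $0\in\mathbb R^m$ to $E$. A double velocity $w=j_0\tilde\gamma\in T_mF_mE$ for which $\rho\circ\tilde\gamma$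 is an immersion at $0$ represents the double contact element $[[w]]=[j_0(\rho\circ\tilde\gamma)]\in J^mJ^mE$. A double contact element is *semiholonomic* (resp. *holonomic*) if it has at least one semiholonomic (resp. holonomic) representative; write $\hat{\mathbf J}\subset J^mJ^mE$ and $\mathbf J\subset J^mJ^mE$ for the sets of these elements. A vertical double velocity over $F_mE$ is a pair $(u,\beta)$ where $u=(x,L)\in F_mE$ and $\beta:\mathbb R^m\times\mathbb R^m\to T_xE$ is bilinear; it is the element of $T_mT_mE$ at $u$ that sends $t\in\mathbb R^m$ to the vertical tangent vector $\beta(t,\cdot)\in\operatorname{Hom}(\mathbb R^m,T_xE)\cong V_uT_mE$. The invertible pairs $(A,B)$, with $A\in\mathrm{GL}(m,\mathbb R)$ and $B:\mathbb R^m\times\mathbb R^m\to\mathbb R^m$ bilinear, are the elements $(j_0\phi,j_0\sigma)$, $A=D\phi(0)=\sigma(0)$, $B=D\sigma(0)$, of the semiholonomic subgroup of the principal jet group; they act on double velocities by $j_0\tilde\gamma\mapsto j_0(t\mapsto\tilde\gamma(\phi(t))\cdot\sigma(t))$. Those with $B$ symmetric form the holonomic subgroup, those with $B$ skew-symmetric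 the curvature subgroup. Let $V^mJ^mE$, $V^mJ^mE_{\mathrm{sym}}$, $V^mJ^mE_{\mathrm{alt}}$ be the smooth vector bundles over $J^mE$ whose fibres at $P\subset T_xE$ are the spaces of all, of symmetric and of skew-symmetric bilinear maps $P\times P\to T_xE/P$, with the smooth structures given by the standard local coordinates; a vertical double velocity $(u,\beta)$ determines the point of the fibre at $P=\operatorname{im}L$ given by $(La,Lb)\mapsto\beta(a,b)\bmod P$. **Theorem.** 1. By the last assignment, $V^mJ^mE$, $V^mJ^mE_{\mathrm{sym}}$ and $V^mJ^mE_{\mathrm{alt}}$ are the sets of orbits of the vertical double velocities $(u,\beta)$ over $F_mE$ with $\beta$ arbitrary, symmetric and skew-symmetric under the semiholonomic, the holonomic and the curvature subgroup, respectively. 2. $\hat{\mathbf J}$ is an embedded submanifold of $J^mJ^mE$, of dimension $n+m(n-m)+m^2(n-m)$. With the projection to $J^mE$ it is an affine bundle over $J^mE$ modelled on the vector bundle $V^mJ^mE$, where the action of $V^mJ^mE$ is the one induced by the addition of vertical double velocities: if $w$ is a semiholonomic representative of $z$ at $u\in F_mE$, then $w+(u,\beta)$ represents $z+[(u,\beta)]$.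 3. $\mathbf J$ is an embedded submanifold of $J^mJ^mE$, of dimension $n+m(n-m)+\tfrac12m(m+1)(n-m)$. With the projection to $J^mE$ and the restricted action it is an affine bundle over $J^mE$ modelled on $V^mJ^mE_{\mathrm{sym}}$. 4. $\hat{\mathbf J}=\mathbf J\oplus_{J^mE}V^mJ^mE_{\mathrm{alt}}$: the map $(h,c)\mapsto h+c$ is a diffeomorphism from the fibre product $\mathbf J\times_{J^mE}V^mJ^mE_{\mathrm{alt}}$ onto $\hat{\mathbf J}$. So every semiholonomic double contact element can be written uniquely as the sum of a holonomic double contact element (its holonomic component) and an element of $V^mJ^mE_{\mathrm{alt}}$ (its curvature component). -/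

import Mathlib

open Bundle Set
open scoped Manifold ContDiff Topology

noncomputable section

namespace DoubleContact

/-- The model space `ℝ^m`. -/
abbrev Rn (m : ℕ) := EuclideanSpace ℝ (Fin m)

/-! ### Contact elements -/

/-- Every `m`-dimensional subspace is the graph of a linear map in some split coordinates. -/
theorem exists_splitting {F : Type*} [NormedAddCommGroup F] [NormedSpace ℝ F]
    [FiniteDimensional ℝ F] {m : ℕ} (P : Submodule ℝ F) (hP : Module.finrank ℝ P = m) :
    ∃ ψ : F ≃L[ℝ] Rn m × Rn (Module.finrank ℝ F - m), ∀ v ∈ P, (ψ v).1 = 0 → v = 0 := by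
  obtain ⟨Q, hQ⟩ := P.exists_isCompl
  have hQ' : Module.finrank ℝ Q = Module.finrank ℝ F - m := by
    have := Submodule.finrank_add_eq_of_isCompl hQ
    omega
  let eP : P ≃ₗ[ℝ] Rn m := LinearEquiv.ofFinrankEq _ _ (by simp [hP])
  let eQ : Q ≃ₗ[ℝ] Rn (Module.finrank ℝ F - m) := LinearEquiv.ofFinrankEq _ _ (by simp [hQ'])
  let ψ := (P.prodEquivOfIsCompl Q hQ).symm.trans (eP.prodCongr eQ)
  refine ⟨ψ.toContinuousLinearEquiv, fun v hv h => ?_⟩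
  have h1 : (P.prodEquivOfIsCompl Q hQ).symm v = (⟨v, hv⟩, 0) :=
    Submodule.prodEquivOfIsCompl_symm_apply_left P Q hQ ⟨v, hv⟩
  have h2 : eP ((P.prodEquivOfIsCompl Q hQ).symm v).1 = 0 := h
  rw [h1] at h2
  have h3 : (⟨v, hv⟩ : P) = 0 := eP.map_eq_zero_iff.1 h2
  exact congrArg Subtype.val h3

section ContactElements

variable {F : Type*} [NormedAddCommGroup F] [NormedSpace ℝ F]
  {M : Type*} [TopologicalSpace M] [ChartedSpace F M]

variable (F M) in
/-- A first order `m`-dimensional contact element of the manifold `M` (modelled on `F`): a point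
`pt` of `M` together with an `m`-dimensional subspace of the tangent space of `M` at `pt`. -/
@[ext] structure ContactElement (m : ℕ) where
  pt : M
  plane : Submodule ℝ (TangentSpace 𝓘(ℝ, F) pt)
  finrank_plane : Module.finrank ℝ plane = m

variable (F) in
/-- The model space of the manifold of `m`-dimensional contact elements. -/
abbrev ContactModel (m : ℕ) := F × (Rn m →L[ℝ] Rn (Module.finrank ℝ F - m))

variable (F M) in
/-- The charts of the manifold of contact elements are indexed by a chart of `M` and a linear
splitting of the model space, that is, a linear system of coordinates whose first `m` members are
singled out. -/
abbrev ChartIndex (m : ℕ) := atlas F M × (F ≃L[ℝ] Rn m × Rn (Module.finrank ℝ F - m))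

variable [IsManifold 𝓘(ℝ, F) ∞ M]

/-- The change of linear coordinates on `T_x M` between the preferred chart at `x` (which is used to
identify `T_x M` with the model space) and a chart `e` around `x`. -/
def tangentChange (e : atlas F M) (x : M) (hx : x ∈ e.1.source) : F ≃L[ℝ] F :=
  ContinuousLinearEquiv.equivOfInverse
    ((tangentBundleCore 𝓘(ℝ, F) M).coordChange (achart F x) e x)
    ((tangentBundleCore 𝓘(ℝ, F) M).coordChange e (achart F x) x)
    (fun v => by
      rw [(tangentBundleCore 𝓘(ℝ, F) M).coordChange_comp (achart F x) e (achart F x) x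
        ⟨⟨mem_chart_source F x, hx⟩, mem_chart_source F x⟩,
        (tangentBundleCore 𝓘(ℝ, F) M).coordChange_self (achart F x) x (mem_chart_source F x)])
    (fun v => by
      rw [(tangentBundleCore 𝓘(ℝ, F) M).coordChange_comp e (achart F x) e x
        ⟨⟨hx, mem_chart_source F x⟩, hx⟩,
        (tangentBundleCore 𝓘(ℝ, F) M).coordChange_self e x hx])

/-- The linear coordinates on `T_x M` given by a chart `e` around `x` (that is, the derivative of
`e` at `x`); a junk value is taken if `x` is not in the domain of `e`. -/
def tangentCoord (e : atlas F M) (x : M) : TangentSpace 𝓘(ℝ, F) x ≃L[ℝ] F :=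
  open Classical in
  (if hx : x ∈ e.1.source then tangentChange e x hx else ContinuousLinearEquiv.refl ℝ F :
    F ≃L[ℝ] F)

variable {m : ℕ}

/-- The split linear coordinates on `T_x M` belonging to a chart index. -/
def frame (c : ChartIndex F M m) (x : M) :
    TangentSpace 𝓘(ℝ, F) x ≃L[ℝ] Rn m × Rn (Module.finrank ℝ F - m) :=
  (tangentCoord c.1 x).trans c.2

/-- The first `m` coordinates on the plane of a contact element. -/
def firstCoord (c : ChartIndex F M m) (z : ContactElement F M m) : z.plane →ₗ[ℝ] Rn m :=
  (LinearMap.fst ℝ _ _ ∘ₗ (frame c z.pt).toLinearEquiv.toLinearMap) ∘ₗ z.plane.subtype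

/-- The domain of a chart: the contact elements over the domain of the chart of `M` on which the
first `m` coordinates are linear coordinates. -/
def chartDomain (c : ChartIndex F M m) : Set (ContactElement F M m) :=
  {z | z.pt ∈ c.1.1.source ∧ Function.Injective (firstCoord c z)}

/-- On the domain of a chart, the first `m` coordinates as an isomorphism. -/
def firstCoordEquiv (c : ChartIndex F M m) (z : ContactElement F M m)
    (h : Function.Injective (firstCoord c z)) : z.plane ≃ₗ[ℝ] Rn m :=
  LinearEquiv.ofInjectiveOfFinrankEq (firstCoord c z) h (by simp [z.finrank_plane])

/-- The fibre coordinate of a contact element: the matrix `A` such that the plane is the graph of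
`A` in the split linear coordinates. -/
def slope (c : ChartIndex F M m) (z : ContactElement F M m) :
    Rn m →L[ℝ] Rn (Module.finrank ℝ F - m) :=
  open Classical in
  if h : Function.Injective (firstCoord c z) then
    LinearMap.toContinuousLinearMap
      (((LinearMap.snd ℝ _ _ ∘ₗ (frame c z.pt).toLinearEquiv.toLinearMap) ∘ₗ z.plane.subtype)
        ∘ₗ (firstCoordEquiv c z h).symm.toLinearMap)
  else 0

/-- The contact element with given base point and given fibre coordinate. -/
def ofSlope (c : ChartIndex F M m) (x : M) (A : Rn m →L[ℝ] Rn (Module.finrank ℝ F - m)) :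
    ContactElement F M m where
  pt := x
  plane := LinearMap.range
    ((frame c x).symm.toLinearEquiv.toLinearMap ∘ₗ LinearMap.prod LinearMap.id A.toLinearMap)
  finrank_plane := by
    rw [LinearMap.finrank_range_of_inj]
    · simp
    · intro a b h
      exact congrArg Prod.fst ((frame c x).symm.injective h)

theorem mem_plane_iff {c : ChartIndex F M m} {z : ContactElement F M m}
    (h : Function.Injective (firstCoord c z)) (v : TangentSpace 𝓘(ℝ, F) z.pt) :
    v ∈ z.plane ↔ (frame c z.pt v).2 = slope c z (frame c z.pt v).1 := by
  have key : ∀ w : z.plane, (frame c z.pt w).2 = slope c z (frame c z.pt w).1 := by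
    intro w
    have h1 : (firstCoordEquiv c z h).symm (frame c z.pt w).1 = w := by
      rw [LinearEquiv.symm_apply_eq]; rfl
    simp only [slope, dif_pos h]
    change _ = (frame c z.pt ((firstCoordEquiv c z h).symm (frame c z.pt w).1 : z.plane)).2
    rw [h1]
  constructor
  · intro hv
    exact key ⟨v, hv⟩
  · intro hv
    set w := (firstCoordEquiv c z h).symm (frame c z.pt v).1 with hw
    have h1 : (frame c z.pt w).1 = (frame c z.pt v).1 := by
      have : firstCoordEquiv c z h w = (frame c z.pt v).1 := by rw [hw]; simp
      exact this
    have h2 : frame c z.pt w = frame c z.pt v := by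
      refine Prod.ext h1 ?_
      rw [key w, h1, hv]
    rw [← (frame c z.pt).injective h2]
    exact w.2

theorem mem_ofSlope_plane {c : ChartIndex F M m} {x : M}
    {A : Rn m →L[ℝ] Rn (Module.finrank ℝ F - m)} (v : TangentSpace 𝓘(ℝ, F) x) :
    v ∈ (ofSlope c x A).plane ↔ (frame c x v).2 = A (frame c x v).1 := by
  constructor
  · rintro ⟨a, rfl⟩
    simp
  · intro h
    refine ⟨(frame c x v).1, ?_⟩
    apply (frame c x).injective
    simp only [LinearMap.coe_comp, Function.comp_apply]
    refine ((frame c x).apply_symm_apply _).trans ?_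
    exact Prod.ext rfl h.symm

theorem injective_firstCoord_ofSlope (c : ChartIndex F M m) (x : M)
    (A : Rn m →L[ℝ] Rn (Module.finrank ℝ F - m)) :
    Function.Injective (firstCoord c (ofSlope c x A)) := by
  intro v w h
  have hv := (mem_ofSlope_plane (A := A) v.1).1 v.2
  have hw := (mem_ofSlope_plane (A := A) w.1).1 w.2
  have h' : (frame c x v.1).1 = (frame c x w.1).1 := h
  refine Subtype.ext ((frame c x).injective (Prod.ext h' ?_))
  exact hv.trans ((congrArg A h').trans hw.symm)

theorem slope_ofSlope (c : ChartIndex F M m) (x : M)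
    (A : Rn m →L[ℝ] Rn (Module.finrank ℝ F - m)) : slope c (ofSlope c x A) = A := by
  ext1 a
  have h := injective_firstCoord_ofSlope c x A
  have h1 : (frame c x).symm (a, A a) ∈ (ofSlope c x A).plane := by
    rw [mem_ofSlope_plane]; simp
  have h2 := (mem_plane_iff h _).1 h1
  have h3 : frame c x ((frame c x).symm (a, A a)) = (a, A a) := by simp
  have h4 : (frame c (ofSlope c x A).pt ((frame c x).symm (a, A a))) = (a, A a) := h3
  rw [h4] at h2
  exact h2.symm

theorem ofSlope_slope {c : ChartIndex F M m} {z : ContactElement F M m}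
    (h : Function.Injective (firstCoord c z)) : ofSlope c z.pt (slope c z) = z := by
  have : (ofSlope c z.pt (slope c z)).plane = z.plane := by
    ext v
    exact (mem_ofSlope_plane v).trans (mem_plane_iff h v).symm
  exact ContactElement.ext rfl this

/-- The chart `(u^a, u^α_i)` of the set of contact elements. -/
def contactChart (c : ChartIndex F M m) :
    PartialEquiv (ContactElement F M m) (ContactModel F m) where
  toFun z := (c.1.1 z.pt, slope c z)
  invFun p := ofSlope c (c.1.1.symm p.1) p.2
  source := chartDomain c
  target := c.1.1.target ×ˢ univ
  map_source' z hz := ⟨c.1.1.map_source hz.1, mem_univ _⟩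
  map_target' p hp := ⟨c.1.1.map_target hp.1, injective_firstCoord_ofSlope _ _ _⟩
  left_inv' z hz := by
    simp only [c.1.1.left_inv hz.1]
    exact ofSlope_slope hz.2
  right_inv' p hp := by
    refine Prod.ext (c.1.1.right_inv hp.1) (slope_ofSlope _ _ _)

/-! #### Changes of coordinates -/

/-- The linear change of split coordinates, at the point with coordinates `y`. -/
def frameChange (c c' : ChartIndex F M m) (y : F) :
    (Rn m × Rn (Module.finrank ℝ F - m)) →L[ℝ] (Rn m × Rn (Module.finrank ℝ F - m)) :=
  (c'.2.toContinuousLinearMap ∘L fderiv ℝ (c'.1.1 ∘ c.1.1.symm) y) ∘L c.2.symm.toContinuousLinearMap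

theorem tangentCoord_comp_symm {e e' : atlas F M} {x : M} (h : x ∈ e.1.source)
    (h' : x ∈ e'.1.source) (v : F) :
    tangentCoord e' x ((tangentCoord e x).symm v) =
      fderiv ℝ (e'.1 ∘ e.1.symm) (e.1 x) v := by
  have h1 := (tangentBundleCore 𝓘(ℝ, F) M).coordChange_comp e (achart F x) e' x
    ⟨⟨h, mem_chart_source F x⟩, h'⟩ v
  have h2 : (tangentBundleCore 𝓘(ℝ, F) M).coordChange e e' x =
      fderiv ℝ (e'.1 ∘ e.1.symm) (e.1 x) := by
    simp [tangentBundleCore, OpenPartialHomeomorph.extend]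
  rw [← h2, ← h1]
  simp only [tangentCoord, dif_pos h, dif_pos h']
  rfl

theorem frame_comp_symm {c c' : ChartIndex F M m} {x : M} (h : x ∈ c.1.1.source)
    (h' : x ∈ c'.1.1.source) (v : Rn m × Rn (Module.finrank ℝ F - m)) :
    frame c' x ((frame c x).symm v) = frameChange c c' (c.1.1 x) v := by
  change c'.2 (tangentCoord c'.1 x ((tangentCoord c.1 x).symm (c.2.symm v))) = _
  rw [tangentCoord_comp_symm h h']
  rfl

theorem contDiffOn_chartChange (c c' : ChartIndex F M m) :
    ContDiffOn ℝ ∞ (c'.1.1 ∘ c.1.1.symm) (c.1.1.symm ≫ₕ c'.1.1).source := by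
  have h := (contDiffGroupoid ∞ 𝓘(ℝ, F)).compatible c.1.2 c'.1.2
  have h2 := (mem_groupoid_of_pregroupoid.1 h).1
  simpa [contDiffPregroupoid] using h2

theorem contDiffOn_frameChange (c c' : ChartIndex F M m) :
    ContDiffOn ℝ ∞ (frameChange c c') (c.1.1.symm ≫ₕ c'.1.1).source := by
  have h := (contDiffOn_chartChange c c').fderiv_of_isOpen (m := ∞)
    (c.1.1.symm ≫ₕ c'.1.1).open_source (by simp)
  exact ((contDiffOn_const (c := c'.2.toContinuousLinearMap)).clm_comp h).clm_comp contDiffOn_const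

/-- The map sending an element of `ℝ^m` to the new coordinates of the element of the plane with
coordinates `(y, A)` that it represents. -/
def planeChange (c c' : ChartIndex F M m) (p : ContactModel F m) :
    Rn m →L[ℝ] Rn m × Rn (Module.finrank ℝ F - m) :=
  frameChange c c' p.1 ∘L (ContinuousLinearMap.id ℝ (Rn m)).prod p.2

/-- The matrix relating the old and new first `m` coordinates on a plane. -/
def planeChange₁ (c c' : ChartIndex F M m) (p : ContactModel F m) : Rn m →L[ℝ] Rn m :=
  ContinuousLinearMap.fst ℝ _ _ ∘L planeChange c c' p

theorem contDiffOn_planeChange (c c' : ChartIndex F M m) :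
    ContDiffOn ℝ ∞ (planeChange c c') ((c.1.1.symm ≫ₕ c'.1.1).source ×ˢ univ) := by
  refine ContDiffOn.clm_comp ?_ ?_
  · exact (contDiffOn_frameChange c c').comp contDiffOn_fst (fun p hp => hp.1)
  · have : (fun p : ContactModel F m => (ContinuousLinearMap.id ℝ (Rn m)).prod p.2) =
        fun p => ContinuousLinearMap.inl ℝ _ _ + ContinuousLinearMap.inr ℝ _ _ ∘L p.2 := by
      ext p a <;> simp
    rw [this]
    exact contDiffOn_const.add (contDiffOn_const.clm_comp contDiffOn_snd)

theorem contDiffOn_planeChange₁ (c c' : ChartIndex F M m) :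
    ContDiffOn ℝ ∞ (planeChange₁ c c') ((c.1.1.symm ≫ₕ c'.1.1).source ×ˢ univ) :=
  contDiffOn_const.clm_comp (contDiffOn_planeChange c c')

/-- The domain, in coordinates, of a change of charts of contact elements. -/
def changeDomain (c c' : ChartIndex F M m) : Set (ContactModel F m) :=
  ((c.1.1.symm ≫ₕ c'.1.1).source ×ˢ univ) ∩ {p | IsUnit (planeChange₁ c c' p)}

theorem isOpen_changeDomain (c c' : ChartIndex F M m) : IsOpen (changeDomain c c') :=
  (contDiffOn_planeChange₁ c c').continuousOn.isOpen_inter_preimage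
    ((c.1.1.symm ≫ₕ c'.1.1).open_source.prod isOpen_univ) Units.isOpen

/-- The change of charts of contact elements, in coordinates. -/
def changeMap (c c' : ChartIndex F M m) (p : ContactModel F m) : ContactModel F m :=
  (c'.1.1 (c.1.1.symm p.1),
    (ContinuousLinearMap.snd ℝ _ _ ∘L planeChange c c' p) ∘L Ring.inverse (planeChange₁ c c' p))

theorem contDiffOn_inverse_planeChange₁ (c c' : ChartIndex F M m) :
    ContDiffOn ℝ ∞ (fun p => Ring.inverse (planeChange₁ c c' p)) (changeDomain c c') := by
  intro p hp
  obtain ⟨u, hu⟩ := hp.2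
  have h1 : ContDiffAt ℝ ∞ Ring.inverse (planeChange₁ c c' p) := by
    rw [← hu]; exact contDiffAt_ringInverse ℝ u
  exact h1.comp_contDiffWithinAt p
    ((contDiffOn_planeChange₁ c c').mono inter_subset_left p hp)

theorem contDiffOn_changeMap (c c' : ChartIndex F M m) :
    ContDiffOn ℝ ∞ (changeMap c c') (changeDomain c c') := by
  refine ContDiffOn.prodMk ?_ ?_
  · exact (contDiffOn_chartChange c c').comp contDiffOn_fst (fun p hp => hp.1.1)
  · exact (contDiffOn_const.clm_comp
      ((contDiffOn_planeChange c c').mono inter_subset_left)).clm_comp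
      (contDiffOn_inverse_planeChange₁ c c')

theorem firstCoord_change {c c' : ChartIndex F M m} {z : ContactElement F M m}
    (h : z ∈ chartDomain c) (h' : z.pt ∈ c'.1.1.source) (v : z.plane) :
    frame c' z.pt v = planeChange c c' (contactChart c z) (firstCoord c z v) := by
  have h1 := (mem_plane_iff h.2 v.1).1 v.2
  have h2 := frame_comp_symm h.1 h' (frame c z.pt v)
  rw [ContinuousLinearEquiv.symm_apply_apply] at h2
  rw [h2]
  change _ = frameChange c c' (c.1.1 z.pt) (_, _)
  congr 1
  exact Prod.ext rfl h1

theorem isUnit_planeChange₁_iff {c c' : ChartIndex F M m} {z : ContactElement F M m}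
    (h : z ∈ chartDomain c) (h' : z.pt ∈ c'.1.1.source) :
    IsUnit (planeChange₁ c c' (contactChart c z)) ↔ Function.Injective (firstCoord c' z) := by
  have h1 : (firstCoord c' z : z.plane → Rn m) =
      planeChange₁ c c' (contactChart c z) ∘ firstCoordEquiv c z h.2 := by
    funext v
    exact congrArg Prod.fst (firstCoord_change h h' v)
  rw [h1, ContinuousLinearMap.isUnit_iff_bijective,
    Function.Injective.of_comp_iff' _ (firstCoordEquiv c z h.2).bijective]
  exact ⟨fun h => h.1, fun h =>
    ⟨h, (LinearMap.injective_iff_surjective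
      (f := (planeChange₁ c c' (contactChart c z) : Rn m →ₗ[ℝ] Rn m))).1 h⟩⟩

theorem contactChart_change {c c' : ChartIndex F M m} {z : ContactElement F M m}
    (h : z ∈ chartDomain c) (h' : z ∈ chartDomain c') :
    contactChart c' z = changeMap c c' (contactChart c z) := by
  have hu := (isUnit_planeChange₁_iff h h'.1).2 h'.2
  refine Prod.ext ?_ ?_
  · change _ = c'.1.1 (c.1.1.symm (c.1.1 z.pt))
    rw [c.1.1.left_inv h.1]; rfl
  · change slope c' z = (ContinuousLinearMap.snd ℝ _ _ ∘L planeChange c c' (contactChart c z)) ∘L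
      Ring.inverse (planeChange₁ c c' (contactChart c z))
    have key : slope c' z ∘L planeChange₁ c c' (contactChart c z) =
        ContinuousLinearMap.snd ℝ _ _ ∘L planeChange c c' (contactChart c z) := by
      ext1 a
      obtain ⟨v, rfl⟩ := (firstCoordEquiv c z h.2).surjective a
      have h1 := firstCoord_change h h'.1 v
      have h2 := (mem_plane_iff h'.2 v.1).1 v.2
      rw [h1] at h2
      exact h2.symm
    have := Ring.mul_inverse_cancel _ hu
    rw [← key, ContinuousLinearMap.comp_assoc]
    change _ = slope c' z ∘L (planeChange₁ c c' (contactChart c z) * _)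
    rw [this]
    rfl

theorem contactChart_symm_trans_source (c c' : ChartIndex F M m) :
    ((contactChart c).symm.trans (contactChart c')).source = changeDomain c c' := by
  ext p
  constructor
  · rintro ⟨hp, hp'⟩
    have hz := (contactChart c).map_target hp
    have h1 := (isUnit_planeChange₁_iff hz hp'.1).2 hp'.2
    rw [(contactChart c).right_inv hp] at h1
    exact ⟨⟨⟨hp.1, hp'.1⟩, mem_univ _⟩, h1⟩
  · rintro ⟨⟨⟨hp, hp'⟩, -⟩, hu⟩
    have ht : p ∈ (contactChart c).target := ⟨hp, mem_univ _⟩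
    have hz := (contactChart c).map_target ht
    refine ⟨ht, hp', ?_⟩
    refine (isUnit_planeChange₁_iff hz hp').1 ?_
    rw [(contactChart c).right_inv ht]
    exact hu

theorem contactChart_symm_trans_eqOn (c c' : ChartIndex F M m) :
    EqOn ((contactChart c).symm.trans (contactChart c')) (changeMap c c')
      (changeDomain c c') := by
  intro p hp
  rw [← contactChart_symm_trans_source] at hp
  have hz := (contactChart c).map_target hp.1
  have := contactChart_change hz hp.2
  rw [(contactChart c).right_inv hp.1] at this
  exact this

variable [FiniteDimensional ℝ F]

theorem exists_mem_chartDomain (z : ContactElement F M m) :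
    ∃ c : ChartIndex F M m, z ∈ chartDomain c := by
  let T := tangentCoord (achart F z.pt) z.pt
  obtain ⟨ψ, hψ⟩ := exists_splitting (m := m)
    (z.plane.map T.toLinearEquiv.toLinearMap) (by
      rw [LinearEquiv.finrank_map_eq, z.finrank_plane])
  refine ⟨(achart F z.pt, ψ), mem_chart_source F z.pt, ?_⟩
  rw [← LinearMap.ker_eq_bot, LinearMap.ker_eq_bot']
  intro v hv
  have := hψ (T v) ⟨v, v.2, rfl⟩ hv
  exact Subtype.ext (T.map_eq_zero_iff.1 this)

/-- A chart index around a given contact element. -/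
def chartIndexAt (z : ContactElement F M m) : ChartIndex F M m :=
  (exists_mem_chartDomain z).choose

theorem mem_chartDomain_chartIndexAt (z : ContactElement F M m) :
    z ∈ chartDomain (chartIndexAt z) :=
  (exists_mem_chartDomain z).choose_spec

variable (F M m) in
/-- The charts `(u^a, u^α_i)` define a topology and an atlas on the set of contact elements. -/
def contactCore : ChartedSpaceCore (ContactModel F m) (ContactElement F M m) where
  atlas := range contactChart
  chartAt z := contactChart (chartIndexAt z)
  mem_chart_source z := mem_chartDomain_chartIndexAt z
  chart_mem_atlas z := mem_range_self _
  open_source := by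
    rintro _ _ ⟨c, rfl⟩ ⟨c', rfl⟩
    rw [contactChart_symm_trans_source]
    exact isOpen_changeDomain c c'
  continuousOn_toFun := by
    rintro _ _ ⟨c, rfl⟩ ⟨c', rfl⟩
    rw [contactChart_symm_trans_source]
    exact (contDiffOn_changeMap c c').continuousOn.congr (contactChart_symm_trans_eqOn c c')

instance : TopologicalSpace (ContactElement F M m) := (contactCore F M m).toTopologicalSpace

instance : ChartedSpace (ContactModel F m) (ContactElement F M m) :=
  (contactCore F M m).toChartedSpace

theorem mem_contactAtlas_iff (e : OpenPartialHomeomorph (ContactElement F M m) (ContactModel F m)) :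
    e ∈ atlas (ContactModel F m) (ContactElement F M m) ↔
      ∃ c : ChartIndex F M m, e = (contactCore F M m).openPartialHomeomorph (contactChart c)
        (mem_range_self c) := by
  constructor
  · intro h
    obtain ⟨e', h⟩ := mem_iUnion.1 h
    obtain ⟨⟨c, rfl⟩, h⟩ := mem_iUnion.1 h
    exact ⟨c, h⟩
  · rintro ⟨c, rfl⟩
    exact mem_iUnion.2 ⟨contactChart c, mem_iUnion.2 ⟨mem_range_self c, rfl⟩⟩

instance : IsManifold 𝓘(ℝ, ContactModel F m) ∞ (ContactElement F M m) := by
  apply isManifold_of_contDiffOn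
  intro e e' he he'
  obtain ⟨c, rfl⟩ := (mem_contactAtlas_iff e).1 he
  obtain ⟨c', rfl⟩ := (mem_contactAtlas_iff e').1 he'
  have h1 : (((contactCore F M m).openPartialHomeomorph (contactChart c) (mem_range_self c)).symm ≫ₕ
      (contactCore F M m).openPartialHomeomorph (contactChart c') (mem_range_self c')).source =
      changeDomain c c' := contactChart_symm_trans_source c c'
  simp only [modelWithCornersSelf_coe, modelWithCornersSelf_coe_symm, range_id, inter_univ,
    preimage_id_eq, id_eq, h1, Function.id_comp, Function.comp_id]
  exact (contDiffOn_changeMap c c').congr (contactChart_symm_trans_eqOn c c')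

end ContactElements

/-! ### The vector bundles `V^m J^m` -/

section VerticalBundle

/-! Shortcuts for type class inference. -/

instance (m k : ℕ) : NormedAddCommGroup (Rn m →L[ℝ] Rn k) :=
  ContinuousLinearMap.toNormedAddCommGroup

instance (m k : ℕ) : NormedSpace ℝ (Rn m →L[ℝ] Rn k) :=
  ContinuousLinearMap.toNormedSpace

instance (m k : ℕ) : NormedAddCommGroup (Rn m →L[ℝ] Rn m →L[ℝ] Rn k) :=
  ContinuousLinearMap.toNormedAddCommGroup

instance (m k : ℕ) : NormedSpace ℝ (Rn m →L[ℝ] Rn m →L[ℝ] Rn k) :=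
  ContinuousLinearMap.toNormedSpace

/-- Three classes of bilinear maps: all of them, the symmetric ones, the skew-symmetric ones. -/
inductive Kind
  | all
  | symmetric
  | skew

/-- The condition defining each class of bilinear maps. -/
def Kind.Holds (κ : Kind) {P Q : Type*} [AddCommGroup Q] (β : P → P → Q) : Prop :=
  match κ with
  | .all => True
  | .symmetric => ∀ a b, β a b = β b a
  | .skew => ∀ a b, β a b = -β b a

theorem Kind.Holds.add {κ : Kind} {P Q : Type*} [AddCommGroup Q] {β γ : P → P → Q}
    (h : κ.Holds β) (h' : κ.Holds γ) : κ.Holds (fun a b => β a b + γ a b) := by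
  cases κ
  · trivial
  · intro a b
    change β a b + γ a b = β b a + γ b a
    rw [h a b, h' a b]
  · intro a b
    change β a b + γ a b = -(β b a + γ b a)
    rw [h a b, h' a b, neg_add]

theorem Kind.Holds.zero {κ : Kind} {P Q : Type*} [AddCommGroup Q] :
    κ.Holds (fun _ _ => 0 : P → P → Q) := by
  cases κ
  · trivial
  · intro a b; rfl
  · intro a b; exact neg_zero.symm

theorem Kind.Holds.map {κ : Kind} {P Q P' Q' : Type*} [AddCommGroup Q] [AddCommGroup Q']
    {β : P → P → Q} (h : κ.Holds β) (f : Q →+ Q') (g : P' → P) :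
    κ.Holds (fun a b => f (β (g a) (g b))) := by
  cases κ
  · trivial
  · intro a b; exact congrArg f (h (g a) (g b))
  · intro a b; exact (congrArg f (h (g a) (g b))).trans (f.map_neg _)

/-- The bilinear maps `P × P → Q` of a given class. -/
def bilinMaps (κ : Kind) (P Q : Type*) [AddCommGroup P] [Module ℝ P] [AddCommGroup Q]
    [Module ℝ Q] : Submodule ℝ (P →ₗ[ℝ] P →ₗ[ℝ] Q) where
  carrier := {β | κ.Holds (fun a b => β a b)}
  add_mem' h h' := Kind.Holds.add h h'
  zero_mem' := Kind.Holds.zero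
  smul_mem' r _ h := Kind.Holds.map h (DistribSMul.toAddMonoidHom _ r) id

/-- The bilinear maps `ℝ^m × ℝ^m → ℝ^k` of a given class, as a normed space. -/
def bilinModel (κ : Kind) (m k : ℕ) : Submodule ℝ (Rn m →L[ℝ] Rn m →L[ℝ] Rn k) where
  carrier := {β | κ.Holds (fun a b => β a b)}
  add_mem' h h' := Kind.Holds.add h h'
  zero_mem' := Kind.Holds.zero
  smul_mem' r _ h := Kind.Holds.map h (DistribSMul.toAddMonoidHom _ r) id

/-- The typical fibre `ℝ^{m × m × k}` of the bundle `V^m J^m` (and of its symmetric and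
skew-symmetric versions). -/
def BilinModel (κ : Kind) (m k : ℕ) : Type := bilinModel κ m k

instance (κ : Kind) (m k : ℕ) : NormedAddCommGroup (BilinModel κ m k) :=
  inferInstanceAs (NormedAddCommGroup (bilinModel κ m k))

instance (κ : Kind) (m k : ℕ) : NormedSpace ℝ (BilinModel κ m k) :=
  inferInstanceAs (NormedSpace ℝ (bilinModel κ m k))

instance (κ : Kind) (m k : ℕ) : FiniteDimensional ℝ (BilinModel κ m k) :=
  inferInstanceAs (FiniteDimensional ℝ (bilinModel κ m k))

instance (κ : Kind) (P Q : Type*) [AddCommGroup P] [Module ℝ P] [AddCommGroup Q]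
    [Module ℝ Q] : AddCommGroup (bilinMaps κ P Q) :=
  inferInstance

instance (κ : Kind) (P Q : Type*) [AddCommGroup P] [Module ℝ P] [AddCommGroup Q]
    [Module ℝ Q] : Module ℝ (bilinMaps κ P Q) :=
  inferInstance

/-- Bilinear maps in linear coordinates. -/
def bilinCoordEquiv (κ : Kind) {P Q : Type*} [AddCommGroup P] [Module ℝ P] [AddCommGroup Q]
    [Module ℝ Q] {m k : ℕ} (S : P ≃ₗ[ℝ] Rn m) (T : Q ≃ₗ[ℝ] Rn k) :
    bilinMaps κ P Q ≃ₗ[ℝ] BilinModel κ m k where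
  toFun β := ⟨LinearMap.toContinuousBilinearMap
      ((β.1.compl₁₂ S.symm.toLinearMap S.symm.toLinearMap).compr₂ T.toLinearMap),
    β.2.map T.toLinearMap.toAddMonoidHom S.symm⟩
  invFun w := ⟨(w.1.toLinearMap₁₂.compl₁₂ S.toLinearMap S.toLinearMap).compr₂ T.symm.toLinearMap,
    w.2.map T.symm.toLinearMap.toAddMonoidHom S⟩
  map_add' β γ := by
    apply Subtype.ext
    ext1 a
    ext1 b
    exact T.map_add _ _
  map_smul' r β := by
    apply Subtype.ext
    ext1 a
    ext1 b
    exact T.map_smul _ _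
  left_inv β := by
    apply Subtype.ext
    ext a b
    change T.symm (T (β.1 (S.symm (S a)) (S.symm (S b)))) = _
    simp
  right_inv w := by
    apply Subtype.ext
    ext1 a
    ext1 b
    change T (T.symm (w.1 (S (S.symm a)) (S (S.symm b)))) = _
    simp

variable {F : Type*} [NormedAddCommGroup F] [NormedSpace ℝ F]
  {M : Type*} [TopologicalSpace M] [ChartedSpace F M] {m : ℕ}

/-- The fibre at a contact element `P ⊆ T_x M` of the bundle `V^m J^m M` (and of its symmetric and
skew-symmetric versions): the bilinear maps `P × P → T_x M / P`. -/
def VFiber (κ : Kind) (z : ContactElement F M m) : Type _ :=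
  bilinMaps κ z.plane (TangentSpace 𝓘(ℝ, F) z.pt ⧸ z.plane)

instance (κ : Kind) (z : ContactElement F M m) : AddCommGroup (VFiber κ z) :=
  inferInstanceAs (AddCommGroup (bilinMaps κ z.plane (TangentSpace 𝓘(ℝ, F) z.pt ⧸ z.plane)))

instance (κ : Kind) (z : ContactElement F M m) : Module ℝ (VFiber κ z) :=
  inferInstanceAs (Module ℝ (bilinMaps κ z.plane (TangentSpace 𝓘(ℝ, F) z.pt ⧸ z.plane)))

variable [IsManifold 𝓘(ℝ, F) ∞ M]

/-- On the domain of a chart, the linear coordinates on `T_x M / P`: if `P` is the graph of `A` in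
split coordinates, then the class of `(a, b)` has coordinates `b - A a`. -/
def normalCoord (c : ChartIndex F M m) (z : ContactElement F M m)
    (h : Function.Injective (firstCoord c z)) :
    (TangentSpace 𝓘(ℝ, F) z.pt ⧸ z.plane) ≃ₗ[ℝ] Rn (Module.finrank ℝ F - m) :=
  let φ : TangentSpace 𝓘(ℝ, F) z.pt →ₗ[ℝ] Rn (Module.finrank ℝ F - m) :=
    (LinearMap.snd ℝ _ _ - (slope c z).toLinearMap ∘ₗ LinearMap.fst ℝ _ _) ∘ₗ
      (frame c z.pt).toLinearEquiv.toLinearMap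
  (Submodule.quotEquivOfEq z.plane (LinearMap.ker φ) (by
    ext v
    rw [mem_plane_iff h v, LinearMap.mem_ker]
    exact sub_eq_zero.symm)).trans
  (φ.quotKerEquivOfSurjective (fun b => ⟨(frame c z.pt).symm (0, b), by
    change (frame c z.pt ((frame c z.pt).symm (0, b))).2 -
      slope c z (frame c z.pt ((frame c z.pt).symm (0, b))).1 = b
    simp⟩))

theorem normalCoord_mk (c : ChartIndex F M m) (z : ContactElement F M m)
    (h : Function.Injective (firstCoord c z)) (v : TangentSpace 𝓘(ℝ, F) z.pt) :
    normalCoord c z h (Submodule.Quotient.mk v) =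
      (frame c z.pt v).2 - slope c z (frame c z.pt v).1 := rfl

/-- The fibre coordinates `v^α_{ij}` on the bundle `V^m J^m M`. -/
def vCoord (κ : Kind) (c : ChartIndex F M m) (z : ContactElement F M m)
    (h : Function.Injective (firstCoord c z)) :
    VFiber κ z ≃ₗ[ℝ] BilinModel κ m (Module.finrank ℝ F - m) :=
  bilinCoordEquiv κ (firstCoordEquiv c z h) (normalCoord c z h)

theorem vCoord_apply (κ : Kind) (c : ChartIndex F M m) (z : ContactElement F M m)
    (h : Function.Injective (firstCoord c z)) (v : VFiber κ z) (a b : Rn m) :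
    (vCoord κ c z h v).1 a b =
      normalCoord c z h (v.1 ((firstCoordEquiv c z h).symm a) ((firstCoordEquiv c z h).symm b)) :=
  rfl

theorem vCoord_symm_apply (κ : Kind) (c : ChartIndex F M m) (z : ContactElement F M m)
    (h : Function.Injective (firstCoord c z)) (w : BilinModel κ m (Module.finrank ℝ F - m))
    (a b : z.plane) :
    ((vCoord κ c z h).symm w).1 a b =
      (normalCoord c z h).symm (w.1 (firstCoordEquiv c z h a) (firstCoordEquiv c z h b)) :=
  rfl

/-- The change of coordinates on `T_x M / P`, at the contact element with coordinates `p`. -/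
def normalChange (c c' : ChartIndex F M m) (p : ContactModel F m) :
    Rn (Module.finrank ℝ F - m) →L[ℝ] Rn (Module.finrank ℝ F - m) :=
  (ContinuousLinearMap.snd ℝ _ _ - (changeMap c c' p).2 ∘L ContinuousLinearMap.fst ℝ _ _) ∘L
    (frameChange c c' p.1 ∘L ContinuousLinearMap.inr ℝ _ _)

theorem contDiffOn_normalChange (c c' : ChartIndex F M m) :
    ContDiffOn ℝ ∞ (normalChange c c') (changeDomain c c') := by
  refine ContDiffOn.clm_comp ?_ ?_
  · exact contDiffOn_const.sub ((contDiffOn_changeMap c c').snd.clm_comp contDiffOn_const)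
  · exact ((contDiffOn_frameChange c c').comp contDiffOn_fst
      (fun p hp => hp.1.1)).clm_comp contDiffOn_const

theorem normalCoord_change {c c' : ChartIndex F M m} {z : ContactElement F M m}
    (h : z ∈ chartDomain c) (h' : z ∈ chartDomain c') (b : Rn (Module.finrank ℝ F - m)) :
    normalCoord c' z h'.2 ((normalCoord c z h.2).symm b) =
      normalChange c c' (contactChart c z) b := by
  have h1 : (normalCoord c z h.2).symm b =
      Submodule.Quotient.mk ((frame c z.pt).symm (0, b)) := by
    rw [LinearEquiv.symm_apply_eq, normalCoord_mk]
    simp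
  rw [h1, normalCoord_mk, frame_comp_symm h.1 h'.1]
  have h2 : slope c' z = (changeMap c c' (contactChart c z)).2 :=
    congrArg Prod.snd (contactChart_change h h')
  rw [h2]
  rfl

theorem firstCoordEquiv_change {c c' : ChartIndex F M m} {z : ContactElement F M m}
    (h : z ∈ chartDomain c) (h' : z ∈ chartDomain c') (a : Rn m) :
    firstCoordEquiv c z h.2 ((firstCoordEquiv c' z h'.2).symm a) =
      Ring.inverse (planeChange₁ c c' (contactChart c z)) a := by
  have hu := (isUnit_planeChange₁_iff h h'.1).2 h'.2
  obtain ⟨v, rfl⟩ := (firstCoordEquiv c' z h'.2).surjective a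
  have h1 : firstCoordEquiv c' z h'.2 v =
      planeChange₁ c c' (contactChart c z) (firstCoordEquiv c z h.2 v) :=
    congrArg Prod.fst (firstCoord_change h h'.1 v)
  rw [LinearEquiv.symm_apply_apply, h1]
  have := congrArg (fun f : Rn m →L[ℝ] Rn m => f (firstCoordEquiv c z h.2 v))
    (Ring.inverse_mul_cancel _ hu)
  exact this.symm

variable [FiniteDimensional ℝ F]

theorem isOpen_chartDomain (c : ChartIndex F M m) : IsOpen (chartDomain c) :=
  (contactCore F M m).open_source' (e := contactChart c) (mem_range_self c)

/-- The local trivialization of `V^m J^m M` given by the coordinates `v^α_{ij}`. -/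
def vPretriv (κ : Kind) (c : ChartIndex F M m) :
    Pretrivialization (BilinModel κ m (Module.finrank ℝ F - m))
      (π (BilinModel κ m (Module.finrank ℝ F - m)) (VFiber (F := F) (M := M) (m := m) κ)) where
  toFun v := open Classical in
    (v.proj, if h : Function.Injective (firstCoord c v.proj) then vCoord κ c v.proj h v.2 else 0)
  invFun p := open Classical in
    ⟨p.1, if h : Function.Injective (firstCoord c p.1) then (vCoord κ c p.1 h).symm p.2 else 0⟩
  source := {v | v.proj ∈ chartDomain c}
  target := chartDomain c ×ˢ univ
  map_source' v hv := ⟨hv, mem_univ _⟩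
  map_target' p hp := hp.1
  left_inv' v hv := by
    have h : Function.Injective (firstCoord c v.proj) := hv.2
    simp only [dif_pos h, LinearEquiv.symm_apply_apply]
  right_inv' p hp := by
    have h : Function.Injective (firstCoord c p.1) := hp.1.2
    simp only [dif_pos h, LinearEquiv.apply_symm_apply]
  open_target := (isOpen_chartDomain c).prod isOpen_univ
  baseSet := chartDomain c
  open_baseSet := isOpen_chartDomain c
  source_eq := rfl
  target_eq := rfl
  proj_toFun _ _ := rfl

theorem vPretriv_apply (κ : Kind) (c : ChartIndex F M m) {z : ContactElement F M m}
    (h : z ∈ chartDomain c) (v : VFiber κ z) :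
    vPretriv κ c ⟨z, v⟩ = (z, vCoord κ c z h.2 v) := by
  change (z, _) = _
  rw [dif_pos h.2]

theorem vPretriv_symm_apply (κ : Kind) (c : ChartIndex F M m) {z : ContactElement F M m}
    (h : z ∈ chartDomain c) (w : BilinModel κ m (Module.finrank ℝ F - m)) :
    (vPretriv κ c).symm z w = (vCoord κ c z h.2).symm w := by
  have hz : z ∈ (vPretriv (F := F) (M := M) κ c).baseSet := h
  rw [Pretrivialization.symm_apply _ hz]
  have : (vPretriv κ c).toPartialEquiv.symm (z, w) = ⟨z, (vCoord κ c z h.2).symm w⟩ := by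
    change TotalSpace.mk z _ = _
    rw [dif_pos h.2]
  rw [cast_eq_iff_heq]
  rw [this]

/-- The fibres carry the topology given by linear coordinates. -/
instance (κ : Kind) (z : ContactElement F M m) : TopologicalSpace (VFiber κ z) :=
  TopologicalSpace.induced (vCoord κ (chartIndexAt z) z (mem_chartDomain_chartIndexAt z).2)
    inferInstance

/-- The change of fibre coordinates on `V^m J^m M`. -/
def vChange (κ : Kind) (c c' : ChartIndex F M m) (z : ContactElement F M m) :
    BilinModel κ m (Module.finrank ℝ F - m) →L[ℝ] BilinModel κ m (Module.finrank ℝ F - m) :=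
  open Classical in
  if h : z ∈ chartDomain c ∧ z ∈ chartDomain c' then
    LinearMap.toContinuousLinearMap
      ((vCoord κ c z h.1.2).symm.trans (vCoord κ c' z h.2.2)).toLinearMap
  else 0

theorem vChange_apply (κ : Kind) {c c' : ChartIndex F M m} {z : ContactElement F M m}
    (h : z ∈ chartDomain c) (h' : z ∈ chartDomain c')
    (w : BilinModel κ m (Module.finrank ℝ F - m)) (a b : Rn m) :
    (vChange κ c c' z w).1 a b = normalChange c c' (contactChart c z)
      (w.1 (Ring.inverse (planeChange₁ c c' (contactChart c z)) a)
        (Ring.inverse (planeChange₁ c c' (contactChart c z)) b)) := by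
  rw [← normalCoord_change h h', ← firstCoordEquiv_change h h', ← firstCoordEquiv_change h h']
  rw [vChange, dif_pos ⟨h, h'⟩]
  rfl

theorem contDiffOn_vChange (κ : Kind) (c c' : ChartIndex F M m) :
    ContDiffOn ℝ ∞ (fun p => vChange κ c c' ((contactChart c).symm p)) (changeDomain c c') := by
  obtain ⟨L, hL⟩ := (bilinModel κ m (Module.finrank ℝ F - m)).exists_isCompl
  have hN := contDiffOn_inverse_planeChange₁ c c'
  have hR := contDiffOn_normalChange c c'
  rw [contDiffOn_clm_apply]
  intro w
  have h1 : ContDiffOn ℝ ∞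
      (fun p => (vChange κ c c' ((contactChart c).symm p) w).1) (changeDomain c c') := by
    rw [contDiffOn_clm_apply]
    intro a
    rw [contDiffOn_clm_apply]
    intro b
    have h2 : ContDiffOn ℝ ∞ (fun p => normalChange c c' p
        (w.1 (Ring.inverse (planeChange₁ c c' p) a) (Ring.inverse (planeChange₁ c c' p) b)))
        (changeDomain c c') :=
      hR.clm_apply ((contDiffOn_const.clm_apply (hN.clm_apply contDiffOn_const)).clm_apply
        (hN.clm_apply contDiffOn_const))
    refine h2.congr (fun p hp => ?_)
    rw [← contactChart_symm_trans_source] at hp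
    rw [vChange_apply κ ((contactChart c).map_target hp.1) hp.2, (contactChart c).right_inv hp.1]
  let Pr := (LinearMap.toContinuousLinearMap
    (Submodule.projectionOnto (bilinModel κ m (Module.finrank ℝ F - m)) L hL))
  have h3 := Pr.contDiff.comp_contDiffOn h1
  refine h3.congr (fun p _ => ?_)
  exact (Submodule.projectionOnto_apply_left hL _).symm

theorem contMDiffOn_vChange (κ : Kind) (c c' : ChartIndex F M m) :
    ContMDiffOn 𝓘(ℝ, ContactModel F m)
      𝓘(ℝ, BilinModel κ m (Module.finrank ℝ F - m) →L[ℝ] BilinModel κ m (Module.finrank ℝ F - m))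
      ∞ (vChange κ c c') (chartDomain c ∩ chartDomain c') := by
  have h1 : (contactCore F M m).openPartialHomeomorph (contactChart c) (mem_range_self c) ∈
      IsManifold.maximalAtlas 𝓘(ℝ, ContactModel F m) ∞ (ContactElement F M m) :=
    IsManifold.subset_maximalAtlas ((mem_contactAtlas_iff _).2 ⟨c, rfl⟩)
  have h2 := contMDiffOn_of_mem_maximalAtlas h1
  have h2' : ContMDiffOn 𝓘(ℝ, ContactModel F m) 𝓘(ℝ, ContactModel F m) ∞ (contactChart c)
      (chartDomain c ∩ chartDomain c') := h2.mono (fun z hz => hz.1)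
  have h3 := (contDiffOn_vChange κ c c').contMDiffOn.comp h2'
    (fun z (hz : z ∈ chartDomain c ∧ z ∈ chartDomain c') => by
      change contactChart c z ∈ changeDomain c c'
      rw [← contactChart_symm_trans_source]
      refine ⟨(contactChart c).map_source hz.1, ?_⟩
      change (contactChart c).symm (contactChart c z) ∈ chartDomain c'
      rw [(contactChart c).left_inv hz.1]
      exact hz.2)
  refine h3.congr (fun z hz => ?_)
  change _ = vChange κ c c' ((contactChart c).symm (contactChart c z))
  rw [(contactChart c).left_inv hz.1]

theorem vPretriv_change (κ : Kind) {c c' : ChartIndex F M m} {z : ContactElement F M m}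
    (h : z ∈ chartDomain c) (h' : z ∈ chartDomain c')
    (w : BilinModel κ m (Module.finrank ℝ F - m)) :
    vChange κ c c' z w = (vPretriv κ c' ⟨z, (vPretriv κ c).symm z w⟩).2 := by
  rw [vPretriv_symm_apply κ c h, vPretriv_apply κ c' h', vChange, dif_pos ⟨h, h'⟩]
  rfl

variable (F M m) in
/-- The local trivializations given by the coordinates `v^α_{ij}` define a vector bundle. -/
def vPrebundle (κ : Kind) :
    VectorPrebundle ℝ (BilinModel κ m (Module.finrank ℝ F - m))
      (VFiber (F := F) (M := M) (m := m) κ) where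
  pretrivializationAtlas := range (vPretriv κ)
  pretrivialization_linear' := by
    rintro _ ⟨c, rfl⟩
    refine ⟨fun z hz => ?_⟩
    have h : z ∈ chartDomain c := hz
    constructor
    · intro v w
      rw [vPretriv_apply κ c h, vPretriv_apply κ c h, vPretriv_apply κ c h, map_add]
    · intro r v
      rw [vPretriv_apply κ c h, vPretriv_apply κ c h, map_smul]
  pretrivializationAt z := vPretriv κ (chartIndexAt z)
  mem_base_pretrivializationAt z := mem_chartDomain_chartIndexAt z
  pretrivialization_mem_atlas z := mem_range_self _
  exists_coordChange := by
    rintro _ ⟨c, rfl⟩ _ ⟨c', rfl⟩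
    exact ⟨vChange κ c c', (contMDiffOn_vChange κ c c').continuousOn,
      fun z hz w => vPretriv_change κ hz.1 hz.2 w⟩
  totalSpaceMk_isInducing z := by
    have h : vPretriv κ (chartIndexAt z) ∘ TotalSpace.mk z = Prod.mk z ∘
        vCoord κ (chartIndexAt z) z (mem_chartDomain_chartIndexAt z).2 := by
      funext v
      exact vPretriv_apply κ _ (mem_chartDomain_chartIndexAt z) v
    rw [h]
    exact (isInducing_prodMkRight z).comp ⟨rfl⟩

instance (κ : Kind) : TopologicalSpace (TotalSpace (BilinModel κ m (Module.finrank ℝ F - m))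
    (VFiber (F := F) (M := M) (m := m) κ)) :=
  (vPrebundle F M m κ).totalSpaceTopology

instance (κ : Kind) : FiberBundle (BilinModel κ m (Module.finrank ℝ F - m))
    (VFiber (F := F) (M := M) (m := m) κ) :=
  (vPrebundle F M m κ).toFiberBundle

instance (κ : Kind) : VectorBundle ℝ (BilinModel κ m (Module.finrank ℝ F - m))
    (VFiber (F := F) (M := M) (m := m) κ) :=
  (vPrebundle F M m κ).toVectorBundle

instance (κ : Kind) : (vPrebundle F M m κ).IsContMDiff 𝓘(ℝ, ContactModel F m) ∞ where
  exists_contMDiffCoordChange := by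
    rintro _ ⟨c, rfl⟩ _ ⟨c', rfl⟩
    exact ⟨vChange κ c c', contMDiffOn_vChange κ c c',
      fun z hz w => vPretriv_change κ hz.1 hz.2 w⟩

instance (κ : Kind) : ContMDiffVectorBundle ∞ (BilinModel κ m (Module.finrank ℝ F - m))
    (VFiber (F := F) (M := M) (m := m) κ) 𝓘(ℝ, ContactModel F m) :=
  VectorPrebundle.contMDiffVectorBundle (IB := 𝓘(ℝ, ContactModel F m)) (n := ∞) (vPrebundle F M m κ)

end VerticalBundle

/-! ### Velocities -/

section Velocities

/-- The manifold `T_m M` of first order `m`-velocities in `M`: a velocity `j_0 γ` consists of the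
point `γ(0)` and the derivative `ℝ^m → T_{γ(0)} M` of `γ` at zero. The smooth structure is that of
the vector bundle `TM ⊗ ℝ^{m*}` over `M`. -/
abbrev Velocity (m : ℕ) {F H : Type*} [NormedAddCommGroup F] [NormedSpace ℝ F]
    [TopologicalSpace H] (I : ModelWithCorners ℝ F H) (M : Type*) [TopologicalSpace M]
    [ChartedSpace H M] :=
  TotalSpace (Rn m →L[ℝ] F) (fun x : M => Bundle.Trivial M (Rn m) x →L[ℝ] TangentSpace I x)

variable {m : ℕ} {F H : Type*} [NormedAddCommGroup F] [NormedSpace ℝ F] [TopologicalSpace H]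
  (I : ModelWithCorners ℝ F H) {M : Type*} [TopologicalSpace M] [ChartedSpace H M]
  {F' H' : Type*} [NormedAddCommGroup F'] [NormedSpace ℝ F'] [TopologicalSpace H']
  (I' : ModelWithCorners ℝ F' H') {M' : Type*} [TopologicalSpace M'] [ChartedSpace H' M']

/-- The velocity `j_0 γ` of a map `γ` defined near zero in `ℝ^m`. -/
def velocity (γ : Rn m → M) : Velocity m I M :=
  ⟨γ 0, mfderiv 𝓘(ℝ, Rn m) I γ 0⟩

/-- The prolongation `t ↦ j_0 (γ ∘ tr_t)` of a map `γ`, where `tr_t s = s + t`. -/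
def prolongation (γ : Rn m → M) (t : Rn m) : Velocity m I M :=
  velocity I (fun s => γ (s + t))

/-- The prolonged map `T_m f : T_m M → T_m M'`, `j_0 γ ↦ j_0 (f ∘ γ)`. -/
def velocityMap (f : M → M') (v : Velocity m I M) : Velocity m I' M' :=
  ⟨f v.proj, mfderiv I I' f v.proj ∘L v.2⟩

variable {I} in
/-- A velocity `j_0 γ` is regular if `γ` is an immersion at zero. -/
def IsRegular (v : Velocity m I M) : Prop := Function.Injective v.2

theorem isOpen_isRegular [IsManifold I ∞ M] : IsOpen {v : Velocity m I M | IsRegular v} := by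
  rw [isOpen_iff_mem_nhds]
  intro v hv
  let e := trivializationAt (Rn m →L[ℝ] F)
    (fun x : M => Bundle.Trivial M (Rn m) x →L[ℝ] TangentSpace I x) v.proj
  have he : IsOpen (e.source ∩ e ⁻¹' {p | Function.Injective p.2}) :=
    e.continuousOn.isOpen_inter_preimage e.open_source
      (ContinuousLinearMap.isOpen_injective.preimage continuous_snd)
  have key : ∀ w ∈ e.source, (Function.Injective (e w).2 ↔ IsRegular w) := by
    intro w hw
    have hw1 : w.proj ∈ e.baseSet := e.mem_source.1 hw
    have hw2 : w.proj ∈ (trivializationAt F (TangentSpace I) v.proj).baseSet := by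
      have := hw1
      rw [hom_trivializationAt_baseSet] at this
      exact this.2
    have h1 : e w = _ := hom_trivializationAt_apply (RingHom.id ℝ) v.proj w
    rw [h1, ContinuousLinearMap.inCoordinates_eq (mem_univ _) hw2]
    simp only [ContinuousLinearMap.coe_comp, ContinuousLinearEquiv.coe_coe]
    rw [EquivLike.comp_injective, EquivLike.injective_comp]
    rfl
  have hv' : v ∈ e.source := FiberBundle.mem_trivializationAt_proj_source
  filter_upwards [he.mem_nhds ⟨hv', (key v hv').2 hv⟩] with w hw
  exact (key w hw.1).1 hw.2

variable (m M) in
/-- The manifold `F_m M` of regular velocities, as an open submanifold of `T_m M`. -/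
def regularVelocities [IsManifold I ∞ M] : TopologicalSpace.Opens (Velocity m I M) :=
  ⟨{v | IsRegular v}, isOpen_isRegular I⟩

/-- The contact element `[j_0 γ]` determined by a regular velocity. -/
def contactOf {M : Type*} [TopologicalSpace M] [ChartedSpace F M] (v : Velocity m 𝓘(ℝ, F) M)
    (hv : IsRegular v) : ContactElement F M m where
  pt := v.proj
  plane := LinearMap.range v.2.toLinearMap
  finrank_plane := by
    rw [LinearMap.finrank_range_of_inj hv]
    exact finrank_euclideanSpace_fin

end Velocities

/-! ### Double velocities and double contact elements -/

section Double

variable {F : Type*} [NormedAddCommGroup F] [NormedSpace ℝ F]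
  {M : Type*} [TopologicalSpace M] [ChartedSpace F M] {m : ℕ}

variable (F m) in
/-- The model with corners of the manifold `T_m M`. -/
abbrev velocityModel := 𝓘(ℝ, F).prod 𝓘(ℝ, Rn m →L[ℝ] F)

variable [IsManifold 𝓘(ℝ, F) ∞ M]

variable (F M m) in
/-- The manifold `T_m T_m M` of double velocities. -/
abbrev DoubleVelocity := Velocity m (velocityModel F m) (Velocity m 𝓘(ℝ, F) M)

/-- A double velocity is semiholonomic if its two projections to `T_m M` agree. -/
def IsSemiholonomic (w : DoubleVelocity F M m) : Prop :=
  velocityMap (velocityModel F m) 𝓘(ℝ, F) TotalSpace.proj w = w.proj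

/-- A double velocity is holonomic if it has a representative map which is the prolongation of a
smooth map, defined on a neighbourhood `O` of zero. -/
def IsHolonomic (w : DoubleVelocity F M m) : Prop :=
  ∃ (O : Set (Rn m)) (γ : Rn m → M), IsOpen O ∧ 0 ∈ O ∧ ContMDiffOn 𝓘(ℝ, Rn m) 𝓘(ℝ, F) ∞ γ O ∧
    w = velocity (velocityModel F m) (prolongation 𝓘(ℝ, F) γ)

/-- The action of matrices on velocities, `j_0 γ · j_0 φ = j_0 (γ ∘ φ)`. -/
def velocityScale (p : Velocity m 𝓘(ℝ, F) M × (Rn m →L[ℝ] Rn m)) : Velocity m 𝓘(ℝ, F) M :=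
  ⟨p.1.proj, p.1.2 ∘L p.2⟩

/-- The action on double velocities of the element `(j_0 φ, j_0 σ)` of the principal jet group,
where `A` is the derivative of `φ` at zero, `C = σ(0)` and `B` is the derivative of `σ` at zero:
the double velocity `j_0 γ` is mapped to `j_0 (t ↦ γ(φ(t)) · σ(t))`. -/
def doubleVelocityAct (w : DoubleVelocity F M m) (A C : Rn m →L[ℝ] Rn m)
    (B : Rn m →L[ℝ] Rn m →L[ℝ] Rn m) : DoubleVelocity F M m :=
  ⟨velocityScale (w.proj, C),
    mfderiv ((velocityModel F m).prod 𝓘(ℝ, Rn m →L[ℝ] Rn m)) (velocityModel F m) velocityScale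
      (w.proj, C) ∘L (w.2 ∘L A).prod B⟩

/-- The inclusion of the fibre of `T_m M` over `x`. -/
def velocityFiberIncl (x : M) (L : Rn m →L[ℝ] F) : Velocity m 𝓘(ℝ, F) M := ⟨x, L⟩

/-- The vertical tangent vectors to `T_m M` at `u` are identified, by the derivative of the
inclusion of the fibre, with linear maps `ℝ^m → T_x M`. So a bilinear map `β` determines a linear
map from `ℝ^m` to the vertical tangent vectors at `u`. -/
def verticalLift (u : Velocity m 𝓘(ℝ, F) M)
    (β : Rn m →L[ℝ] Rn m →L[ℝ] TangentSpace 𝓘(ℝ, F) u.proj) :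
    Rn m →L[ℝ] TangentSpace (velocityModel F m) u :=
  let L : Rn m →L[ℝ] F := u.2
  let β' : Rn m →L[ℝ] Rn m →L[ℝ] F := β
  mfderiv 𝓘(ℝ, Rn m →L[ℝ] F) (velocityModel F m) (velocityFiberIncl u.proj) L ∘L β'

/-- The vertical double velocity at `u` determined by a bilinear map. -/
def verticalVelocity (u : Velocity m 𝓘(ℝ, F) M)
    (β : Rn m →L[ℝ] Rn m →L[ℝ] TangentSpace 𝓘(ℝ, F) u.proj) : DoubleVelocity F M m :=
  ⟨u, verticalLift u β⟩

/-- The sum of a double velocity and a vertical double velocity at the same point of `T_m M`. -/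
def addVertical (w : DoubleVelocity F M m)
    (β : Rn m →L[ℝ] Rn m →L[ℝ] TangentSpace 𝓘(ℝ, F) w.proj.proj) : DoubleVelocity F M m :=
  ⟨w.proj, w.2 + verticalLift w.proj β⟩

/-- The point of `V^m J^m M` determined by a vertical double velocity: the bilinear map `β` on
`ℝ^m` induces a bilinear map on the plane, with values in the quotient by the plane. -/
def verticalClass (κ : Kind) (u : Velocity m 𝓘(ℝ, F) M) (hu : IsRegular u)
    (β : Rn m →L[ℝ] Rn m →L[ℝ] TangentSpace 𝓘(ℝ, F) u.proj) (hβ : κ.Holds (fun s t => β s t)) :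
    TotalSpace (BilinModel κ m (Module.finrank ℝ F - m)) (VFiber (F := F) (M := M) (m := m) κ) :=
  ⟨contactOf u hu,
    ⟨(β.toLinearMap₁₂.compl₁₂ (LinearEquiv.ofInjective u.2.toLinearMap hu).symm.toLinearMap
        (LinearEquiv.ofInjective u.2.toLinearMap hu).symm.toLinearMap).compr₂
        (contactOf u hu).plane.mkQ,
      hβ.map (contactOf u hu).plane.mkQ.toAddMonoidHom
        (LinearEquiv.ofInjective u.2.toLinearMap hu).symm⟩⟩

/-- The inclusion of the symmetric or skew-symmetric part into `V^m J^m M`. -/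
def vIncl (κ : Kind)
    (v : TotalSpace (BilinModel κ m (Module.finrank ℝ F - m))
      (VFiber (F := F) (M := M) (m := m) κ)) :
    TotalSpace (BilinModel .all m (Module.finrank ℝ F - m))
      (VFiber (F := F) (M := M) (m := m) .all) :=
  ⟨v.proj, ⟨v.2.1, trivial⟩⟩

variable [FiniteDimensional ℝ F]

variable (F M m) in
/-- The manifold `J^m J^m M` of double contact elements. -/
abbrev DoubleContactElement :=
  ContactElement (ContactModel F m) (ContactElement F M m) m

/-- The projection `ρ : F_m M → J^m M`. -/
def contactProj (u : regularVelocities m 𝓘(ℝ, F) M) : ContactElement F M m :=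
  contactOf u.1 u.2

/-- The double velocity `W` represents the double contact element `z`, that is `z = [[W]]`: the
velocity `W` lies in `T_m F_m M`, its image under `T_m ρ` is a regular velocity in `J^m M`, and
`z` is the contact element determined by this image. -/
def Represents (W : DoubleVelocity F M m) (z : DoubleContactElement F M m) : Prop :=
  ∃ (w : Velocity m (velocityModel F m) (regularVelocities m 𝓘(ℝ, F) M))
    (h : IsRegular (velocityMap (velocityModel F m) 𝓘(ℝ, ContactModel F m) contactProj w)),
    velocityMap (velocityModel F m) (velocityModel F m) Subtype.val w = W ∧
    contactOf (velocityMap (velocityModel F m) 𝓘(ℝ, ContactModel F m) contactProj w) h = z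

variable (F M m) in
/-- The set of semiholonomic double contact elements. -/
def semiholonomicContact : Set (DoubleContactElement F M m) :=
  {z | ∃ W, Represents W z ∧ IsSemiholonomic W}

variable (F M m) in
/-- The set of holonomic double contact elements. -/
def holonomicContact : Set (DoubleContactElement F M m) :=
  {z | ∃ W, Represents W z ∧ IsHolonomic W}

end Double

/-! ### Submanifolds and affine bundles -/

section Bundles

variable {EX X : Type*} [NormedAddCommGroup EX] [NormedSpace ℝ EX] [TopologicalSpace X]
  [ChartedSpace EX X]

variable (EX) in
/-- The subset `S` is a (smooth, embedded) submanifold of dimension `d` of the manifold `X`: around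
each of its points there is a chart in which it is given by a linear subspace of dimension `d`. -/
def IsSubmanifold (S : Set X) (d : ℕ) : Prop :=
  ∀ z ∈ S, ∃ φ ∈ IsManifold.maximalAtlas 𝓘(ℝ, EX) ∞ X, z ∈ φ.source ∧
    ∃ L : Submodule ℝ EX, Module.finrank ℝ L = d ∧ ∀ y ∈ φ.source, y ∈ S ↔ φ y ∈ L

variable {EB B W : Type*} [NormedAddCommGroup EB] [NormedSpace ℝ EB] [TopologicalSpace B]
  [ChartedSpace EB B] [NormedAddCommGroup W] [NormedSpace ℝ W] {V : B → Type*}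
  [TopologicalSpace (TotalSpace W V)] [∀ b, TopologicalSpace (V b)] [∀ b, AddCommGroup (V b)]
  [∀ b, Module ℝ (V b)] [FiberBundle W V]

variable (EX EB) in
/-- The submanifold `S` of `X` is, with the projection `pr` to `B` and the action `add`, an affine
bundle modelled on the smooth vector bundle `V` over `B`. -/
structure IsAffineBundle (S : Set X) (pr : X → B) (add : X → TotalSpace W V → X) : Prop where
  smooth_proj : ContMDiffOn 𝓘(ℝ, EX) 𝓘(ℝ, EB) ∞ pr S
  /-- The action preserves `S` and its fibres. -/
  mem : ∀ z ∈ S, ∀ v : V (pr z), add z ⟨pr z, v⟩ ∈ S ∧ pr (add z ⟨pr z, v⟩) = pr z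
  zero_act : ∀ z ∈ S, add z ⟨pr z, 0⟩ = z
  add_act : ∀ z ∈ S, ∀ v w : V (pr z),
    add z ⟨pr z, v + w⟩ = add (add z ⟨pr z, v⟩) ⟨pr z, w⟩
  /-- The action is simply transitive on the fibres. -/
  simply_transitive : ∀ z ∈ S, ∀ z' ∈ S, pr z' = pr z → ∃! v : V (pr z), add z ⟨pr z, v⟩ = z'
  /-- Local triviality: near each point of the base there is a smooth local section `σ` such that
  `v ↦ σ + v` is a diffeomorphism from `V` to `S` (over the given open set), with inverse `δ`. -/
  locally_trivial : ∀ b : B, ∃ U : Set B, IsOpen U ∧ b ∈ U ∧ ∃ σ : B → X,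
    ContMDiffOn 𝓘(ℝ, EB) 𝓘(ℝ, EX) ∞ σ U ∧ (∀ x ∈ U, σ x ∈ S ∧ pr (σ x) = x) ∧
    ContMDiffOn (𝓘(ℝ, EB).prod 𝓘(ℝ, W)) 𝓘(ℝ, EX) ∞ (fun v : TotalSpace W V => add (σ v.proj) v)
      {v | v.proj ∈ U} ∧
    ∃ δ : X → TotalSpace W V,
      ContMDiffOn 𝓘(ℝ, EX) (𝓘(ℝ, EB).prod 𝓘(ℝ, W)) ∞ δ (S ∩ pr ⁻¹' U) ∧
      ∀ z ∈ S ∩ pr ⁻¹' U, (δ z).proj = pr z ∧ add (σ (pr z)) (δ z) = z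

/-- The map `f` restricts to a diffeomorphism from the submanifold `S` of `X` to the submanifold
`T` of `Y`: it is a bijection from `S` to `T`, smooth on `S`, with smooth inverse on `T`. -/
def IsDiffeomorphismOn {E₁ H₁ E₂ H₂ X Y : Type*} [NormedAddCommGroup E₁] [NormedSpace ℝ E₁]
    [TopologicalSpace H₁] [NormedAddCommGroup E₂] [NormedSpace ℝ E₂] [TopologicalSpace H₂]
    [TopologicalSpace X] [ChartedSpace H₁ X] [TopologicalSpace Y] [ChartedSpace H₂ Y]
    (I₁ : ModelWithCorners ℝ E₁ H₁) (I₂ : ModelWithCorners ℝ E₂ H₂)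
    (f : X → Y) (S : Set X) (T : Set Y) : Prop :=
  BijOn f S T ∧ ContMDiffOn I₁ I₂ ∞ f S ∧ ∃ g : Y → X, InvOn g f S T ∧ ContMDiffOn I₂ I₁ ∞ g T

end Bundles

end DoubleContact

end

open DoubleContact

/-!
The theorem is a computation in one family of charts, made independent of charts by a comparison
with double velocities.

Let `c` be a chart of `J^m E` with coordinates `(y, A)`: the contact element is the graph of `A` in
split linear coordinates. A semiholonomic double velocity at `u = (x, L)`, with `L = (L₁, L₂)` in
split coordinates and with second order part `N(t, s) = (N₁, N₂)`, is mapped by the prolonged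
projection `T_m ρ` to `t ↦ (L t, A'(t))`. Since `A L₁ = L₂`, the derivative of the slope satisfies
`A'(t) L₁ s = N₂(t, s) - A N₁(t, s)` (`fderiv_slopeMap`, `tangentCoord_mfderiv_contactExt`). So the
double contact element represented is the graph of `a ↦ (A a, β a)` over `ℝ^m`, where
`β(L₁ t, L₁ s) = N₂(t, s) - A N₁(t, s)` (`represents_semiElement`). Therefore, in the chart of
`J^m J^m E` belonging to `c`, the semiholonomic elements are those for which the `E`-part of the
slope is `A`, and they have the coordinates `(y, A, β)` with an arbitrary bilinear map `β`.

A holonomic double velocity is the velocity of a prolongation, so that `N` is a second derivative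
and is symmetric. Conversely, a symmetric `β` is realized by a quadratic map
(`exists_isHolonomic_represents`). Hence the holonomic elements are those with `β` symmetric.
Adding a vertical double velocity `(u, b)` adds to `β` the fibre coordinates of the class of
`(u, b)` in `V^m J^m E` (`represents_addVertical`). As double velocities do not refer to `c`, the
operation `β ↦ β + v` on coordinates is the same in all charts (`addContact_semiElement`).

Now everything is linear algebra on `β`. The sets `β` arbitrary and `β` symmetric are linear
subspaces of the coordinate space (`IsSecondOrderSet.isSubmanifold`), translation by `v` is simply
transitive on them and `β = 0` is a local section (`IsSecondOrderSet.isAffineBundle`), and the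
splitting of `β` into its symmetric and its skew-symmetric part gives the decomposition
(`isDiffeomorphismOn_addContact`).

For the description of `V^m J^m E` by orbits (`verticalClass_eq_iff`), `(A, B)` maps `(u, β)` to
`(u A, β(A·, A·) + L B)`: two vertical double velocities are in the same orbit if and only if their
planes agree and, after a change of basis, the difference of their bilinear maps takes values in the
plane. The form `B` has the symmetry of this difference, as `L` is injective.
-/

noncomputable section

namespace DoubleContact

/-! ### Charts of the manifold of velocities -/

section TangentCoordinates

variable {F : Type*} [NormedAddCommGroup F] [NormedSpace ℝ F]
  {M : Type*} [TopologicalSpace M] [ChartedSpace F M] [IsManifold 𝓘(ℝ, F) ∞ M] {m : ℕ}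

theorem mdifferentiableAt_of_mem_atlas (e : atlas F M) {x : M} (hx : x ∈ e.1.source) :
    MDifferentiableAt 𝓘(ℝ, F) 𝓘(ℝ, F) e.1 x :=
  (contMDiffAt_of_mem_maximalAtlas (n := ∞) (IsManifold.subset_maximalAtlas e.2) hx).mdifferentiableAt
    (by simp)

theorem mfderiv_eq_tangentCoord (e : atlas F M) {x : M} (hx : x ∈ e.1.source)
    (v : TangentSpace 𝓘(ℝ, F) x) :
    mfderiv 𝓘(ℝ, F) 𝓘(ℝ, F) e.1 x v = tangentCoord e x v := by
  have h : (mfderiv 𝓘(ℝ, F) 𝓘(ℝ, F) e.1 x : TangentSpace 𝓘(ℝ, F) x →L[ℝ] F) =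
      (tangentBundleCore 𝓘(ℝ, F) M).coordChange (achart F x) e x :=
    if_pos (mdifferentiableAt_of_mem_atlas e hx)
  have h' : tangentCoord e x = tangentChange e x hx := dif_pos hx
  exact (congrArg (fun f : F →L[ℝ] F => f v) h).trans
    (congrArg (fun f : F ≃L[ℝ] F => f v) h').symm

/-- The trivialization of the tangent bundle given by a chart of the manifold. -/
def tangentTriv (e : atlas F M) :
    Trivialization F (π F (TangentSpace 𝓘(ℝ, F) : M → Type _)) :=
  (tangentBundleCore 𝓘(ℝ, F) M).localTriv e

instance (e : atlas F M) : MemTrivializationAtlas (tangentTriv e) :=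
  ⟨⟨e, rfl⟩⟩

instance : MemTrivializationAtlas (Bundle.Trivial.trivialization M (Rn m)) :=
  ⟨mem_singleton _⟩

theorem continuousLinearMapAt_tangentTriv (e : atlas F M) {x : M} (hx : x ∈ e.1.source)
    (v : TangentSpace 𝓘(ℝ, F) x) :
    (tangentTriv e).continuousLinearMapAt ℝ x v = tangentCoord e x v := by
  have h' : tangentCoord e x = tangentChange e x hx := dif_pos hx
  have h : (tangentTriv e).linearMapAt ℝ x v = _ :=
    (tangentTriv e).linearMapAt_apply (R := ℝ) v
  rw [if_pos (show x ∈ (tangentTriv e).baseSet from hx)] at h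
  exact h.trans (congrArg (fun f : F ≃L[ℝ] F => f v) h').symm

variable (m) in
/-- The trivialization of the bundle of velocities given by a chart of the manifold. -/
def velocityTriv (e : atlas F M) :
    Trivialization (Rn m →L[ℝ] F) (π (Rn m →L[ℝ] F)
      (fun x : M => Bundle.Trivial M (Rn m) x →L[ℝ] TangentSpace 𝓘(ℝ, F) x)) :=
  Trivialization.continuousLinearMap (RingHom.id ℝ) (Bundle.Trivial.trivialization M (Rn m))
    (tangentTriv e)

instance (e : atlas F M) : MemTrivializationAtlas (velocityTriv m e) := by
  unfold velocityTriv; infer_instance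

theorem mem_velocityTriv_source {e : atlas F M} {u : Velocity m 𝓘(ℝ, F) M} :
    u ∈ (velocityTriv m e).source ↔ u.proj ∈ e.1.source := by
  rw [Trivialization.mem_source]
  change u.proj ∈ univ ∩ e.1.source ↔ _
  rw [univ_inter]

/-- The derivative part of a velocity in the linear coordinates given by a chart. -/
def velocityLin (e : atlas F M) (u : Velocity m 𝓘(ℝ, F) M) : Rn m →L[ℝ] F :=
  (tangentCoord e u.proj : TangentSpace 𝓘(ℝ, F) u.proj →L[ℝ] F) ∘L
    (u.2 : Rn m →L[ℝ] TangentSpace 𝓘(ℝ, F) u.proj)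

theorem velocityTriv_snd {e : atlas F M} {u : Velocity m 𝓘(ℝ, F) M} (hu : u.proj ∈ e.1.source) :
    (velocityTriv m e u).2 = velocityLin e u := by
  rw [velocityTriv, Trivialization.continuousLinearMap_apply]
  ext1 t
  refine (continuousLinearMapAt_tangentTriv e hu _).trans ?_
  have h : (Bundle.Trivial.trivialization M (Rn m)).symmL ℝ u.proj t = t :=
    congrArg (fun f : Rn m →L[ℝ] Rn m => f t) (Bundle.Trivial.symmL_trivialization ℝ M (Rn m) u.proj)
  exact congrArg (fun s : Rn m => tangentCoord e u.proj (u.2 s)) h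

variable {EN HN N : Type*} [NormedAddCommGroup EN] [NormedSpace ℝ EN] [TopologicalSpace HN]
  [TopologicalSpace N] [ChartedSpace HN N] {IN : ModelWithCorners ℝ EN HN}

/-- Smoothness of a map into the velocity bundle is smoothness of its base point and of its
derivative part in linear coordinates. -/
theorem contMDiffAt_velocity_iff (e : atlas F M) {f : N → Velocity m 𝓘(ℝ, F) M} {x : N}
    (hx : (f x).proj ∈ e.1.source) :
    ContMDiffAt IN (velocityModel F m) ∞ f x ↔
      ContMDiffAt IN 𝓘(ℝ, F) ∞ (fun y => (f y).proj) x ∧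
      ContMDiffAt IN 𝓘(ℝ, Rn m →L[ℝ] F) ∞ (fun y => velocityLin e (f y)) x := by
  rw [Trivialization.contMDiffAt_iff (e := velocityTriv m e) (mem_velocityTriv_source.2 hx)]
  refine and_congr_right fun h => Filter.EventuallyEq.contMDiffAt_iff ?_
  filter_upwards [h.continuousAt.preimage_mem_nhds (e.1.open_source.mem_nhds hx)] with y hy
  exact velocityTriv_snd hy

/-- The coordinates on the manifold of velocities given by a chart. -/
def velCoord (e : atlas F M) (u : Velocity m 𝓘(ℝ, F) M) : F × (Rn m →L[ℝ] F) :=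
  (e.1 u.proj, velocityLin e u)

theorem contMDiffAt_velCoord (e : atlas F M) {u : Velocity m 𝓘(ℝ, F) M}
    (hu : u.proj ∈ e.1.source) :
    ContMDiffAt (velocityModel F m) 𝓘(ℝ, F × (Rn m →L[ℝ] F)) ∞ (velCoord (m := m) e) u := by
  have h := (contMDiffAt_velocity_iff (m := m) e (f := id) hu).1 contMDiffAt_id
  have h1 := contMDiffAt_of_mem_maximalAtlas (n := ∞)
    (IsManifold.subset_maximalAtlas (I := 𝓘(ℝ, F)) e.2) hu
  exact (h1.comp u h.1).prodMk_space h.2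

end TangentCoordinates

/-! ### Derivatives of maps between manifolds of velocities -/

section VelocityCalculus

variable {F : Type*} [NormedAddCommGroup F] [NormedSpace ℝ F]
  {M : Type*} [TopologicalSpace M] [ChartedSpace F M] [IsManifold 𝓘(ℝ, F) ∞ M] {m : ℕ}

/-- The derivative at `u` of the coordinates on the manifold of velocities given by a chart. -/
def velDeriv (e : atlas F M) (u : Velocity m 𝓘(ℝ, F) M) :
    TangentSpace (velocityModel F m) u →L[ℝ] F × (Rn m →L[ℝ] F) :=
  mfderiv (velocityModel F m) 𝓘(ℝ, F × (Rn m →L[ℝ] F)) (velCoord (m := m) e) u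

theorem hasMFDerivAt_velCoord (e : atlas F M) {u : Velocity m 𝓘(ℝ, F) M}
    (hu : u.proj ∈ e.1.source) :
    HasMFDerivAt (velocityModel F m) 𝓘(ℝ, F × (Rn m →L[ℝ] F)) (velCoord (m := m) e) u
      (velDeriv e u) :=
  ((contMDiffAt_velCoord e hu).mdifferentiableAt (by simp)).hasMFDerivAt

theorem mdifferentiableAt_proj (u : Velocity m 𝓘(ℝ, F) M) :
    MDifferentiableAt (velocityModel F m) 𝓘(ℝ, F)
      (TotalSpace.proj : Velocity m 𝓘(ℝ, F) M → M) u :=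
  (contMDiffAt_proj (n := ∞) _).mdifferentiableAt (by simp)

theorem fst_velDeriv (e : atlas F M) {u : Velocity m 𝓘(ℝ, F) M} (hu : u.proj ∈ e.1.source)
    (ξ : TangentSpace (velocityModel F m) u) :
    (velDeriv e u ξ).1 = tangentCoord e u.proj
      (mfderiv (velocityModel F m) 𝓘(ℝ, F) (TotalSpace.proj : Velocity m 𝓘(ℝ, F) M → M) u ξ) := by
  have h1 := (hasMFDerivAt_velCoord (m := m) e hu)
  have h2 : HasMFDerivAt 𝓘(ℝ, F × (Rn m →L[ℝ] F)) 𝓘(ℝ, F) Prod.fst (velCoord (m := m) e u)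
      (ContinuousLinearMap.fst ℝ F (Rn m →L[ℝ] F)) := hasFDerivAt_fst.hasMFDerivAt
  have h3 := h2.comp u h1
  have h4 := (mdifferentiableAt_of_mem_atlas e hu).hasMFDerivAt.comp u
    (mdifferentiableAt_proj u).hasMFDerivAt
  have h5 := hasMFDerivAt_unique h3 h4
  rw [← mfderiv_eq_tangentCoord e hu]
  exact congrArg (fun f : TangentSpace (velocityModel F m) u →L[ℝ] F => f ξ) h5

theorem contMDiff_velocityFiberIncl (x : M) :
    ContMDiff 𝓘(ℝ, Rn m →L[ℝ] F) (velocityModel F m) ∞ (velocityFiberIncl (F := F) (M := M) (m := m) x) := by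
  intro L
  refine (contMDiffAt_velocity_iff (f := velocityFiberIncl (F := F) (M := M) (m := m) x)
    (achart F x) (mem_chart_source F x)).2 ⟨contMDiffAt_const, ?_⟩
  let T : F →L[ℝ] F := (tangentCoord (achart F x) x : TangentSpace 𝓘(ℝ, F) x →L[ℝ] F)
  exact (ContinuousLinearMap.compL ℝ (Rn m) F F T).contMDiff.contMDiffAt

theorem hasMFDerivAt_velocityFiberIncl (x : M) (L : Rn m →L[ℝ] F) :
    HasMFDerivAt 𝓘(ℝ, Rn m →L[ℝ] F) (velocityModel F m)
      (velocityFiberIncl (F := F) (M := M) (m := m) x) L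
      (mfderiv 𝓘(ℝ, Rn m →L[ℝ] F) (velocityModel F m)
        (velocityFiberIncl (F := F) (M := M) (m := m) x) L) :=
  ((contMDiff_velocityFiberIncl x).contMDiffAt.mdifferentiableAt (by simp)).hasMFDerivAt

theorem velDeriv_verticalLift (e : atlas F M) {u : Velocity m 𝓘(ℝ, F) M}
    (hu : u.proj ∈ e.1.source)
    (β : Rn m →L[ℝ] Rn m →L[ℝ] TangentSpace 𝓘(ℝ, F) u.proj) (t : Rn m) :
    velDeriv e u (verticalLift u β t) =
      (0, (tangentCoord e u.proj : TangentSpace 𝓘(ℝ, F) u.proj →L[ℝ] F) ∘L β t) := by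
  let L : Rn m →L[ℝ] F := u.2
  have h1 := HasMFDerivAt.comp (f := velocityFiberIncl (F := F) (M := M) (m := m) u.proj) L
    (hasMFDerivAt_velCoord (m := m) e hu) (hasMFDerivAt_velocityFiberIncl u.proj L)
  let T : F →L[ℝ] F := (tangentCoord e u.proj : TangentSpace 𝓘(ℝ, F) u.proj →L[ℝ] F)
  have h2 : HasFDerivAt (fun L : Rn m →L[ℝ] F => ((e.1 u.proj, T ∘L L) : F × (Rn m →L[ℝ] F)))
      ((0 : (Rn m →L[ℝ] F) →L[ℝ] F).prod (ContinuousLinearMap.compL ℝ (Rn m) F F T)) L :=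
    (hasFDerivAt_const _ _).prodMk (ContinuousLinearMap.compL ℝ (Rn m) F F T).hasFDerivAt
  have h3 := hasMFDerivAt_unique h1 h2.hasMFDerivAt
  exact congrArg (fun f : (Rn m →L[ℝ] F) →L[ℝ] F × (Rn m →L[ℝ] F) => f (β t)) h3

theorem verticalVelocity_injective {u : Velocity m 𝓘(ℝ, F) M}
    {β β' : Rn m →L[ℝ] Rn m →L[ℝ] TangentSpace 𝓘(ℝ, F) u.proj}
    (h : verticalVelocity u β = verticalVelocity u β') : β = β' := by
  have h1 : verticalLift u β = verticalLift u β' := eq_of_heq (TotalSpace.mk.inj h).2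
  ext1 t
  have h2 := velDeriv_verticalLift (achart F u.proj) (mem_chart_source F u.proj) β t
  rw [h1, velDeriv_verticalLift (achart F u.proj) (mem_chart_source F u.proj) β' t] at h2
  ext1 s
  refine (tangentCoord (achart F u.proj) u.proj).injective ?_
  exact (congrArg (fun p : F × (Rn m →L[ℝ] F) => p.2 s) h2).symm

/-- The inclusion of an open submanifold has the identity as its derivative. -/
theorem hasMFDerivAt_subtype_val {EN HN N : Type*} [NormedAddCommGroup EN] [NormedSpace ℝ EN]
    [TopologicalSpace HN] [TopologicalSpace N] [ChartedSpace HN N] {I : ModelWithCorners ℝ EN HN}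
    {U : TopologicalSpace.Opens N} (x : U) :
    HasMFDerivAt I I (Subtype.val : U → N) x (ContinuousLinearMap.id ℝ EN) := by
  refine ⟨continuous_subtype_val.continuousAt, ?_⟩
  refine (hasFDerivWithinAt_id _ _).congr_of_eventuallyEq ?_ ?_
  · have := extChartAt_target_mem_nhdsWithin (I := I) x
    filter_upwards [this] with y hy
    have h1 : extChartAt I x.1 ((extChartAt I x).symm y : U).1 =
      extChartAt I x ((extChartAt I x).symm y) := rfl
    change extChartAt I x.1 ((extChartAt I x).symm y : U).1 = y
    rw [h1, (extChartAt I x).right_inv hy]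
  · change extChartAt I x.1 ((extChartAt I x).symm (extChartAt I x x) : U).1 = _
    rw [extChartAt_to_inv]; rfl

theorem contMDiff_velocityScale :
    ContMDiff ((velocityModel F m).prod 𝓘(ℝ, Rn m →L[ℝ] Rn m)) (velocityModel F m) ∞
      (velocityScale (M := M) (F := F) (m := m)) := by
  intro p
  have h0 := contMDiffAt_fst (I := velocityModel F m) (J := 𝓘(ℝ, Rn m →L[ℝ] Rn m)) (n := ∞) (p := p)
  have h1 := (contMDiffAt_velocity_iff (achart F p.1.proj) (mem_chart_source F p.1.proj)).1 h0
  refine (contMDiffAt_velocity_iff (f := velocityScale (M := M) (F := F) (m := m))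
    (achart F p.1.proj) (mem_chart_source F p.1.proj)).2 ⟨h1.1, ?_⟩
  exact h1.2.clm_comp contMDiffAt_snd

/-- The action on a vertical double velocity is computed in the fibre over `x`, where the action
of `(A, B)` is the derivative of the composition of linear maps: the result is
`(L A, β(A ·, A ·) + L B)`. -/
theorem doubleVelocityAct_verticalVelocity (u : Velocity m 𝓘(ℝ, F) M)
    (β : Rn m →L[ℝ] Rn m →L[ℝ] TangentSpace 𝓘(ℝ, F) u.proj) (A : Rn m →L[ℝ] Rn m)
    (B : Rn m →L[ℝ] Rn m →L[ℝ] Rn m)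
    (β' : Rn m →L[ℝ] Rn m →L[ℝ] TangentSpace 𝓘(ℝ, F) u.proj)
    (hβ' : ∀ s t, β' s t = β (A s) (A t) + u.2 (B s t)) :
    doubleVelocityAct (verticalVelocity u β) A A B =
      verticalVelocity (velocityScale (u, A)) β' := by
  refine congrArg (TotalSpace.mk (velocityScale (u, A))) ?_
  ext1 s
  let L : Rn m →L[ℝ] F := u.2
  let b : Rn m →L[ℝ] F := β (A s)
  have h1 := (HasMFDerivAt.comp (I' := 𝓘(ℝ, Rn m →L[ℝ] F)) (L, A)
      (hasMFDerivAt_velocityFiberIncl u.proj L)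
      (hasFDerivAt_fst (p := (L, A)) (𝕜 := ℝ)).hasMFDerivAt).prodMk
      (hasFDerivAt_snd (p := (L, A)) (𝕜 := ℝ)).hasMFDerivAt
  have h2 := HasMFDerivAt.comp (L, A) 
    (((contMDiff_velocityScale (m := m) (F := F) (M := M)) (u, A)).mdifferentiableAt
      (by simp)).hasMFDerivAt h1
  have h3 := (hasFDerivAt_fst (p := (L, A)) (𝕜 := ℝ)).clm_comp (hasFDerivAt_snd (p := (L, A)) (𝕜 := ℝ))
  have h4 := HasMFDerivAt.comp (L, A)
    (hasMFDerivAt_velocityFiberIncl u.proj (L ∘L A)) h3.hasMFDerivAt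
  have h5 := hasMFDerivAt_unique h2 h4
  have h6 := congrArg (fun f : (Rn m →L[ℝ] F) × (Rn m →L[ℝ] Rn m) →L[ℝ] F × (Rn m →L[ℝ] F)
    => f (b, B s)) h5
  refine h6.trans ?_
  refine congrArg (fun b' : Rn m →L[ℝ] F => (mfderiv 𝓘(ℝ, Rn m →L[ℝ] F) (velocityModel F m)
        (velocityFiberIncl (F := F) (M := M) (m := m) u.proj) (L ∘L A) : (Rn m →L[ℝ] F) →L[ℝ] _) b') ?_
  ext1 t
  refine Eq.trans ?_ (hβ' s t).symm
  exact add_comm _ _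

end VelocityCalculus

/-! ### The projection from regular velocities to contact elements -/

section ContactProjection

variable {F : Type*} [NormedAddCommGroup F] [NormedSpace ℝ F]
  {M : Type*} [TopologicalSpace M] [ChartedSpace F M] {m : ℕ}

/-- The projection of regular velocities to contact elements, extended to all velocities by a
constant. -/
def contactExt (z₀ : ContactElement F M m) (u : Velocity m 𝓘(ℝ, F) M) : ContactElement F M m :=
  open Classical in if h : IsRegular u then contactOf u h else z₀

theorem contactExt_eq {z₀ : ContactElement F M m} {u : Velocity m 𝓘(ℝ, F) M} (h : IsRegular u) :
    contactExt z₀ u = contactOf u h := dif_pos h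

variable [IsManifold 𝓘(ℝ, F) ∞ M]

/-- The derivative part of a velocity in split linear coordinates. -/
def frameLin (c : ChartIndex F M m) (u : Velocity m 𝓘(ℝ, F) M) :
    Rn m →L[ℝ] Rn m × Rn (Module.finrank ℝ F - m) :=
  c.2.toContinuousLinearMap ∘L velocityLin c.1 u

/-- The first `m` split coordinates of the derivative part of a velocity. -/
def firstLin (c : ChartIndex F M m) (u : Velocity m 𝓘(ℝ, F) M) : Rn m →L[ℝ] Rn m :=
  ContinuousLinearMap.fst ℝ _ _ ∘L frameLin c u

theorem injective_firstCoord_contactOf_iff {c : ChartIndex F M m} {u : Velocity m 𝓘(ℝ, F) M}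
    (hu : IsRegular u) :
    Function.Injective (firstCoord c (contactOf u hu)) ↔ Function.Injective (firstLin c u) := by
  have h : (firstLin c u : Rn m → Rn m) = firstCoord c (contactOf u hu) ∘
      LinearEquiv.ofInjective u.2.toLinearMap hu := rfl
  rw [h]
  exact (EquivLike.injective_comp (LinearEquiv.ofInjective u.2.toLinearMap hu)
    (firstCoord c (contactOf u hu))).symm

theorem isUnit_iff_injective (f : Rn m →L[ℝ] Rn m) : IsUnit f ↔ Function.Injective f := by
  rw [ContinuousLinearMap.isUnit_iff_bijective]
  exact ⟨fun h => h.1, fun h => ⟨h, (LinearMap.injective_iff_surjective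
    (f := (f : Rn m →ₗ[ℝ] Rn m))).1 h⟩⟩

theorem contactOf_mem_chartDomain_iff {c : ChartIndex F M m} {u : Velocity m 𝓘(ℝ, F) M}
    (hu : IsRegular u) :
    contactOf u hu ∈ chartDomain c ↔ u.proj ∈ c.1.1.source ∧ IsUnit (firstLin c u) := by
  rw [isUnit_iff_injective, ← injective_firstCoord_contactOf_iff hu]
  rfl

theorem isRegular_of_isUnit_firstLin {c : ChartIndex F M m} {u : Velocity m 𝓘(ℝ, F) M}
    (h : IsUnit (firstLin c u)) : IsRegular u := by
  rw [isUnit_iff_injective] at h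
  intro s t hst
  refine h ?_
  change (frame c u.proj (u.2 s)).1 = (frame c u.proj (u.2 t)).1
  rw [hst]

theorem slope_contactOf {c : ChartIndex F M m} {u : Velocity m 𝓘(ℝ, F) M}
    {hu : IsRegular u} (h : contactOf u hu ∈ chartDomain c) (t : Rn m) :
    slope c (contactOf u hu) (firstLin c u t) = (frameLin c u t).2 :=
  ((mem_plane_iff h.2 (u.2 t)).1 ⟨t, rfl⟩).symm

/-- The projection from velocities to contact elements in coordinates. -/
def slopeMap (ψ : F ≃L[ℝ] Rn m × Rn (Module.finrank ℝ F - m)) (p : F × (Rn m →L[ℝ] F)) :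
    ContactModel F m :=
  (p.1, (ContinuousLinearMap.snd ℝ _ _ ∘L ψ.toContinuousLinearMap ∘L p.2) ∘L
    Ring.inverse (ContinuousLinearMap.fst ℝ _ _ ∘L ψ.toContinuousLinearMap ∘L p.2))

theorem contDiffAt_slopeMap (ψ : F ≃L[ℝ] Rn m × Rn (Module.finrank ℝ F - m))
    {p : F × (Rn m →L[ℝ] F)}
    (hp : IsUnit (ContinuousLinearMap.fst ℝ _ _ ∘L ψ.toContinuousLinearMap ∘L p.2)) :
    ContDiffAt ℝ ∞ (slopeMap ψ) p := by
  refine contDiffAt_fst.prodMk (ContDiffAt.clm_comp ?_ ?_)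
  · exact contDiffAt_const.clm_comp (contDiffAt_const.clm_comp contDiffAt_snd)
  · have h1 : ContDiffAt ℝ ∞ (fun p : F × (Rn m →L[ℝ] F) =>
        ContinuousLinearMap.fst ℝ _ _ ∘L ψ.toContinuousLinearMap ∘L p.2) p :=
      contDiffAt_const.clm_comp (contDiffAt_const.clm_comp contDiffAt_snd)
    obtain ⟨w, hw⟩ := hp
    have h2 : ContDiffAt ℝ ∞ Ring.inverse
      (ContinuousLinearMap.fst ℝ _ _ ∘L ψ.toContinuousLinearMap ∘L p.2) := by
      rw [← hw]; exact contDiffAt_ringInverse ℝ w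
    exact h2.comp p h1

theorem slopeMap_apply (ψ : F ≃L[ℝ] Rn m × Rn (Module.finrank ℝ F - m))
    {p : F × (Rn m →L[ℝ] F)}
    (hp : IsUnit (ContinuousLinearMap.fst ℝ _ _ ∘L ψ.toContinuousLinearMap ∘L p.2)) (s : Rn m) :
    (slopeMap ψ p).2 (ψ (p.2 s)).1 = (ψ (p.2 s)).2 :=
  congrArg (fun f : Rn m →L[ℝ] Rn m => (ψ (p.2 (f s))).2) (Ring.inverse_mul_cancel _ hp)

/-- As the slope `A` is determined by `A L₁ = L₂`, its derivative is determined by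
`A' L₁ = L₂' - A L₁'`. -/
theorem fderiv_slopeMap (ψ : F ≃L[ℝ] Rn m × Rn (Module.finrank ℝ F - m))
    {p : F × (Rn m →L[ℝ] F)}
    (hp : IsUnit (ContinuousLinearMap.fst ℝ _ _ ∘L ψ.toContinuousLinearMap ∘L p.2))
    (η : F × (Rn m →L[ℝ] F)) :
    (fderiv ℝ (slopeMap ψ) p η).1 = η.1 ∧
    ∀ s, (fderiv ℝ (slopeMap ψ) p η).2 (ψ (p.2 s)).1 =
      (ψ (η.2 s)).2 - (slopeMap ψ p).2 (ψ (η.2 s)).1 := by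
  have h := ((contDiffAt_slopeMap ψ hp).differentiableAt (by simp)).hasFDerivAt
  constructor
  · have h1 := h.fst.unique hasFDerivAt_fst
    exact congrArg (fun f : F × (Rn m →L[ℝ] F) →L[ℝ] F => f η) h1
  · intro s
    let ev : F × (Rn m →L[ℝ] F) →L[ℝ] F :=
      ContinuousLinearMap.apply ℝ F s ∘L ContinuousLinearMap.snd ℝ _ _
    let ψ₁ : F →L[ℝ] Rn m := ContinuousLinearMap.fst ℝ _ _ ∘L ψ.toContinuousLinearMap
    let ψ₂ : F →L[ℝ] Rn (Module.finrank ℝ F - m) :=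
      ContinuousLinearMap.snd ℝ _ _ ∘L ψ.toContinuousLinearMap
    have h1 := h.snd.clm_apply (ψ₁ ∘L ev).hasFDerivAt
    have h2 : (fun p' => (slopeMap ψ p').2 ((ψ₁ ∘L ev) p')) =ᶠ[𝓝 p] ψ₂ ∘L ev := by
      have hc : ContinuousAt (fun p' : F × (Rn m →L[ℝ] F) =>
          ContinuousLinearMap.fst ℝ _ _ ∘L ψ.toContinuousLinearMap ∘L p'.2) p :=
        continuousAt_const.clm_comp (continuousAt_const.clm_comp continuousAt_snd)
      filter_upwards [hc.preimage_mem_nhds (Units.isOpen.mem_nhds hp)] with p' hp'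
      exact slopeMap_apply ψ hp' s
    have h3 := h1.unique ((ψ₂ ∘L ev).hasFDerivAt.congr_of_eventuallyEq h2)
    have h4 := congrArg (fun f : F × (Rn m →L[ℝ] F) →L[ℝ] _ => f η) h3
    exact eq_sub_of_add_eq' h4

theorem contactChart_contactOf {c : ChartIndex F M m} {u : Velocity m 𝓘(ℝ, F) M}
    {hu : IsRegular u} (h : contactOf u hu ∈ chartDomain c) :
    contactChart c (contactOf u hu) = slopeMap c.2 (velCoord c.1 u) := by
  refine Prod.ext rfl ?_
  have hu' := ((contactOf_mem_chartDomain_iff hu).1 h).2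
  change slope c (contactOf u hu) = (ContinuousLinearMap.snd ℝ _ _ ∘L frameLin c u) ∘L
    Ring.inverse (firstLin c u)
  have h1 : ContinuousLinearMap.snd ℝ _ _ ∘L frameLin c u =
      slope c (contactOf u hu) ∘L firstLin c u := by
    ext1 t
    exact (slope_contactOf h t).symm
  rw [h1, ContinuousLinearMap.comp_assoc]
  change _ = slope c (contactOf u hu) ∘L (firstLin c u * _)
  rw [Ring.mul_inverse_cancel _ hu']
  rfl

theorem eventually_mem_chartDomain {c : ChartIndex F M m} {u : Velocity m 𝓘(ℝ, F) M}
    {hu : IsRegular u} (h : contactOf u hu ∈ chartDomain c) :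
    ∀ᶠ v in 𝓝 u, ∃ hv : IsRegular v, contactOf v hv ∈ chartDomain c := by
  have h1 := (contactOf_mem_chartDomain_iff hu).1 h
  have h2 := (contMDiffAt_velCoord (m := m) c.1 h1.1).continuousAt
  have h3 : ContinuousAt (fun v => firstLin c v) u :=
    (continuousAt_const (y := (ContinuousLinearMap.fst ℝ _ _ ∘L
      c.2.toContinuousLinearMap))).clm_comp (continuousAt_snd.comp h2)
  have h4 : ContinuousAt (TotalSpace.proj : Velocity m 𝓘(ℝ, F) M → M) u :=
    (mdifferentiableAt_proj u).continuousAt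
  filter_upwards [h3.preimage_mem_nhds (Units.isOpen.mem_nhds h1.2),
    h4.preimage_mem_nhds (c.1.1.open_source.mem_nhds h1.1)] with v hv hv'
  exact ⟨isRegular_of_isUnit_firstLin hv, (contactOf_mem_chartDomain_iff _).2 ⟨hv', hv⟩⟩

/-- In a neighbourhood of a regular velocity, the projection to contact elements in
coordinates. -/
theorem contactChart_contactExt_eventuallyEq {z₀ : ContactElement F M m} {c : ChartIndex F M m}
    {u : Velocity m 𝓘(ℝ, F) M} {hu : IsRegular u} (hc : contactOf u hu ∈ chartDomain c) :
    (fun v => contactChart c (contactExt z₀ v)) =ᶠ[𝓝 u]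
      fun v => slopeMap c.2 (velCoord c.1 v) := by
  filter_upwards [eventually_mem_chartDomain hc] with v hv
  obtain ⟨hv, hvc⟩ := hv
  rw [contactExt_eq hv, contactChart_contactOf hvc]

variable [FiniteDimensional ℝ F]

instance (x : M) : FiniteDimensional ℝ (TangentSpace 𝓘(ℝ, F) x) :=
  inferInstanceAs (FiniteDimensional ℝ F)

/-- A regular velocity whose image satisfies the equations of a graph spans this graph. -/
theorem contactOf_eq_ofSlope {c : ChartIndex F M m} {u : Velocity m 𝓘(ℝ, F) M}
    (hu : IsRegular u) (S : Rn m →L[ℝ] Rn (Module.finrank ℝ F - m))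
    (h : ∀ t, (frameLin c u t).2 = S (frameLin c u t).1) :
    contactOf u hu = ofSlope c u.proj S := by
  refine ContactElement.ext rfl ?_
  have hle : (contactOf u hu).plane ≤ (ofSlope c u.proj S).plane := by
    rintro _ ⟨t, rfl⟩
    exact (mem_ofSlope_plane _).2 (h t)
  have key : ∀ P Q : Submodule ℝ (TangentSpace 𝓘(ℝ, F) u.proj), P ≤ Q →
      Module.finrank ℝ P = Module.finrank ℝ Q → P = Q :=
    fun _ _ h h' => Submodule.eq_of_le_of_finrank_eq h h'
  exact key _ _ hle
    ((contactOf u hu).finrank_plane.trans (ofSlope c u.proj S).finrank_plane.symm)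

/-- The chart of the manifold of contact elements with a given index, as a member of its atlas. -/
def jetChart (c : ChartIndex F M m) : atlas (ContactModel F m) (ContactElement F M m) :=
  ⟨(contactCore F M m).openPartialHomeomorph (contactChart c) (mem_range_self c),
    (mem_contactAtlas_iff _).2 ⟨c, rfl⟩⟩

theorem jetChart_mem_maximalAtlas (c : ChartIndex F M m) :
    (jetChart c).1 ∈ IsManifold.maximalAtlas 𝓘(ℝ, ContactModel F m) ∞ (ContactElement F M m) :=
  IsManifold.subset_maximalAtlas (jetChart c).2

theorem contMDiffAt_contactExt {z₀ : ContactElement F M m} {u : Velocity m 𝓘(ℝ, F) M}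
    (hu : IsRegular u) :
    ContMDiffAt (velocityModel F m) 𝓘(ℝ, ContactModel F m) ∞ (contactExt z₀) u := by
  let c := chartIndexAt (contactOf u hu)
  have hc : contactOf u hu ∈ chartDomain c := mem_chartDomain_chartIndexAt _
  have h1 := (contactOf_mem_chartDomain_iff hu).1 hc
  have h2 : ContMDiffAt (velocityModel F m) 𝓘(ℝ, ContactModel F m) ∞
      (fun v => slopeMap c.2 (velCoord c.1 v)) u :=
    (contDiffAt_slopeMap c.2 (p := velCoord c.1 u) h1.2).contMDiffAt.comp u (contMDiffAt_velCoord c.1 h1.1)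
  have h3 : contactChart c (contactOf u hu) ∈ (jetChart c).1.target :=
    (contactChart c).map_source hc
  have h4 := contMDiffOn_symm_of_mem_maximalAtlas (jetChart_mem_maximalAtlas c)
  have h5 : ContMDiffAt 𝓘(ℝ, ContactModel F m) 𝓘(ℝ, ContactModel F m) ∞ (jetChart c).1.symm
      (slopeMap c.2 (velCoord c.1 u)) := by
    rw [← contactChart_contactOf hc]
    exact h4.contMDiffAt ((jetChart c).1.open_target.mem_nhds h3)
  refine (h5.comp u h2).congr_of_eventuallyEq ?_
  filter_upwards [eventually_mem_chartDomain hc] with v hv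
  obtain ⟨hv, hvc⟩ := hv
  rw [contactExt_eq hv, Function.comp_apply, ← contactChart_contactOf hvc]
  exact ((contactChart c).left_inv hvc).symm

theorem tangentCoord_mfderiv_contactExt {z₀ : ContactElement F M m} {c : ChartIndex F M m}
    {u : Velocity m 𝓘(ℝ, F) M} (hu : IsRegular u) (hc : contactOf u hu ∈ chartDomain c)
    (ξ : TangentSpace (velocityModel F m) u) :
    tangentCoord (jetChart c) (contactExt z₀ u)
      (mfderiv (velocityModel F m) 𝓘(ℝ, ContactModel F m) (contactExt z₀) u ξ) =
    fderiv ℝ (slopeMap c.2) (velCoord c.1 u) (velDeriv c.1 u ξ) := by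
  have hc' : contactExt z₀ u ∈ (jetChart c).1.source := by rw [contactExt_eq hu]; exact hc
  have hux := (contactOf_mem_chartDomain_iff hu).1 hc
  have h1 := (mdifferentiableAt_of_mem_atlas (jetChart c) hc').hasMFDerivAt.comp u
    ((contMDiffAt_contactExt (z₀ := z₀) hu).mdifferentiableAt (by simp)).hasMFDerivAt
  have h2 := ((contDiffAt_slopeMap c.2 (p := velCoord c.1 u) hux.2).differentiableAt
    (by simp)).hasFDerivAt.hasMFDerivAt.comp u (hasMFDerivAt_velCoord (m := m) c.1 hux.1)
  have h3 := hasMFDerivAt_unique h1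
    (h2.congr_of_eventuallyEq (contactChart_contactExt_eventuallyEq hc))
  rw [← mfderiv_eq_tangentCoord _ hc']
  exact congrArg
    (fun f : TangentSpace (velocityModel F m) u →L[ℝ] ContactModel F m => f ξ) h3

end ContactProjection

/-! ### Double contact elements represented by semiholonomic double velocities -/

section Semiholonomic

variable {F : Type*} [NormedAddCommGroup F] [NormedSpace ℝ F]
  {M : Type*} [TopologicalSpace M] [ChartedSpace F M] [IsManifold 𝓘(ℝ, F) ∞ M] {m : ℕ}

theorem IsSemiholonomic.mfderiv_proj {W : DoubleVelocity F M m} (h : IsSemiholonomic W)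
    (t : Rn m) :
    mfderiv (velocityModel F m) 𝓘(ℝ, F) (TotalSpace.proj : Velocity m 𝓘(ℝ, F) M → M) W.proj
      (W.2 t) = W.proj.2 t := by
  have h1 := eq_of_heq (TotalSpace.mk.inj h).2
  exact congrArg (fun f : Rn m →L[ℝ] F => f t) h1

theorem isSemiholonomic_of_mfderiv_proj {W : DoubleVelocity F M m}
    (h : ∀ t : Rn m, mfderiv (velocityModel F m) 𝓘(ℝ, F)
      (TotalSpace.proj : Velocity m 𝓘(ℝ, F) M → M) W.proj (W.2 t) = W.proj.2 t) :
    IsSemiholonomic W := by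
  refine congrArg (TotalSpace.mk W.proj.proj) ?_
  ext1 t
  exact h t

theorem IsSemiholonomic.velDeriv_fst {W : DoubleVelocity F M m} (h : IsSemiholonomic W)
    (e : atlas F M) (he : W.proj.proj ∈ e.1.source) (t : Rn m) :
    (velDeriv e W.proj (W.2 t)).1 = velocityLin e W.proj t := by
  rw [fst_velDeriv e he, h.mfderiv_proj]
  rfl

theorem IsSemiholonomic.addVertical {W : DoubleVelocity F M m} (h : IsSemiholonomic W)
    (β : Rn m →L[ℝ] Rn m →L[ℝ] TangentSpace 𝓘(ℝ, F) W.proj.proj) :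
    IsSemiholonomic (addVertical W β) := by
  refine isSemiholonomic_of_mfderiv_proj fun t => ?_
  let e := achart F W.proj.proj
  have he := mem_chart_source F W.proj.proj
  have h1 := fst_velDeriv e he (verticalLift W.proj β t)
  rw [velDeriv_verticalLift e he] at h1
  have h2 : mfderiv (velocityModel F m) 𝓘(ℝ, F) (TotalSpace.proj : Velocity m 𝓘(ℝ, F) M → M)
      W.proj (verticalLift W.proj β t) = 0 :=
    (tangentCoord e W.proj.proj).injective (h1.symm.trans (map_zero _).symm)
  refine Eq.trans (map_add (mfderiv (velocityModel F m) 𝓘(ℝ, F)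
    (TotalSpace.proj : Velocity m 𝓘(ℝ, F) M → M) W.proj) (W.2 t) _) ?_
  exact (congrArg₂ (fun a b : F => a + b) (h.mfderiv_proj t) h2).trans (add_zero _)

variable [FiniteDimensional ℝ F]

/-- Representation in terms of an extension of the projection `ρ` to all velocities: regular
velocities form an open submanifold, near which the value `z₀` off regular velocities is not seen
by derivatives. This allows calculations with double velocities over the whole velocity bundle. -/
theorem represents_iff (z₀ : ContactElement F M m) {W : DoubleVelocity F M m}
    {z : DoubleContactElement F M m} :
    Represents W z ↔ ∃ (_ : IsRegular W.proj) (h : IsRegular (velocityMap (velocityModel F m)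
      𝓘(ℝ, ContactModel F m) (contactExt z₀) W)),
      contactOf (velocityMap (velocityModel F m) 𝓘(ℝ, ContactModel F m) (contactExt z₀) W) h = z := by
  have hcomp : (contactProj : regularVelocities m 𝓘(ℝ, F) M → ContactElement F M m) =
      contactExt z₀ ∘ Subtype.val := by
    funext u
    exact (contactExt_eq u.2).symm
  have key : ∀ w : Velocity m (velocityModel F m) (regularVelocities m 𝓘(ℝ, F) M),
      velocityMap (velocityModel F m) 𝓘(ℝ, ContactModel F m) contactProj w =
      velocityMap (velocityModel F m) 𝓘(ℝ, ContactModel F m) (contactExt z₀)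
        (velocityMap (velocityModel F m) (velocityModel F m) Subtype.val w) := by
    intro w
    rw [hcomp]
    refine congrArg (TotalSpace.mk (contactExt z₀ w.proj.1)) ?_
    have h1 := (((contMDiffAt_contactExt (z₀ := z₀) w.proj.2).mdifferentiableAt
      (by simp)).hasMFDerivAt.comp w.proj (hasMFDerivAt_subtype_val w.proj)).mfderiv
    have h2 := (hasMFDerivAt_subtype_val (I := velocityModel F m) w.proj).mfderiv
    ext1 t
    refine (congrArg (fun f : F × (Rn m →L[ℝ] F) →L[ℝ] ContactModel F m => f (w.2 t)) h1).trans ?_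
    exact (congrArg (fun f : F × (Rn m →L[ℝ] F) →L[ℝ] F × (Rn m →L[ℝ] F) =>
      mfderiv (velocityModel F m) 𝓘(ℝ, ContactModel F m) (contactExt z₀) w.proj.1 (f (w.2 t))) h2).symm
  constructor
  · rintro ⟨w, h, rfl, rfl⟩
    refine ⟨w.proj.2, key w ▸ h, ?_⟩
    congr 1
    exact (key w).symm
  · rintro ⟨hW, h, rfl⟩
    let w : Velocity m (velocityModel F m) (regularVelocities m 𝓘(ℝ, F) M) := ⟨⟨W.proj, hW⟩, W.2⟩
    have hw : velocityMap (velocityModel F m) (velocityModel F m) Subtype.val w = W := by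
      refine congrArg (TotalSpace.mk W.proj) ?_
      have h2 := (hasMFDerivAt_subtype_val (I := velocityModel F m) w.proj).mfderiv
      ext1 t
      exact congrArg (fun f : F × (Rn m →L[ℝ] F) →L[ℝ] F × (Rn m →L[ℝ] F) => f (W.2 t)) h2
    have hk := key w
    rw [hw] at hk
    refine ⟨w, hk ▸ h, hw, ?_⟩
    congr 1

theorem Represents.isRegular {W : DoubleVelocity F M m} {z : DoubleContactElement F M m}
    (h : Represents W z) : IsRegular W.proj := by
  obtain ⟨w, -, rfl, -⟩ := h
  exact w.proj.2

theorem Represents.pt_eq {W : DoubleVelocity F M m} {z : DoubleContactElement F M m}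
    (h : Represents W z) (hu : IsRegular W.proj) : z.pt = contactOf W.proj hu := by
  obtain ⟨w, -, rfl, rfl⟩ := h
  rfl

theorem Represents.unique {W : DoubleVelocity F M m} {z z' : DoubleContactElement F M m}
    (h : Represents W z) (h' : Represents W z') : z = z' := by
  obtain ⟨_, _, h1⟩ := (represents_iff z.pt).1 h
  obtain ⟨_, _, h2⟩ := (represents_iff z.pt).1 h'
  exact h1.symm.trans h2

/-- The splitting of the model space of contact elements belonging to a splitting of the model
space `F`: the first `m` coordinates are those of `F`, and the isomorphism `q` arranges the remaining
ones, in `T_x M / P` and `Hom(P, T_x M / P)`, as a single tuple. -/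
def doubleSplitting (ψ : F ≃L[ℝ] Rn m × Rn (Module.finrank ℝ F - m))
    (q : (Rn (Module.finrank ℝ F - m) × (Rn m →L[ℝ] Rn (Module.finrank ℝ F - m))) ≃L[ℝ]
      Rn (Module.finrank ℝ (ContactModel F m) - m)) :
    ContactModel F m ≃L[ℝ] Rn m × Rn (Module.finrank ℝ (ContactModel F m) - m) :=
  (ψ.prodCongr (ContinuousLinearEquiv.refl ℝ _)).trans
    ((ContinuousLinearEquiv.prodAssoc ℝ _ _ _).trans
      ((ContinuousLinearEquiv.refl ℝ _).prodCongr q))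

/-- The index of the chart of double contact elements belonging to a chart of contact elements. -/
def doubleIndex (c : ChartIndex F M m)
    (q : (Rn (Module.finrank ℝ F - m) × (Rn m →L[ℝ] Rn (Module.finrank ℝ F - m))) ≃L[ℝ]
      Rn (Module.finrank ℝ (ContactModel F m) - m)) :
    ChartIndex (ContactModel F m) (ContactElement F M m) m :=
  (jetChart c, doubleSplitting c.2 q)

/-- The semiholonomic double contact element over the contact element `P` with second order
coordinates `β`, in the coordinates belonging to `c`: the graph of `a ↦ (A a, β a)`, where `A` is
the slope of `P`. -/
def semiElement (c : ChartIndex F M m)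
    (q : (Rn (Module.finrank ℝ F - m) × (Rn m →L[ℝ] Rn (Module.finrank ℝ F - m))) ≃L[ℝ]
      Rn (Module.finrank ℝ (ContactModel F m) - m))
    (P : ContactElement F M m) (β : Rn m →L[ℝ] Rn m →L[ℝ] Rn (Module.finrank ℝ F - m)) :
    DoubleContactElement F M m :=
  ofSlope (doubleIndex c q) P (q.toContinuousLinearMap ∘L (slope c P).prod β)

/-- The second order coordinates of the double contact element represented by a semiholonomic
double velocity. If `L = (L₁, L₂)` in split coordinates, with `A L₁ = L₂` for the slope `A`, then
the derivative `A'` of the slope in the direction `t` satisfies `A' L₁ = L₂' - A L₁'`, and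
semiholonomy says that the base point moves in the direction `L t`; the bilinear map is therefore `L₁ t ↦ A'`. -/
theorem represents_semiElement {c : ChartIndex F M m}
    (q : (Rn (Module.finrank ℝ F - m) × (Rn m →L[ℝ] Rn (Module.finrank ℝ F - m))) ≃L[ℝ]
      Rn (Module.finrank ℝ (ContactModel F m) - m))
    {W : DoubleVelocity F M m} (hW : IsSemiholonomic W) (hu : IsRegular W.proj)
    (hc : contactOf W.proj hu ∈ chartDomain c)
    (β : Rn m →L[ℝ] Rn m →L[ℝ] Rn (Module.finrank ℝ F - m))
    (hβ : ∀ t s, β (firstLin c W.proj t) (firstLin c W.proj s) =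
      (c.2 ((velDeriv c.1 W.proj (W.2 t)).2 s)).2 -
        slope c (contactOf W.proj hu) (c.2 ((velDeriv c.1 W.proj (W.2 t)).2 s)).1) :
    Represents W (semiElement c q (contactOf W.proj hu) β) := by
  let z₀ := contactOf W.proj hu
  let v := velocityMap (velocityModel F m) 𝓘(ℝ, ContactModel F m) (contactExt z₀) W
  have hux := (contactOf_mem_chartDomain_iff hu).1 hc
  have hinj := (isUnit_iff_injective _).1 hux.2
  have hsurj := (ContinuousLinearMap.isUnit_iff_bijective.1 hux.2).2
  have hv : ∀ t : Rn m, tangentCoord (jetChart c) v.proj (v.2 t) =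
      (velocityLin c.1 W.proj t, β (firstLin c W.proj t)) := by
    intro t
    have h1 := tangentCoord_mfderiv_contactExt (z₀ := z₀) hu hc (W.2 t)
    have h2 := fderiv_slopeMap c.2 (p := velCoord c.1 W.proj) hux.2 (velDeriv c.1 W.proj (W.2 t))
    refine h1.trans (Prod.ext ?_ ?_)
    · exact h2.1.trans (hW.velDeriv_fst c.1 hux.1 t)
    · ext1 a
      obtain ⟨s, rfl⟩ := hsurj a
      rw [hβ t s]
      refine (h2.2 s).trans ?_
      rw [← contactChart_contactOf hc]
      rfl
  have hfr : ∀ t, frameLin (doubleIndex c q) v t =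
      (firstLin c W.proj t, q ((frameLin c W.proj t).2, β (firstLin c W.proj t))) := by
    intro t
    change doubleSplitting c.2 q (tangentCoord (jetChart c) v.proj (v.2 t)) = _
    rw [hv]
    rfl
  have hreg : IsRegular v := by
    intro s t hst
    refine hinj ?_
    have h1 := congrArg (fun p => (frame (doubleIndex c q) v.proj p).1) hst
    exact (congrArg Prod.fst (hfr s)).symm.trans (h1.trans (congrArg Prod.fst (hfr t)))
  refine (represents_iff z₀).2 ⟨hu, hreg, ?_⟩
  have hz : contactExt z₀ W.proj = contactOf W.proj hu := contactExt_eq hu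
  rw [← hz]
  refine contactOf_eq_ofSlope hreg _ (fun t => ?_)
  rw [hfr]
  change q _ = q _
  rw [hz]
  congr 1
  exact Prod.ext (slope_contactOf hc t).symm rfl

end Semiholonomic

/-! ### Prolongations and holonomic double velocities -/

section Holonomic

variable {F : Type*} [NormedAddCommGroup F] [NormedSpace ℝ F]
  {M : Type*} [TopologicalSpace M] [ChartedSpace F M] {m : ℕ}

theorem eventually_contMDiffAt {γ : Rn m → M} {O : Set (Rn m)} (hO : IsOpen O) (h0 : 0 ∈ O)
    (hγ : ContMDiffOn 𝓘(ℝ, Rn m) 𝓘(ℝ, F) ∞ γ O) :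
    ∀ᶠ t in 𝓝 0, ContMDiffAt 𝓘(ℝ, Rn m) 𝓘(ℝ, F) ∞ γ t := by
  filter_upwards [hO.mem_nhds h0] with t ht
  exact hγ.contMDiffAt (hO.mem_nhds ht)

variable [IsManifold 𝓘(ℝ, F) ∞ M]

theorem velCoord_prolongation {e : atlas F M} {γ : Rn m → M} {t : Rn m} (ht : γ t ∈ e.1.source)
    (hγ : MDifferentiableAt 𝓘(ℝ, Rn m) 𝓘(ℝ, F) γ t) :
    velCoord e (prolongation 𝓘(ℝ, F) γ t) = (e.1 (γ t), fderiv ℝ (e.1 ∘ γ) t) := by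
  have h0 : γ (0 + t) ∈ e.1.source := by rwa [zero_add]
  have hγ' : MDifferentiableAt 𝓘(ℝ, Rn m) 𝓘(ℝ, F) γ (0 + t) := by rwa [zero_add]
  refine Prod.ext (congrArg (fun s => e.1 (γ s)) (zero_add t)) ?_
  ext1 v
  have h1 : HasMFDerivAt 𝓘(ℝ, Rn m) 𝓘(ℝ, Rn m) (fun s : Rn m => s + t) 0
      (ContinuousLinearMap.id ℝ (Rn m)) := ((hasFDerivAt_id (𝕜 := ℝ) (0 : Rn m)).add_const t).hasMFDerivAt
  have h2 := (hγ'.hasMFDerivAt.comp (0 : Rn m) h1).mdifferentiableAt.hasMFDerivAt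
  have h3 := (mdifferentiableAt_of_mem_atlas e h0).hasMFDerivAt.comp (0 : Rn m) h2
  have h4 : fderiv ℝ (fun s => (e.1 ∘ γ) (s + t)) 0 = fderiv ℝ (e.1 ∘ γ) t := by
    rw [fderiv_comp_add_right, zero_add]
  have h5 := h3.mfderiv
  rw [mfderiv_eq_fderiv] at h5
  rw [← h4]
  refine Eq.trans ?_ (congrArg (fun f : Rn m →L[ℝ] F => f v) h5).symm
  exact (mfderiv_eq_tangentCoord e h0 _).symm

/-- The velocity of the prolongation of a map which has the expression `g` in a chart is given by
the first and second derivatives of `g`. -/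
theorem velDeriv_velocity_prolongation {e : atlas F M} {γ : Rn m → M}
    (h0 : γ 0 ∈ e.1.source) (hγ : ∀ᶠ t in 𝓝 0, ContMDiffAt 𝓘(ℝ, Rn m) 𝓘(ℝ, F) ∞ γ t)
    {g : Rn m → F} (hg : e.1 ∘ γ =ᶠ[𝓝 0] g) :
    ContDiffAt ℝ ∞ g 0 ∧
    velocityLin e (velocity (velocityModel F m) (prolongation 𝓘(ℝ, F) γ)).proj = fderiv ℝ g 0 ∧
    ∀ t : Rn m, velDeriv e _ ((velocity (velocityModel F m) (prolongation 𝓘(ℝ, F) γ)).2 t) =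
      (fderiv ℝ g 0 t, fderiv ℝ (fderiv ℝ g) 0 t) := by
  have hmem : ∀ᶠ t in 𝓝 0, γ t ∈ e.1.source :=
    hγ.self_of_nhds.continuousAt.preimage_mem_nhds (e.1.open_source.mem_nhds h0)
  have hg0 : ContDiffAt ℝ ∞ g 0 := by
    have h1 := contMDiffAt_of_mem_maximalAtlas (n := ∞)
      (IsManifold.subset_maximalAtlas (I := 𝓘(ℝ, F)) e.2) h0
    exact ((h1.comp 0 hγ.self_of_nhds).congr_of_eventuallyEq hg.symm).contDiffAt
  have hvc : (fun t => velCoord e (prolongation 𝓘(ℝ, F) γ t)) =ᶠ[𝓝 0]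
      fun t => (g t, fderiv ℝ g t) := by
    filter_upwards [hmem, hγ, hg.eventuallyEq_nhds] with t h1 h2 h3
    rw [velCoord_prolongation h1 (h2.mdifferentiableAt (by simp)), h3.fderiv_eq]
    exact Prod.ext h3.self_of_nhds rfl
  have hdg : ContDiffAt ℝ ∞ (fderiv ℝ g) 0 := hg0.fderiv_right (by simp)
  have hpr : ContMDiffAt 𝓘(ℝ, Rn m) (velocityModel F m) ∞ (prolongation 𝓘(ℝ, F) γ) 0 := by
    refine (contMDiffAt_velocity_iff (f := prolongation 𝓘(ℝ, F) γ) e ?_).2 ⟨?_, ?_⟩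
    · change γ (0 + 0) ∈ _
      rwa [zero_add]
    · have h1 : (fun t => (prolongation 𝓘(ℝ, F) γ t).proj) = γ :=
        funext fun t => congrArg γ (zero_add t)
      rw [h1]
      exact hγ.self_of_nhds
    · refine hdg.contMDiffAt.congr_of_eventuallyEq ?_
      filter_upwards [hvc] with t ht
      exact congrArg Prod.snd ht
  have h0' : (prolongation 𝓘(ℝ, F) γ 0).proj ∈ e.1.source := by
    change γ (0 + 0) ∈ _
    rwa [zero_add]
  refine ⟨hg0, congrArg Prod.snd hvc.self_of_nhds, fun t => ?_⟩
  have h1 := (hasMFDerivAt_velCoord e h0').comp (0 : Rn m)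
    (hpr.mdifferentiableAt (by simp)).hasMFDerivAt
  have h2 : HasFDerivAt (fun t => (g t, fderiv ℝ g t))
      ((fderiv ℝ g 0).prod (fderiv ℝ (fderiv ℝ g) 0)) 0 :=
    (hg0.differentiableAt (by simp)).hasFDerivAt.prodMk
      (hdg.differentiableAt (by simp)).hasFDerivAt
  have h3 := hasMFDerivAt_unique h1 (h2.congr_of_eventuallyEq hvc).hasMFDerivAt
  exact congrArg (fun f : Rn m →L[ℝ] F × (Rn m →L[ℝ] F) => f t) h3

theorem isSemiholonomic_velocity_prolongation {γ : Rn m → M}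
    (hγ : ∀ᶠ t in 𝓝 0, ContMDiffAt 𝓘(ℝ, Rn m) 𝓘(ℝ, F) ∞ γ t) :
    IsSemiholonomic (velocity (velocityModel F m) (prolongation 𝓘(ℝ, F) γ)) := by
  refine isSemiholonomic_of_mfderiv_proj fun t => ?_
  let e := achart F (γ 0)
  have h0 : γ 0 ∈ e.1.source := mem_chart_source F (γ 0)
  have h0' : (prolongation 𝓘(ℝ, F) γ 0).proj ∈ e.1.source := by
    change γ (0 + 0) ∈ _
    rwa [zero_add]
  obtain ⟨-, h1, h2⟩ := velDeriv_velocity_prolongation (e := e) h0 hγ Filter.EventuallyEq.rfl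
  refine (tangentCoord e (prolongation 𝓘(ℝ, F) γ 0).proj).injective ?_
  refine (fst_velDeriv e h0' _).symm.trans ?_
  refine (congrArg Prod.fst (h2 t)).trans ?_
  exact (congrArg (fun f : Rn m →L[ℝ] F => f t) h1).symm

theorem IsHolonomic.isSemiholonomic {W : DoubleVelocity F M m} (h : IsHolonomic W) :
    IsSemiholonomic W := by
  obtain ⟨O, γ, hO, h0, hγ, rfl⟩ := h
  exact isSemiholonomic_velocity_prolongation (eventually_contMDiffAt hO h0 hγ)

/-- The second order part of a holonomic double velocity is a second derivative, hence
symmetric. -/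
theorem IsHolonomic.velDeriv_symm {W : DoubleVelocity F M m} (h : IsHolonomic W) {e : atlas F M}
    (he : W.proj.proj ∈ e.1.source) (s t : Rn m) :
    (velDeriv e W.proj (W.2 s)).2 t = (velDeriv e W.proj (W.2 t)).2 s := by
  obtain ⟨O, γ, hO, h0, hγ, rfl⟩ := h
  have he' : γ 0 ∈ e.1.source := by
    change γ (0 + 0) ∈ _ at he
    rwa [zero_add] at he
  obtain ⟨h1, -, h2⟩ := velDeriv_velocity_prolongation (e := e) he'
    (eventually_contMDiffAt hO h0 hγ) Filter.EventuallyEq.rfl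
  have h3 : IsSymmSndFDerivAt ℝ (e.1 ∘ γ) 0 := h1.isSymmSndFDerivAt (by
    rw [minSmoothness_of_isRCLikeNormedField]; exact ENat.LEInfty.out)
  rw [h2 s, h2 t]
  exact h3.eq s t

variable [FiniteDimensional ℝ F]

/-- A symmetric second order part is realized by the prolongation of a quadratic map. -/
theorem exists_isHolonomic_represents {c : ChartIndex F M m}
    (q : (Rn (Module.finrank ℝ F - m) × (Rn m →L[ℝ] Rn (Module.finrank ℝ F - m))) ≃L[ℝ]
      Rn (Module.finrank ℝ (ContactModel F m) - m))
    {P : ContactElement F M m} (hP : P ∈ chartDomain c)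
    (β : Rn m →L[ℝ] Rn m →L[ℝ] Rn (Module.finrank ℝ F - m)) (hβ : ∀ s t, β s t = β t s) :
    ∃ W, IsHolonomic W ∧ Represents W (semiElement c q P β) := by
  let y := c.1.1 P.pt
  let T : Rn m →L[ℝ] F := c.2.symm.toContinuousLinearMap ∘L
    (ContinuousLinearMap.id ℝ (Rn m)).prod (slope c P)
  let Q : Rn m →L[ℝ] Rn m →L[ℝ] F := ContinuousLinearMap.compL ℝ (Rn m) _ F
    (c.2.symm.toContinuousLinearMap ∘L ContinuousLinearMap.inr ℝ _ _) ∘L β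
  have hQ : ∀ s t, Q s t = c.2.symm (0, β s t) := fun s t => rfl
  -- the map with value `y`, first derivative `T` and second derivative `Q` at the origin
  let g : Rn m → F := fun t => y + T t + (2⁻¹ : ℝ) • Q t t
  have hg1 : ∀ t, HasFDerivAt g (T + Q t) t := by
    intro t
    have h1 := (T.hasFDerivAt (x := t)).const_add y
    have h2 := ((Q.hasFDerivAt (x := t)).clm_apply (hasFDerivAt_id t)).const_smul (2⁻¹ : ℝ)
    refine (h1.add h2).congr_fderiv ?_
    ext1 s
    change T s + (2⁻¹ : ℝ) • (Q t s + Q s t) = T s + Q t s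
    rw [hQ s t, hβ s t, ← hQ t s, ← two_smul ℝ, smul_smul]
    norm_num
  have hg2 : fderiv ℝ g = fun t => T + Q t := funext fun t => (hg1 t).fderiv
  have hg3 : fderiv ℝ (fderiv ℝ g) 0 = Q := by
    rw [hg2]
    exact ((Q.hasFDerivAt (x := 0)).const_add T).fderiv
  have hgs : ContDiff ℝ ∞ g :=
    (contDiff_const.add T.contDiff).add ((Q.contDiff.clm_apply contDiff_id).const_smul _)
  have hg0 : g 0 = y := by simp [g]
  have hy : y ∈ c.1.1.target := c.1.1.map_source hP.1
  let O := g ⁻¹' c.1.1.target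
  have hO : IsOpen O := c.1.1.open_target.preimage hgs.continuous
  have h0 : (0 : Rn m) ∈ O := by
    change g 0 ∈ c.1.1.target
    rwa [hg0]
  let γ : Rn m → M := c.1.1.symm ∘ g
  have hγ : ContMDiffOn 𝓘(ℝ, Rn m) 𝓘(ℝ, F) ∞ γ O :=
    (contMDiffOn_symm_of_mem_maximalAtlas
      (IsManifold.subset_maximalAtlas (I := 𝓘(ℝ, F)) c.1.2)).comp hgs.contMDiff.contMDiffOn
      (fun t ht => ht)
  have hγ0 : γ 0 = P.pt := by
    change c.1.1.symm (g 0) = _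
    rw [hg0]
    exact c.1.1.left_inv hP.1
  have hγs : γ 0 ∈ c.1.1.source := by rw [hγ0]; exact hP.1
  have heq : c.1.1 ∘ γ =ᶠ[𝓝 0] g := by
    filter_upwards [hO.mem_nhds h0] with t ht
    exact c.1.1.right_inv ht
  have hev := eventually_contMDiffAt hO h0 hγ
  obtain ⟨-, h1, h2⟩ := velDeriv_velocity_prolongation hγs hev heq
  have hpt : (prolongation 𝓘(ℝ, F) γ 0).proj = P.pt := by
    change γ (0 + 0) = _
    rw [zero_add, hγ0]
  have hfr : ∀ t, frameLin c (prolongation 𝓘(ℝ, F) γ 0) t = (t, slope c P t) := by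
    intro t
    have h3 : velocityLin c.1 (prolongation 𝓘(ℝ, F) γ 0) t = T t := by
      refine (congrArg (fun f : Rn m →L[ℝ] F => f t) h1).trans ?_
      rw [hg2]
      simp
    change c.2 (velocityLin c.1 (prolongation 𝓘(ℝ, F) γ 0) t) = _
    rw [h3]
    exact c.2.apply_symm_apply _
  have hfst : ∀ t, firstLin c (prolongation 𝓘(ℝ, F) γ 0) t = t :=
    fun t => congrArg Prod.fst (hfr t)
  have hreg : IsRegular (prolongation 𝓘(ℝ, F) γ 0) := by
    refine isRegular_of_isUnit_firstLin (c := c) ((isUnit_iff_injective _).2 fun s t hst => ?_)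
    rwa [hfst, hfst] at hst
  have hP' : contactOf (prolongation 𝓘(ℝ, F) γ 0) hreg = P := by
    rw [contactOf_eq_ofSlope (c := c) hreg (slope c P) (fun t => by rw [hfr]), hpt]
    exact ofSlope_slope hP.2
  refine ⟨velocity (velocityModel F m) (prolongation 𝓘(ℝ, F) γ), ⟨O, γ, hO, h0, hγ, rfl⟩, ?_⟩
  have hc : contactOf (prolongation 𝓘(ℝ, F) γ 0) hreg ∈ chartDomain c := hP'.symm ▸ hP
  have key := represents_semiElement q (isSemiholonomic_velocity_prolongation hev) hreg hc β
    (fun t s => by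
      have h4 : c.2 ((velDeriv c.1 _ ((velocity (velocityModel F m)
          (prolongation 𝓘(ℝ, F) γ)).2 t)).2 s) = (0, β t s) := by
        rw [h2 t, hg3]
        exact c.2.apply_symm_apply _
      rw [h4]
      refine (congrArg₂ (fun a b => β a b) (hfst t) (hfst s)).trans ?_
      simp)
  have h5 : contactOf (velocity (velocityModel F m) (prolongation 𝓘(ℝ, F) γ)).proj hreg = P := hP'
  rwa [h5] at key

end Holonomic

/-! ### Vertical classes and their action on semiholonomic contact elements -/

section VerticalClasses

variable {F : Type*} [NormedAddCommGroup F] [NormedSpace ℝ F]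
  {M : Type*} [TopologicalSpace M] [ChartedSpace F M] {m : ℕ} [FiniteDimensional ℝ F]

theorem exists_contactOf_eq (P : ContactElement F M m) :
    ∃ (u : Velocity m 𝓘(ℝ, F) M) (hu : IsRegular u), contactOf u hu = P := by
  let e : Rn m ≃ₗ[ℝ] P.plane := LinearEquiv.ofFinrankEq _ _ (by simp [P.finrank_plane])
  let L : Rn m →ₗ[ℝ] TangentSpace 𝓘(ℝ, F) P.pt := P.plane.subtype ∘ₗ e.toLinearMap
  let L' : Rn m →L[ℝ] TangentSpace 𝓘(ℝ, F) P.pt := ⟨L, L.continuous_of_finiteDimensional⟩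
  refine ⟨⟨P.pt, L'⟩, P.plane.injective_subtype.comp e.injective, ContactElement.ext rfl ?_⟩
  change LinearMap.range L = P.plane
  rw [LinearMap.range_comp, LinearEquiv.range, Submodule.map_top, Submodule.range_subtype]

theorem exists_verticalClass_eq {κ : Kind} {u : Velocity m 𝓘(ℝ, F) M} (hu : IsRegular u)
    (v : VFiber κ (contactOf u hu)) :
    ∃ (β : Rn m →L[ℝ] Rn m →L[ℝ] TangentSpace 𝓘(ℝ, F) u.proj) (hβ : κ.Holds (fun s t => β s t)),
      verticalClass κ u hu β hβ = ⟨contactOf u hu, v⟩ := by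
  let Pl : Submodule ℝ (TangentSpace 𝓘(ℝ, F) u.proj) := (contactOf u hu).plane
  obtain ⟨σ, hσ⟩ := Pl.mkQ.exists_rightInverse_of_surjective Pl.range_mkQ
  let e := LinearEquiv.ofInjective u.2.toLinearMap hu
  let v' : bilinMaps κ Pl (TangentSpace 𝓘(ℝ, F) u.proj ⧸ Pl) := v
  let b : Rn m →ₗ[ℝ] Rn m →ₗ[ℝ] F :=
    (v'.1.compl₁₂ e.toLinearMap e.toLinearMap).compr₂ σ
  let β : Rn m →L[ℝ] Rn m →L[ℝ] F := LinearMap.toContinuousBilinearMap b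
  have hβ : ∀ s t, β s t = σ (v'.1 (e s) (e t)) := fun s t => rfl
  refine ⟨β, v'.2.map σ.toAddMonoidHom e, ?_⟩
  refine congrArg (TotalSpace.mk (contactOf u hu)) (Subtype.ext ?_)
  refine LinearMap.ext fun x => LinearMap.ext fun y => ?_
  change Pl.mkQ (σ (v'.1 (e (e.symm x)) (e (e.symm y)))) = v'.1 x y
  refine (congrArg₂ (fun x y => Pl.mkQ (σ (v'.1 x y))) (e.apply_symm_apply x)
    (e.apply_symm_apply y)).trans ?_
  exact LinearMap.congr_fun hσ _

variable [IsManifold 𝓘(ℝ, F) ∞ M]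

/-- The fibre coordinates of the class of a vertical double velocity. -/
theorem vPretriv_verticalClass {κ : Kind} {c : ChartIndex F M m} {u : Velocity m 𝓘(ℝ, F) M}
    (hu : IsRegular u) (hc : contactOf u hu ∈ chartDomain c)
    (β : Rn m →L[ℝ] Rn m →L[ℝ] TangentSpace 𝓘(ℝ, F) u.proj) (hβ : κ.Holds (fun s t => β s t))
    (s t : Rn m) :
    (vPretriv κ c (verticalClass κ u hu β hβ)).2.1 (firstLin c u s) (firstLin c u t) =
      (frame c u.proj (β s t)).2 - slope c (contactOf u hu) (frame c u.proj (β s t)).1 := by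
  have h1 := vPretriv_apply κ c hc (verticalClass κ u hu β hβ).2
  have h2 : (vPretriv κ c (verticalClass κ u hu β hβ)).2 =
    vCoord κ c (contactOf u hu) hc.2 (verticalClass κ u hu β hβ).2 := congrArg Prod.snd h1
  let e := LinearEquiv.ofInjective u.2.toLinearMap hu
  have h3 : ∀ s : Rn m, (firstCoordEquiv c (contactOf u hu) hc.2).symm (firstLin c u s) = e s :=
    fun s => (LinearEquiv.symm_apply_eq _).2 rfl
  have h4 : (verticalClass κ u hu β hβ).2.1 (e s) (e t) =
      Submodule.Quotient.mk (p := (contactOf u hu).plane) (β s t) :=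
    congrArg₂ (fun x y => Submodule.Quotient.mk (p := (contactOf u hu).plane) (β x y))
      (e.symm_apply_apply s) (e.symm_apply_apply t)
  refine (congrArg (fun w : BilinModel κ m (Module.finrank ℝ F - m) =>
    w.1 (firstLin c u s) (firstLin c u t)) h2).trans ?_
  refine (vCoord_apply κ c (contactOf u hu) hc.2 _ _ _).trans ?_
  refine (congrArg₂ (fun x y => normalCoord c (contactOf u hu) hc.2
    ((verticalClass κ u hu β hβ).2.1 x y)) (h3 s) (h3 t)).trans ?_
  exact (congrArg (normalCoord c (contactOf u hu) hc.2) h4).trans (normalCoord_mk c _ hc.2 _)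

end VerticalClasses

section SecondOrder

variable {F : Type*} [NormedAddCommGroup F] [NormedSpace ℝ F]
  {M : Type*} [TopologicalSpace M] [ChartedSpace F M] [IsManifold 𝓘(ℝ, F) ∞ M] {m : ℕ}

theorem exists_secondOrder {c : ChartIndex F M m} {W : DoubleVelocity F M m}
    (hu : IsRegular W.proj) (hc : contactOf W.proj hu ∈ chartDomain c) :
    ∃ β : Rn m →L[ℝ] Rn m →L[ℝ] Rn (Module.finrank ℝ F - m), ∀ t s,
      β (firstLin c W.proj t) (firstLin c W.proj s) =
      (c.2 ((velDeriv c.1 W.proj (W.2 t)).2 s)).2 -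
        slope c (contactOf W.proj hu) (c.2 ((velDeriv c.1 W.proj (W.2 t)).2 s)).1 := by
  obtain ⟨u, hu'⟩ := ((contactOf_mem_chartDomain_iff hu).1 hc).2
  let W' : Rn m →L[ℝ] TangentSpace (velocityModel F m) W.proj := W.2
  let N : Rn m →L[ℝ] Rn m →L[ℝ] F :=
    (ContinuousLinearMap.snd ℝ _ _ ∘L velDeriv c.1 W.proj) ∘L W'
  let φ : F →L[ℝ] Rn (Module.finrank ℝ F - m) := (ContinuousLinearMap.snd ℝ _ _ -
    slope c (contactOf W.proj hu) ∘L ContinuousLinearMap.fst ℝ _ _) ∘L c.2.toContinuousLinearMap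
  let v : Rn m →L[ℝ] Rn m := (u⁻¹ : (Rn m →L[ℝ] Rn m)ˣ).1
  have hv : ∀ t, v (firstLin c W.proj t) = t := by
    intro t
    rw [← hu']
    exact congrArg (fun f : Rn m →L[ℝ] Rn m => f t) u.inv_mul
  refine ⟨ContinuousLinearMap.compL ℝ (Rn m) F _ φ ∘L N.bilinearComp v v, fun t s => ?_⟩
  change φ (N (v _) (v _)) = _
  rw [hv, hv]
  rfl

end SecondOrder

section SemiholonomicElements

variable {F : Type*} [NormedAddCommGroup F] [NormedSpace ℝ F]
  {M : Type*} [TopologicalSpace M] [ChartedSpace F M] [IsManifold 𝓘(ℝ, F) ∞ M] {m : ℕ}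
  [FiniteDimensional ℝ F]

/-- The second order coordinates of a double contact element. -/
def secondCoord (c : ChartIndex F M m)
    (q : (Rn (Module.finrank ℝ F - m) × (Rn m →L[ℝ] Rn (Module.finrank ℝ F - m))) ≃L[ℝ]
      Rn (Module.finrank ℝ (ContactModel F m) - m))
    (z : DoubleContactElement F M m) : Rn m →L[ℝ] Rn m →L[ℝ] Rn (Module.finrank ℝ F - m) :=
  ContinuousLinearMap.snd ℝ _ _ ∘L q.symm.toContinuousLinearMap ∘L slope (doubleIndex c q) z

variable (q : (Rn (Module.finrank ℝ F - m) × (Rn m →L[ℝ] Rn (Module.finrank ℝ F - m))) ≃L[ℝ]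
      Rn (Module.finrank ℝ (ContactModel F m) - m))

theorem secondCoord_semiElement (c : ChartIndex F M m) (P : ContactElement F M m)
    (β : Rn m →L[ℝ] Rn m →L[ℝ] Rn (Module.finrank ℝ F - m)) :
    secondCoord c q (semiElement c q P β) = β := by
  rw [secondCoord, semiElement, slope_ofSlope]
  ext1 t
  change (q.symm (q (slope c P t, β t))).2 = β t
  rw [q.symm_apply_apply]

theorem semiElement_mem_chartDomain {c : ChartIndex F M m} {P : ContactElement F M m}
    (hP : P ∈ chartDomain c) (β : Rn m →L[ℝ] Rn m →L[ℝ] Rn (Module.finrank ℝ F - m)) :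
    semiElement c q P β ∈ chartDomain (doubleIndex c q) :=
  ⟨hP, injective_firstCoord_ofSlope _ _ _⟩

/-- The addition of a vertical double velocity `(u, b)` leaves the projection to `T_m M` unchanged and
adds the coordinates of the class of `(u, b)` to the second order coordinates. -/
theorem represents_addVertical {c : ChartIndex F M m} {W : DoubleVelocity F M m}
    (hW : IsSemiholonomic W) (hu : IsRegular W.proj) (hc : contactOf W.proj hu ∈ chartDomain c)
    {β : Rn m →L[ℝ] Rn m →L[ℝ] Rn (Module.finrank ℝ F - m)}
    (hβ : Represents W (semiElement c q (contactOf W.proj hu) β))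
    (b : Rn m →L[ℝ] Rn m →L[ℝ] TangentSpace 𝓘(ℝ, F) W.proj.proj) :
    Represents (addVertical W b) (semiElement c q (contactOf W.proj hu)
      (β + (vPretriv .all c (verticalClass .all W.proj hu b trivial)).2.1)) := by
  obtain ⟨β₀, hβ₀⟩ := exists_secondOrder hu hc
  have h1 := hβ.unique (represents_semiElement q hW hu hc β₀ hβ₀)
  have h2 : β = β₀ := by
    rw [← secondCoord_semiElement q c (contactOf W.proj hu) β, h1, secondCoord_semiElement]
  subst h2
  have hux := (contactOf_mem_chartDomain_iff hu).1 hc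
  refine represents_semiElement (W := addVertical W b) q (hW.addVertical b) hu hc _
    (fun t s => ?_)
  have h3 : velDeriv c.1 W.proj (W.2 t + verticalLift W.proj b t) =
      velDeriv c.1 W.proj (W.2 t) +
        (0, (tangentCoord c.1 W.proj.proj : TangentSpace 𝓘(ℝ, F) W.proj.proj →L[ℝ] F) ∘L b t) := by
    rw [← velDeriv_verticalLift c.1 hux.1]
    exact ContinuousLinearMap.map_add _ _ _
  have h4 : c.2 ((velDeriv c.1 W.proj (W.2 t + verticalLift W.proj b t)).2 s) =
      c.2 ((velDeriv c.1 W.proj (W.2 t)).2 s) + frame c W.proj.proj (b t s) := by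
    rw [h3]
    exact map_add c.2 _ _
  refine (congrArg₂ (fun x y => x + y) (hβ₀ t s)
    (vPretriv_verticalClass (κ := .all) hu hc b trivial t s)).trans ?_
  refine Eq.trans ?_ (congrArg (fun p : Rn m × Rn (Module.finrank ℝ F - m) =>
    p.2 - slope c (contactOf W.proj hu) p.1) h4).symm
  simp only [Prod.fst_add, Prod.snd_add, map_add]
  abel

/-- A representative is obtained by adding a vertical double velocity to a holonomic representative
of the element with second order coordinates `0`. -/
theorem semiElement_mem_semiholonomicContact {c : ChartIndex F M m} {P : ContactElement F M m}
    (hP : P ∈ chartDomain c) (β : Rn m →L[ℝ] Rn m →L[ℝ] Rn (Module.finrank ℝ F - m)) :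
    semiElement c q P β ∈ semiholonomicContact F M m := by
  obtain ⟨W, hW, hWz⟩ := exists_isHolonomic_represents q hP 0 (fun _ _ => rfl)
  have hu := hWz.isRegular
  have hpt : P = contactOf W.proj hu := hWz.pt_eq hu
  subst hpt
  let w : BilinModel .all m (Module.finrank ℝ F - m) := ⟨β, trivial⟩
  obtain ⟨b, hb, hbv⟩ := exists_verticalClass_eq hu
    ((vCoord .all c (contactOf W.proj hu) hP.2).symm w)
  have h1 := represents_addVertical q hW.isSemiholonomic hu hP hWz b
  rw [hbv, vPretriv_apply _ _ hP, LinearEquiv.apply_symm_apply, zero_add] at h1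
  exact ⟨_, h1, hW.isSemiholonomic.addVertical b⟩

theorem eq_semiElement {c : ChartIndex F M m} {z : DoubleContactElement F M m}
    (hz : z ∈ semiholonomicContact F M m) (hc : z.pt ∈ chartDomain c) :
    z = semiElement c q z.pt (secondCoord c q z) := by
  obtain ⟨W, hWz, hW⟩ := hz
  have hu := hWz.isRegular
  have hpt := hWz.pt_eq hu
  rw [hpt] at hc
  obtain ⟨β, hβ⟩ := exists_secondOrder hu hc
  have h1 := hWz.unique (represents_semiElement q hW hu hc β hβ)
  rw [h1, secondCoord_semiElement]
  rfl

/-- In one direction the second order coordinates are, up to the slope, a second derivative of a map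
into `M`, and hence symmetric; in the other they are the second derivative of a quadratic map. -/
theorem semiElement_mem_holonomicContact_iff {c : ChartIndex F M m} {P : ContactElement F M m}
    (hP : P ∈ chartDomain c) (β : Rn m →L[ℝ] Rn m →L[ℝ] Rn (Module.finrank ℝ F - m)) :
    semiElement c q P β ∈ holonomicContact F M m ↔ ∀ s t, β s t = β t s := by
  constructor
  · rintro ⟨W, hWz, hW⟩
    have hu := hWz.isRegular
    have hpt : P = contactOf W.proj hu := hWz.pt_eq hu
    subst hpt
    obtain ⟨β₀, hβ₀⟩ := exists_secondOrder hu hP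
    have h1 := hWz.unique (represents_semiElement q hW.isSemiholonomic hu hP β₀ hβ₀)
    have h2 : β = β₀ := by
      rw [← secondCoord_semiElement q c (contactOf W.proj hu) β, h1, secondCoord_semiElement]
    subst h2
    have hux := (contactOf_mem_chartDomain_iff hu).1 hP
    intro s t
    obtain ⟨s, rfl⟩ := (ContinuousLinearMap.isUnit_iff_bijective.1 hux.2).2 s
    obtain ⟨t, rfl⟩ := (ContinuousLinearMap.isUnit_iff_bijective.1 hux.2).2 t
    rw [hβ₀, hβ₀, hW.velDeriv_symm hux.1]
  · intro hβ
    obtain ⟨W, hW, hWz⟩ := exists_isHolonomic_represents q hP β hβ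
    exact ⟨W, hWz, hW⟩

theorem holonomicContact_subset : holonomicContact F M m ⊆ semiholonomicContact F M m :=
  fun _ ⟨W, hWz, hW⟩ => ⟨W, hWz, hW.isSemiholonomic⟩

/-- The action of `V^m J^m` on double contact elements: the addition of the second order
coordinates. It is defined with a chosen chart around each contact element, but does not depend
on this chart on semiholonomic elements. -/
def addContact (z : DoubleContactElement F M m)
    (v : TotalSpace (BilinModel .all m (Module.finrank ℝ F - m))
      (VFiber (F := F) (M := M) (m := m) .all)) : DoubleContactElement F M m :=
  semiElement (chartIndexAt z.pt) q z.pt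
    (secondCoord (chartIndexAt z.pt) q z + (vPretriv .all (chartIndexAt z.pt) v).2.1)

/-- The defining property of the action. It determines `addContact` on semiholonomic elements, as a
double velocity represents at most one element. -/
theorem represents_addContact {W : DoubleVelocity F M m} {z : DoubleContactElement F M m}
    (hu : IsRegular W.proj) (b : Rn m →L[ℝ] Rn m →L[ℝ] TangentSpace 𝓘(ℝ, F) W.proj.proj)
    (hW : IsSemiholonomic W) (hWz : Represents W z) :
    Represents (addVertical W b) (addContact q z (verticalClass .all W.proj hu b trivial)) := by
  have hpt := hWz.pt_eq hu
  have hc := mem_chartDomain_chartIndexAt z.pt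
  have h1 := eq_semiElement q ⟨W, hWz, hW⟩ hc
  have key : ∀ (c : ChartIndex F M m) (β : Rn m →L[ℝ] Rn m →L[ℝ] Rn (Module.finrank ℝ F - m)),
      z.pt ∈ chartDomain c → Represents W (semiElement c q z.pt β) →
      Represents (addVertical W b) (semiElement c q z.pt
        (β + (vPretriv .all c (verticalClass .all W.proj hu b trivial)).2.1)) := by
    rw [hpt]
    exact fun c β hc hβ => represents_addVertical q hW hu hc hβ b
  exact key _ _ hc (by rw [← h1]; exact hWz)

/-- In every chart the action is the addition of second order coordinates: both sides are represented
by the same double velocity. -/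
theorem addContact_semiElement {c : ChartIndex F M m} {P : ContactElement F M m}
    (hP : P ∈ chartDomain c) (β : Rn m →L[ℝ] Rn m →L[ℝ] Rn (Module.finrank ℝ F - m))
    (v : VFiber .all P) :
    addContact q (semiElement c q P β) ⟨P, v⟩ =
      semiElement c q P (β + (vPretriv .all c ⟨P, v⟩).2.1) := by
  obtain ⟨W, hWz, hW⟩ := semiElement_mem_semiholonomicContact q hP β
  have hu := hWz.isRegular
  have hpt : P = contactOf W.proj hu := hWz.pt_eq hu
  subst hpt
  obtain ⟨b, hb, hbv⟩ := exists_verticalClass_eq hu v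
  rw [← hbv]
  exact (represents_addContact q hu b hW hWz).unique (represents_addVertical q hW hu hP hWz b)

end SemiholonomicElements

/-! ### Orbits of vertical double velocities -/

section Orbits

variable {F : Type*} [NormedAddCommGroup F] [NormedSpace ℝ F]
  {M : Type*} [TopologicalSpace M] [ChartedSpace F M] {m : ℕ}

theorem contactOf_velocityScale {u : Velocity m 𝓘(ℝ, F) M} (hu : IsRegular u)
    (A : Rn m ≃L[ℝ] Rn m) (hu' : IsRegular (velocityScale (u, (A : Rn m →L[ℝ] Rn m)))) :
    contactOf (velocityScale (u, (A : Rn m →L[ℝ] Rn m))) hu' = contactOf u hu := by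
  refine ContactElement.ext rfl ?_
  change LinearMap.range (u.2.toLinearMap ∘ₗ A.toLinearEquiv.toLinearMap) =
    LinearMap.range u.2.toLinearMap
  rw [LinearMap.range_comp_of_range_eq_top _ A.toLinearEquiv.range]

theorem exists_velocityScale_eq {u u' : Velocity m 𝓘(ℝ, F) M} (hu : IsRegular u)
    (hu' : IsRegular u') (h : contactOf u hu = contactOf u' hu') :
    ∃ A : Rn m ≃L[ℝ] Rn m, u' = velocityScale (u, (A : Rn m →L[ℝ] Rn m)) := by
  obtain ⟨x, L⟩ := u
  obtain ⟨x', L'⟩ := u'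
  obtain rfl : x = x' := congrArg ContactElement.pt h
  have hr : LinearMap.range L.toLinearMap = LinearMap.range L'.toLinearMap :=
    (ContactElement.mk.inj h).2
  let A : Rn m ≃ₗ[ℝ] Rn m := (LinearEquiv.ofInjective L'.toLinearMap hu').trans
    ((LinearEquiv.ofEq _ _ hr.symm).trans (LinearEquiv.ofInjective L.toLinearMap hu).symm)
  have hA : ∀ t : Rn m, L (A t) = L' t := fun t =>
    congrArg Subtype.val ((LinearEquiv.ofInjective L.toLinearMap hu).apply_symm_apply
      (LinearEquiv.ofEq _ _ hr.symm (LinearEquiv.ofInjective L'.toLinearMap hu' t)))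
  refine ⟨A.toContinuousLinearEquiv, congrArg (TotalSpace.mk x) ?_⟩
  ext1 t
  exact (hA t).symm

variable [IsManifold 𝓘(ℝ, F) ∞ M] [FiniteDimensional ℝ F]

/-- Up to a change of the basis of the plane, two vertical double velocities have the same class
if and only if they differ by a bilinear map with values in the plane. -/
theorem verticalClass_eq_velocityScale_iff {κ : Kind} {u : Velocity m 𝓘(ℝ, F) M}
    (hu : IsRegular u) (β : Rn m →L[ℝ] Rn m →L[ℝ] TangentSpace 𝓘(ℝ, F) u.proj)
    (hβ : κ.Holds (fun s t => β s t)) (A : Rn m ≃L[ℝ] Rn m)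
    (hu' : IsRegular (velocityScale (u, (A : Rn m →L[ℝ] Rn m))))
    (β' : Rn m →L[ℝ] Rn m →L[ℝ] TangentSpace 𝓘(ℝ, F) u.proj)
    (hβ' : κ.Holds (fun s t => β' s t)) :
    verticalClass κ u hu β hβ =
        verticalClass κ (velocityScale (u, (A : Rn m →L[ℝ] Rn m))) hu' β' hβ' ↔
      ∀ s t, β' s t - β (A s) (A t) ∈ (contactOf u hu).plane := by
  let u' := velocityScale (u, (A : Rn m →L[ℝ] Rn m))
  have hP : contactOf u' hu' = contactOf u hu := contactOf_velocityScale hu A hu'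
  let c := chartIndexAt (contactOf u hu)
  have hc : contactOf u hu ∈ chartDomain c := mem_chartDomain_chartIndexAt _
  have hc' : contactOf u' hu' ∈ chartDomain c := hP ▸ hc
  have h1 : verticalClass κ u hu β hβ = verticalClass κ u' hu' β' hβ' ↔
      (vPretriv κ c (verticalClass κ u hu β hβ)).2 =
        (vPretriv κ c (verticalClass κ u' hu' β' hβ')).2 := by
    constructor
    · intro h
      rw [h]
    · intro h
      have h2 : vPretriv κ c (verticalClass κ u hu β hβ) =
          vPretriv κ c (verticalClass κ u' hu' β' hβ') := Prod.ext hP.symm h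
      have h3 : verticalClass κ u hu β hβ ∈ (vPretriv κ c).source := hc
      have h4 : verticalClass κ u' hu' β' hβ' ∈ (vPretriv κ c).source := hc'
      exact (vPretriv κ c).injOn h3 h4 h2
  have hfl : ∀ s, firstLin c u' s = firstLin c u (A s) := fun s => rfl
  have hsurj := (ContinuousLinearMap.isUnit_iff_bijective.1
    ((contactOf_mem_chartDomain_iff hu').1 hc').2).2
  have h2 : (vPretriv κ c (verticalClass κ u hu β hβ)).2 =
        (vPretriv κ c (verticalClass κ u' hu' β' hβ')).2 ↔ ∀ s t,
      (frame c u.proj (β (A s) (A t))).2 -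
        slope c (contactOf u hu) (frame c u.proj (β (A s) (A t))).1 =
      (frame c u.proj (β' s t)).2 - slope c (contactOf u hu) (frame c u.proj (β' s t)).1 := by
    have e1 := fun s t => vPretriv_verticalClass hu hc β hβ (A s) (A t)
    have e2 := fun s t => vPretriv_verticalClass hu' hc' β' hβ' s t
    rw [hP] at e2
    constructor
    · intro h s t
      refine (e1 s t).symm.trans (Eq.trans ?_ (e2 s t))
      exact congrArg (fun w : BilinModel κ m (Module.finrank ℝ F - m) =>
        w.1 (firstLin c u' s) (firstLin c u' t)) h
    · intro h
      refine Subtype.ext ?_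
      ext1 a
      ext1 b
      obtain ⟨s, rfl⟩ := hsurj a
      obtain ⟨t, rfl⟩ := hsurj b
      exact (e1 s t).trans ((h s t).trans (e2 s t).symm)
  rw [h1, h2]
  refine forall₂_congr fun s t => ?_
  refine Iff.trans ?_ (mem_plane_iff hc.2 _).symm
  have h3 : frame c u.proj (β' s t - β (A s) (A t)) =
    frame c u.proj (β' s t) - frame c u.proj (β (A s) (A t)) := map_sub _ _ _
  refine Iff.trans ?_ (Eq.congr (congrArg Prod.snd h3)
    (congrArg (fun p => slope c (contactOf u hu) p.1) h3)).symm
  rw [Prod.snd_sub, Prod.fst_sub, map_sub, sub_eq_sub_iff_sub_eq_sub, eq_comm, eq_comm]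
  constructor
  · intro h; rw [sub_eq_sub_iff_add_eq_add] at h ⊢; rw [add_comm, ← h, add_comm]
  · intro h; rw [sub_eq_sub_iff_add_eq_add] at h ⊢; rw [add_comm, ← h, add_comm]

/-- The vertical double velocities `(L, β)` and `(L A, β')` have the same class if and only if
`β' - β(A ·, A ·)` takes values in the image of `L`, that is, equals `L B` for some bilinear `B`. A
left inverse of `L` provides this `B`, with the same symmetry as `β` and `β'`. -/
theorem verticalClass_eq_iff {κ : Kind} {u : Velocity m 𝓘(ℝ, F) M} (hu : IsRegular u)
    (β : Rn m →L[ℝ] Rn m →L[ℝ] TangentSpace 𝓘(ℝ, F) u.proj) (hβ : κ.Holds (fun s t => β s t))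
    {u' : Velocity m 𝓘(ℝ, F) M} (hu' : IsRegular u')
    (β' : Rn m →L[ℝ] Rn m →L[ℝ] TangentSpace 𝓘(ℝ, F) u'.proj)
    (hβ' : κ.Holds (fun s t => β' s t)) :
    verticalClass κ u hu β hβ = verticalClass κ u' hu' β' hβ' ↔
      ∃ (A : Rn m ≃L[ℝ] Rn m) (B : Rn m →L[ℝ] Rn m →L[ℝ] Rn m),
        κ.Holds (fun s t => B s t) ∧
        verticalVelocity u' β' = doubleVelocityAct (verticalVelocity u β) A A B := by
  let L : Rn m →L[ℝ] F := u.2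
  let b : Rn m →L[ℝ] Rn m →L[ℝ] F := β
  constructor
  · intro h
    obtain ⟨A, rfl⟩ := exists_velocityScale_eq hu hu' (congrArg TotalSpace.proj h)
    have h1 := (verticalClass_eq_velocityScale_iff hu β hβ A hu' β' hβ').1 h
    obtain ⟨g, hg⟩ := LinearMap.exists_leftInverse_of_injective L.toLinearMap
      (LinearMap.ker_eq_bot.2 hu)
    let g' : F →L[ℝ] Rn m := LinearMap.toContinuousLinearMap g
    let b' : Rn m →L[ℝ] Rn m →L[ℝ] F := β'
    let D : Rn m →L[ℝ] Rn m →L[ℝ] F :=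
      b' - b.bilinearComp (A : Rn m →L[ℝ] Rn m) (A : Rn m →L[ℝ] Rn m)
    have hD : ∀ s t, D s t = b' s t - b (A s) (A t) := fun s t => rfl
    have hD' : ∀ s t, L (g (D s t)) = D s t := by
      intro s t
      obtain ⟨r, hr⟩ := h1 s t
      have hr' : L r = D s t := hr
      have hgr : g (L r) = r := LinearMap.congr_fun hg r
      rw [← hr', hgr]
    refine ⟨A, ContinuousLinearMap.compL ℝ (Rn m) F (Rn m) g' ∘L D, ?_, ?_⟩
    · have h2 : κ.Holds (fun s t => b (A s) (A t)) := hβ.map (AddMonoidHom.id F) A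
      have h3 : κ.Holds (fun s t => -b (A s) (A t)) := h2.map (-AddMonoidHom.id F) id
      have h4 : κ.Holds (fun s t => D s t) := by
        simp only [hD, sub_eq_add_neg]
        exact Kind.Holds.add (β := fun s t => b' s t) hβ' h3
      exact h4.map g.toAddMonoidHom id
    · refine (doubleVelocityAct_verticalVelocity u β A _ β' fun s t => ?_).symm
      refine Eq.trans ?_ (congrArg (fun x : F => b (A s) (A t) + x) (hD' s t)).symm
      exact (add_sub_cancel (b (A s) (A t)) (b' s t)).symm
  · rintro ⟨A, B, hB, h⟩
    let b₀ : Rn m →L[ℝ] Rn m →L[ℝ] F :=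
      b.bilinearComp (A : Rn m →L[ℝ] Rn m) (A : Rn m →L[ℝ] Rn m) +
        ContinuousLinearMap.compL ℝ (Rn m) (Rn m) F L ∘L B
    rw [doubleVelocityAct_verticalVelocity u β A B b₀ fun s t => rfl] at h
    obtain rfl : u' = velocityScale (u, (A : Rn m →L[ℝ] Rn m)) := congrArg TotalSpace.proj h
    obtain rfl : β' = b₀ := verticalVelocity_injective h
    refine (verticalClass_eq_velocityScale_iff hu β hβ A hu' _ hβ').2 fun s t => ⟨B s t, ?_⟩
    exact (add_sub_cancel_left (b (A s) (A t)) (L (B s t))).symm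

end Orbits

/-! ### Smoothness in coordinates -/

section Smoothness

variable {F : Type*} [NormedAddCommGroup F] [NormedSpace ℝ F]
  {M : Type*} [TopologicalSpace M] [ChartedSpace F M] [IsManifold 𝓘(ℝ, F) ∞ M] {m : ℕ}
  [FiniteDimensional ℝ F]
  {EN HN N : Type*} [NormedAddCommGroup EN] [NormedSpace ℝ EN] [TopologicalSpace HN]
  [TopologicalSpace N] [ChartedSpace HN N] {IN : ModelWithCorners ℝ EN HN}

theorem contMDiffAt_contactChart {c : ChartIndex F M m} {z : ContactElement F M m}
    (hz : z ∈ chartDomain c) :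
    ContMDiffAt 𝓘(ℝ, ContactModel F m) 𝓘(ℝ, ContactModel F m) ∞ (contactChart c) z :=
  contMDiffAt_of_mem_maximalAtlas (jetChart_mem_maximalAtlas c) hz

theorem contMDiffAt_pt (z : ContactElement F M m) :
    ContMDiffAt 𝓘(ℝ, ContactModel F m) 𝓘(ℝ, F) ∞ (ContactElement.pt (F := F) (M := M)) z := by
  let c := chartIndexAt z
  have hz : z ∈ chartDomain c := mem_chartDomain_chartIndexAt z
  have h1 : ContMDiffAt 𝓘(ℝ, ContactModel F m) 𝓘(ℝ, F) ∞ (fun z => (contactChart c z).1) z :=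
    contDiff_fst.contMDiff.contMDiffAt.comp z (contMDiffAt_contactChart hz)
  have h2 : ContMDiffAt 𝓘(ℝ, F) 𝓘(ℝ, F) ∞ c.1.1.symm (contactChart c z).1 :=
    (contMDiffOn_symm_of_mem_maximalAtlas (IsManifold.subset_maximalAtlas c.1.2)).contMDiffAt
      (c.1.1.open_target.mem_nhds (c.1.1.map_source hz.1))
  refine (h2.comp z h1).congr_of_eventuallyEq ?_
  filter_upwards [(isOpen_chartDomain c).mem_nhds hz] with z' hz'
  exact (c.1.1.left_inv hz'.1).symm

theorem contMDiffAt_slope {c : ChartIndex F M m} {z : ContactElement F M m}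
    (hz : z ∈ chartDomain c) :
    ContMDiffAt 𝓘(ℝ, ContactModel F m) 𝓘(ℝ, Rn m →L[ℝ] Rn (Module.finrank ℝ F - m)) ∞
      (slope c) z :=
  (contDiff_snd (E := F)).contMDiff.contMDiffAt.comp z (contMDiffAt_contactChart hz)

theorem contMDiffWithinAt_ofSlope {c : ChartIndex F M m} {f : N → M}
    {A : N → Rn m →L[ℝ] Rn (Module.finrank ℝ F - m)} {s : Set N} {x : N}
    (hx : f x ∈ c.1.1.source) (hf : ContMDiffWithinAt IN 𝓘(ℝ, F) ∞ f s x)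
    (hA : ContMDiffWithinAt IN 𝓘(ℝ, Rn m →L[ℝ] Rn (Module.finrank ℝ F - m)) ∞ A s x) :
    ContMDiffWithinAt IN 𝓘(ℝ, ContactModel F m) ∞ (fun y => ofSlope c (f y) (A y)) s x := by
  have h1 : ContMDiffWithinAt IN 𝓘(ℝ, ContactModel F m) ∞ (fun y => (c.1.1 (f y), A y)) s x :=
    ((contMDiffAt_of_mem_maximalAtlas (IsManifold.subset_maximalAtlas c.1.2)
      hx).comp_contMDiffWithinAt x hf).prodMk_space hA
  have h2 : ContMDiffAt 𝓘(ℝ, ContactModel F m) 𝓘(ℝ, ContactModel F m) ∞ (jetChart c).1.symm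
      (c.1.1 (f x), A x) :=
    (contMDiffOn_symm_of_mem_maximalAtlas (jetChart_mem_maximalAtlas c)).contMDiffAt
      ((jetChart c).1.open_target.mem_nhds ⟨c.1.1.map_source hx, mem_univ _⟩)
  have h3 : ∀ y, f y ∈ c.1.1.source →
      ofSlope c (f y) (A y) = (jetChart c).1.symm (c.1.1 (f y), A y) := by
    intro y hy
    change _ = ofSlope c (c.1.1.symm (c.1.1 (f y))) (A y)
    rw [c.1.1.left_inv hy]
  refine (h2.comp_contMDiffWithinAt x h1).congr_of_eventuallyEq ?_ (h3 x hx)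
  filter_upwards [hf.continuousWithinAt.preimage_mem_nhdsWithin
    (c.1.1.open_source.mem_nhds hx)] with y hy
  exact h3 y hy

/-- The trivialization of the bundle `V^m J^m` given by a chart. -/
def vTriv (κ : Kind) (c : ChartIndex F M m) :
    Trivialization (BilinModel κ m (Module.finrank ℝ F - m))
      (π (BilinModel κ m (Module.finrank ℝ F - m)) (VFiber (F := F) (M := M) (m := m) κ)) :=
  (vPrebundle F M m κ).trivializationOfMemPretrivializationAtlas (mem_range_self c)

instance (κ : Kind) (c : ChartIndex F M m) : MemTrivializationAtlas (vTriv (M := M) κ c) :=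
  ⟨_, mem_range_self c, rfl⟩

/-- Smoothness of a map into `V^m J^m` in fibre coordinates. -/
theorem contMDiffWithinAt_vertical_iff {κ : Kind} {c : ChartIndex F M m}
    {f : N → TotalSpace (BilinModel κ m (Module.finrank ℝ F - m))
      (VFiber (F := F) (M := M) (m := m) κ)} {s : Set N} {x : N}
    (hx : (f x).proj ∈ chartDomain c) :
    ContMDiffWithinAt IN (𝓘(ℝ, ContactModel F m).prod
        𝓘(ℝ, BilinModel κ m (Module.finrank ℝ F - m))) ∞ f s x ↔
      ContMDiffWithinAt IN 𝓘(ℝ, ContactModel F m) ∞ (fun y => (f y).proj) s x ∧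
      ContMDiffWithinAt IN 𝓘(ℝ, BilinModel κ m (Module.finrank ℝ F - m)) ∞
        (fun y => (vPretriv κ c (f y)).2) s x :=
  Trivialization.contMDiffWithinAt_iff (e := vTriv κ c) hx

/-- The element of `V^m J^m` with given fibre coordinates. -/
def verticalMk (κ : Kind) (c : ChartIndex F M m) (P : ContactElement F M m)
    (w : BilinModel κ m (Module.finrank ℝ F - m)) :
    TotalSpace (BilinModel κ m (Module.finrank ℝ F - m))
      (VFiber (F := F) (M := M) (m := m) κ) :=
  (vPretriv κ c).toPartialEquiv.symm (P, w)

theorem vPretriv_verticalMk (κ : Kind) {c : ChartIndex F M m} {P : ContactElement F M m}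
    (hP : P ∈ chartDomain c) (w : BilinModel κ m (Module.finrank ℝ F - m)) :
    (vPretriv κ c (verticalMk κ c P w)).2 = w :=
  congrArg Prod.snd ((vPretriv κ c).toPartialEquiv.right_inv
    (show (P, w) ∈ (vPretriv (F := F) (M := M) κ c).target from ⟨hP, mem_univ _⟩))

theorem verticalMk_vPretriv (κ : Kind) {c : ChartIndex F M m} {P : ContactElement F M m}
    (hP : P ∈ chartDomain c) (v : VFiber κ P) :
    verticalMk κ c P (vPretriv κ c ⟨P, v⟩).2 = ⟨P, v⟩ :=
  (vPretriv κ c).toPartialEquiv.left_inv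
    (show (⟨P, v⟩ : TotalSpace (BilinModel κ m (Module.finrank ℝ F - m)) _) ∈
      (vPretriv (F := F) (M := M) κ c).source from hP)

theorem contMDiffWithinAt_verticalMk {κ : Kind} {c : ChartIndex F M m}
    {f : N → ContactElement F M m} {w : N → BilinModel κ m (Module.finrank ℝ F - m)}
    {s : Set N} {x : N} (hx : f x ∈ chartDomain c)
    (hf : ContMDiffWithinAt IN 𝓘(ℝ, ContactModel F m) ∞ f s x)
    (hw : ContMDiffWithinAt IN 𝓘(ℝ, BilinModel κ m (Module.finrank ℝ F - m)) ∞ w s x) :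
    ContMDiffWithinAt IN (𝓘(ℝ, ContactModel F m).prod
        𝓘(ℝ, BilinModel κ m (Module.finrank ℝ F - m))) ∞
      (fun y => verticalMk κ c (f y) (w y)) s x := by
  refine (contMDiffWithinAt_vertical_iff (f := fun y => verticalMk κ c (f y) (w y))
    (c := c) hx).2 ⟨hf, ?_⟩
  refine hw.congr_of_eventuallyEq ?_ (vPretriv_verticalMk κ hx _)
  filter_upwards [hf.continuousWithinAt.preimage_mem_nhdsWithin
    ((isOpen_chartDomain c).mem_nhds hx)] with y hy
  exact vPretriv_verticalMk κ hy _

theorem vPretriv_vIncl {κ : Kind} {c : ChartIndex F M m} {P : ContactElement F M m}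
    (hP : P ∈ chartDomain c) (v : VFiber κ P) :
    (vPretriv .all c (vIncl κ ⟨P, v⟩)).2.1 = (vPretriv κ c ⟨P, v⟩).2.1 := by
  rw [vPretriv_apply κ c hP]
  exact congrArg (fun p : ContactElement F M m × BilinModel .all m (Module.finrank ℝ F - m) =>
    p.2.1) (vPretriv_apply .all c hP (vIncl κ ⟨P, v⟩).2)

variable (q : (Rn (Module.finrank ℝ F - m) × (Rn m →L[ℝ] Rn (Module.finrank ℝ F - m))) ≃L[ℝ]
      Rn (Module.finrank ℝ (ContactModel F m) - m))

theorem contMDiffWithinAt_semiElement {c : ChartIndex F M m} {f : N → ContactElement F M m}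
    {β : N → Rn m →L[ℝ] Rn m →L[ℝ] Rn (Module.finrank ℝ F - m)} {s : Set N} {x : N}
    (hx : f x ∈ chartDomain c) (hf : ContMDiffWithinAt IN 𝓘(ℝ, ContactModel F m) ∞ f s x)
    (hβ : ContMDiffWithinAt IN 𝓘(ℝ, Rn m →L[ℝ] Rn m →L[ℝ] Rn (Module.finrank ℝ F - m)) ∞ β s x) :
    ContMDiffWithinAt IN 𝓘(ℝ, ContactModel (ContactModel F m) m) ∞
      (fun y => semiElement c q (f y) (β y)) s x := by
  refine contMDiffWithinAt_ofSlope (c := doubleIndex c q) hx hf ?_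
  have h1 : ContMDiffWithinAt IN 𝓘(ℝ, Rn m →L[ℝ] Rn (Module.finrank ℝ F - m)) ∞
      (fun y => slope c (f y)) s x := (contMDiffAt_slope hx).comp_contMDiffWithinAt x hf
  have h2 : ContDiff ℝ ∞ (fun p : (Rn m →L[ℝ] Rn (Module.finrank ℝ F - m)) ×
      (Rn m →L[ℝ] Rn m →L[ℝ] Rn (Module.finrank ℝ F - m)) =>
      q.toContinuousLinearMap ∘L p.1.prod p.2) := by
    have h3 : (fun p : (Rn m →L[ℝ] Rn (Module.finrank ℝ F - m)) ×
      (Rn m →L[ℝ] Rn m →L[ℝ] Rn (Module.finrank ℝ F - m)) =>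
      q.toContinuousLinearMap ∘L p.1.prod p.2) = fun p =>
        (q.toContinuousLinearMap ∘L ContinuousLinearMap.inl ℝ _ _) ∘L p.1 +
        (q.toContinuousLinearMap ∘L ContinuousLinearMap.inr ℝ _ _) ∘L p.2 := by
      funext p
      ext1 a
      change q (p.1 a, p.2 a) = q (p.1 a, 0) + q (0, p.2 a)
      rw [← map_add, Prod.mk_add_mk, add_zero, zero_add]
    rw [h3]
    exact (contDiff_const.clm_comp contDiff_fst).add (contDiff_const.clm_comp contDiff_snd)
  exact h2.contMDiff.contMDiffAt.comp_contMDiffWithinAt x (h1.prodMk_space hβ)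

theorem contMDiffAt_secondCoord {c : ChartIndex F M m} {z : DoubleContactElement F M m}
    (hz : z ∈ chartDomain (doubleIndex c q)) :
    ContMDiffAt 𝓘(ℝ, ContactModel (ContactModel F m) m)
      𝓘(ℝ, Rn m →L[ℝ] Rn m →L[ℝ] Rn (Module.finrank ℝ F - m)) ∞ (secondCoord c q) z := by
  have h1 : ContDiff ℝ ∞ (fun S : Rn m →L[ℝ] Rn (Module.finrank ℝ (ContactModel F m) - m) =>
      (ContinuousLinearMap.snd ℝ (Rn (Module.finrank ℝ F - m)) _ ∘L
        q.symm.toContinuousLinearMap) ∘L S) :=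
    contDiff_const.clm_comp contDiff_id
  exact h1.contMDiff.contMDiffAt.comp z (contMDiffAt_slope hz)

end Smoothness

/-! ### Submanifolds and affine bundles of given symmetry class -/

section Dimensions

/-- The coordinates of a symmetric bilinear map, indexed by unordered pairs. -/
def symmetricCoord (m k : ℕ) : BilinModel .symmetric m k →ₗ[ℝ] (Sym2 (Fin m) → Rn k) where
  toFun β p := Sym2.lift ⟨fun i j => β.1 (EuclideanSpace.basisFun (Fin m) ℝ i)
    (EuclideanSpace.basisFun (Fin m) ℝ j), fun _ _ => β.2 _ _⟩ p
  map_add' β γ := by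
    funext p
    induction p using Sym2.ind with
    | _ i j => rfl
  map_smul' r β := by
    funext p
    induction p using Sym2.ind with
    | _ i j => rfl

theorem bilin_ext {m k : ℕ} {β γ : Rn m →L[ℝ] Rn m →L[ℝ] Rn k}
    (h : ∀ i j, β (EuclideanSpace.basisFun (Fin m) ℝ i) (EuclideanSpace.basisFun (Fin m) ℝ j) =
      γ (EuclideanSpace.basisFun (Fin m) ℝ i) (EuclideanSpace.basisFun (Fin m) ℝ j)) : β = γ := by
  let b := (EuclideanSpace.basisFun (Fin m) ℝ).toBasis
  have h1 : β.toLinearMap₁₂ = γ.toLinearMap₁₂ :=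
    b.ext fun i => b.ext fun j => by simpa [b] using h i j
  ext1 s
  ext1 t
  exact LinearMap.congr_fun₂ h1 s t

theorem bijective_symmetricCoord (m k : ℕ) : Function.Bijective (symmetricCoord m k) := by
  constructor
  · intro β γ h
    exact Subtype.ext (bilin_ext fun i j => congrFun h s(i, j))
  · intro f
    let b := (EuclideanSpace.basisFun (Fin m) ℝ).toBasis
    let B : Rn m →ₗ[ℝ] Rn m →ₗ[ℝ] Rn k := b.constr ℝ fun i => b.constr ℝ fun j => f s(i, j)
    let β : Rn m →L[ℝ] Rn m →L[ℝ] Rn k := LinearMap.toContinuousBilinearMap B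
    have hβ : ∀ i j, β (EuclideanSpace.basisFun (Fin m) ℝ i)
        (EuclideanSpace.basisFun (Fin m) ℝ j) = f s(i, j) := by
      intro i j
      change B _ _ = _
      have h1 : ∀ i, EuclideanSpace.basisFun (Fin m) ℝ i = b i := fun i =>
        ((EuclideanSpace.basisFun (Fin m) ℝ).coe_toBasis ▸ rfl)
      rw [h1, h1, b.constr_basis, b.constr_basis]
    have hs : β = β.flip := bilin_ext fun i j => by
      rw [ContinuousLinearMap.flip_apply, hβ, hβ, Sym2.eq_swap]
    refine ⟨⟨β, fun s t => congrArg (fun γ : Rn m →L[ℝ] Rn m →L[ℝ] Rn k => γ s t) hs⟩, ?_⟩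
    funext p
    induction p using Sym2.ind with
    | _ i j => exact hβ i j

theorem finrank_bilinModel_symmetric (m k : ℕ) :
    Module.finrank ℝ (BilinModel .symmetric m k) = m * (m + 1) / 2 * k := by
  rw [(LinearEquiv.ofBijective _ (bijective_symmetricCoord m k)).finrank_eq,
    Module.finrank_pi_fintype]
  simp [Sym2.card, Nat.choose_two_right, mul_comm]

theorem finrank_clm (V W : Type*) [NormedAddCommGroup V] [NormedSpace ℝ V]
    [FiniteDimensional ℝ V] [NormedAddCommGroup W] [NormedSpace ℝ W] [FiniteDimensional ℝ W] :
    Module.finrank ℝ (V →L[ℝ] W) = Module.finrank ℝ V * Module.finrank ℝ W := by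
  rw [← (LinearMap.toContinuousLinearMap (𝕜 := ℝ) (E := V) (F' := W)).finrank_eq,
    Module.finrank_linearMap]

theorem finrank_bilinModel_all (m k : ℕ) :
    Module.finrank ℝ (BilinModel .all m k) = m * m * k := by
  have h : bilinModel .all m k = ⊤ := eq_top_iff.2 fun _ _ => trivial
  change Module.finrank ℝ (bilinModel .all m k) = _
  rw [h, finrank_top, finrank_clm, finrank_clm]
  simp [mul_assoc]

end Dimensions

section SecondOrderCoordinates

variable {F : Type*} [NormedAddCommGroup F] [NormedSpace ℝ F] {m : ℕ}
  {q : (Rn (Module.finrank ℝ F - m) × (Rn m →L[ℝ] Rn (Module.finrank ℝ F - m))) ≃L[ℝ]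
      Rn (Module.finrank ℝ (ContactModel F m) - m)}

variable (q) in
/-- The second order coordinate space inside the coordinate space of double contact elements. -/
def secondOrderParam (κ : Kind) :
    (F × (Rn m →L[ℝ] Rn (Module.finrank ℝ F - m))) × BilinModel κ m (Module.finrank ℝ F - m) →ₗ[ℝ]
      ContactModel (ContactModel F m) m where
  toFun p := (p.1, q.toContinuousLinearMap ∘L p.1.2.prod p.2.1)
  map_add' p p' := by
    refine Prod.ext rfl ?_
    ext1 a
    exact map_add q (p.1.2 a, p.2.1 a) (p'.1.2 a, p'.2.1 a)
  map_smul' r p := by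
    refine Prod.ext rfl ?_
    ext1 a
    exact map_smul q r (p.1.2 a, p.2.1 a)

theorem secondOrderParam_injective (κ : Kind) :
    Function.Injective (secondOrderParam (F := F) (m := m) q κ) := by
  intro p p' h
  have h0 : p.1 = p'.1 :=
    congrArg (Prod.fst : ContactModel (ContactModel F m) m → ContactModel F m) h
  refine Prod.ext h0 (Subtype.ext ?_)
  ext1 a
  have h1 := congrArg (fun r : ContactModel (ContactModel F m) m => q.symm (r.2 a)) h
  have h2 : ∀ p : (F × (Rn m →L[ℝ] Rn (Module.finrank ℝ F - m))) ×
      BilinModel κ m (Module.finrank ℝ F - m),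
      q.symm ((secondOrderParam q κ p).2 a) = (p.1.2 a, p.2.1 a) := fun p => q.symm_apply_apply _
  have h3 := (h2 p).symm.trans (h1.trans (h2 p'))
  exact congrArg Prod.snd h3

end SecondOrderCoordinates

section SecondOrderSets

variable {F : Type*} [NormedAddCommGroup F] [NormedSpace ℝ F]
  {M : Type*} [TopologicalSpace M] [ChartedSpace F M] [IsManifold 𝓘(ℝ, F) ∞ M] {m : ℕ}
  [FiniteDimensional ℝ F]

variable (q : (Rn (Module.finrank ℝ F - m) × (Rn m →L[ℝ] Rn (Module.finrank ℝ F - m))) ≃L[ℝ]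
      Rn (Module.finrank ℝ (ContactModel F m) - m))

/-- The semiholonomic double contact elements whose second order coordinates are of a given
class. -/
def IsSecondOrderSet (κ : Kind) (S : Set (DoubleContactElement F M m)) : Prop :=
  S ⊆ semiholonomicContact F M m ∧
  ∀ (c : ChartIndex F M m) (P : ContactElement F M m), P ∈ chartDomain c →
    ∀ β : Rn m →L[ℝ] Rn m →L[ℝ] Rn (Module.finrank ℝ F - m),
      semiElement c q P β ∈ S ↔ β ∈ bilinModel κ m (Module.finrank ℝ F - m)

theorem isSecondOrderSet_semiholonomicContact :
    IsSecondOrderSet q .all (semiholonomicContact F M m) :=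
  ⟨Subset.rfl, fun _ _ hP β =>
    ⟨fun _ => trivial, fun _ => semiElement_mem_semiholonomicContact q hP β⟩⟩

theorem isSecondOrderSet_holonomicContact :
    IsSecondOrderSet q .symmetric (holonomicContact F M m) :=
  ⟨holonomicContact_subset, fun _ _ hP β => semiElement_mem_holonomicContact_iff q hP β⟩

variable {q}

theorem IsSecondOrderSet.exists_eq {κ : Kind} {S : Set (DoubleContactElement F M m)}
    (hS : IsSecondOrderSet q κ S) {c : ChartIndex F M m} {P : ContactElement F M m}
    (hP : P ∈ chartDomain c) {z : DoubleContactElement F M m} (hz : z ∈ S) (hpt : z.pt = P) :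
    ∃ w : BilinModel κ m (Module.finrank ℝ F - m), semiElement c q P w.1 = z := by
  subst hpt
  have h := eq_semiElement q (hS.1 hz) hP
  refine ⟨⟨secondCoord c q z, ?_⟩, h.symm⟩
  refine (hS.2 c z.pt hP _).1 ?_
  rwa [← h]

theorem IsSecondOrderSet.isSubmanifold {κ : Kind} {S : Set (DoubleContactElement F M m)}
    (hS : IsSecondOrderSet q κ S) {d : ℕ} (hd : Module.finrank ℝ F +
      m * (Module.finrank ℝ F - m) + Module.finrank ℝ (BilinModel κ m (Module.finrank ℝ F - m)) =
      d) : IsSubmanifold (ContactModel (ContactModel F m) m) S d := by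
  intro z hz
  let c := chartIndexAt z.pt
  have hc : z.pt ∈ chartDomain c := mem_chartDomain_chartIndexAt _
  refine ⟨(jetChart (doubleIndex c q)).1, jetChart_mem_maximalAtlas _, ?_,
    LinearMap.range (secondOrderParam q κ), ?_, ?_⟩
  · obtain ⟨w, hw⟩ := hS.exists_eq hc hz rfl
    rw [← hw]
    exact semiElement_mem_chartDomain q hc _
  · rw [LinearMap.finrank_range_of_inj (secondOrderParam_injective κ), ← hd,
      Module.finrank_prod, Module.finrank_prod, finrank_clm]
    simp
  · intro y hy
    have hy' : y ∈ chartDomain (doubleIndex c q) := hy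
    have hyc : y.pt ∈ chartDomain c := hy'.1
    constructor
    · intro hyS
      obtain ⟨w, hw⟩ := hS.exists_eq hyc hyS rfl
      refine ⟨(contactChart c y.pt, w), ?_⟩
      change (contactChart c y.pt, _) = (contactChart c y.pt, slope (doubleIndex c q) y)
      rw [← hw, semiElement, slope_ofSlope]
      rfl
    · rintro ⟨⟨p, w⟩, hp⟩
      have h1 : p = contactChart c y.pt := congrArg Prod.fst hp
      have h2 : q.toContinuousLinearMap ∘L p.2.prod w.1 = slope (doubleIndex c q) y :=
        congrArg Prod.snd hp
      have h3 : semiElement c q y.pt w.1 = y := by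
        rw [h1] at h2
        refine Eq.trans ?_ (ofSlope_slope hy'.2)
        rw [← h2]
        rfl
      rw [← h3]
      exact (hS.2 c y.pt hyc w.1).2 w.2

variable (q) in
theorem addContact_semiElement_vIncl {κ : Kind} {c : ChartIndex F M m} {P : ContactElement F M m}
    (hP : P ∈ chartDomain c) (β : Rn m →L[ℝ] Rn m →L[ℝ] Rn (Module.finrank ℝ F - m))
    (v : VFiber κ P) :
    addContact q (semiElement c q P β) (vIncl κ ⟨P, v⟩) =
      semiElement c q P (β + (vCoord κ c P hP.2 v).1) := by
  have h := addContact_semiElement q hP β (vIncl κ ⟨P, v⟩).2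
  refine h.trans ?_
  have h1 := vPretriv_vIncl hP v
  rw [vPretriv_apply κ c hP] at h1
  exact congrArg (fun γ => semiElement c q P (β + γ)) h1

/-- Every class of bilinear maps is a direct summand, so that a map into it is smooth if it is smooth
as a map into all bilinear maps. -/
theorem exists_projection (κ : Kind) (k : ℕ) : ∃ Pr : (Rn m →L[ℝ] Rn m →L[ℝ] Rn k) →L[ℝ]
    BilinModel κ m k, ∀ w : BilinModel κ m k, Pr w.1 = w := by
  obtain ⟨g, hg⟩ := (bilinModel κ m k).subtype.exists_leftInverse_of_injective
    (Submodule.ker_subtype _)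
  exact ⟨LinearMap.toContinuousLinearMap (F' := BilinModel κ m k) g, fun w => LinearMap.congr_fun hg w⟩

theorem semiElement_injective {c : ChartIndex F M m} {P : ContactElement F M m}
    {β γ : Rn m →L[ℝ] Rn m →L[ℝ] Rn (Module.finrank ℝ F - m)}
    (h : semiElement c q P β = semiElement c q P γ) : β = γ := by
  rw [← secondCoord_semiElement q c P β, h, secondCoord_semiElement]

/-- In the second order coordinates every fibre is the vector space of bilinear maps of kind `κ`, and
`V^m J^m` acts by translations; the local section of the trivialization is the zero section. -/
theorem IsSecondOrderSet.isAffineBundle {κ : Kind} {S : Set (DoubleContactElement F M m)}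
    (hS : IsSecondOrderSet q κ S) :
    IsAffineBundle (ContactModel (ContactModel F m) m) (ContactModel F m) S ContactElement.pt
      (fun z v => addContact q z (vIncl κ v)) where
  smooth_proj z _ := (contMDiffAt_pt z).contMDiffWithinAt
  mem z hz v := by
    have hc := mem_chartDomain_chartIndexAt z.pt
    generalize chartIndexAt z.pt = c at hc
    refine ⟨?_, rfl⟩
    obtain ⟨w, hw⟩ := hS.exists_eq hc hz rfl
    generalize z.pt = P at *
    subst hw
    change addContact q (semiElement c q P w.1) (vIncl κ ⟨P, v⟩) ∈ S
    rw [addContact_semiElement_vIncl q hc]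
    exact (hS.2 c P hc _).2 (w + vCoord κ c P hc.2 v).2
  zero_act z hz := by
    have hc := mem_chartDomain_chartIndexAt z.pt
    generalize chartIndexAt z.pt = c at hc
    obtain ⟨w, hw⟩ := hS.exists_eq hc hz rfl
    generalize z.pt = P at *
    subst hw
    change addContact q (semiElement c q P w.1) (vIncl κ ⟨P, 0⟩) = _
    rw [addContact_semiElement_vIncl q hc, map_zero]
    exact congrArg (semiElement c q P) (add_zero _)
  add_act z hz v v' := by
    have hc := mem_chartDomain_chartIndexAt z.pt
    generalize chartIndexAt z.pt = c at hc
    obtain ⟨w, hw⟩ := hS.exists_eq hc hz rfl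
    generalize z.pt = P at *
    subst hw
    change addContact q (semiElement c q P w.1) (vIncl κ ⟨P, v + v'⟩) =
      addContact q (addContact q (semiElement c q P w.1) (vIncl κ ⟨P, v⟩)) (vIncl κ ⟨P, v'⟩)
    rw [addContact_semiElement_vIncl q hc, addContact_semiElement_vIncl q hc,
      addContact_semiElement_vIncl q hc, map_add]
    exact congrArg (semiElement c q P) (add_assoc _ _ _).symm
  simply_transitive z hz z' hz' h := by
    have hc := mem_chartDomain_chartIndexAt z.pt
    generalize chartIndexAt z.pt = c at hc
    obtain ⟨w, hw⟩ := hS.exists_eq hc hz rfl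
    obtain ⟨w', rfl⟩ := hS.exists_eq hc hz' h
    clear h
    generalize z.pt = P at *
    subst hw
    refine ⟨(vCoord κ c P hc.2).symm (w' - w), ?_, fun v hv => ?_⟩
    · change addContact q (semiElement c q P w.1) (vIncl κ ⟨P, _⟩) = _
      rw [addContact_semiElement_vIncl q hc, LinearEquiv.apply_symm_apply]
      exact congrArg (semiElement c q P) (add_sub_cancel w.1 w'.1)
    · change addContact q (semiElement c q P w.1) (vIncl κ ⟨P, v⟩) = _ at hv
      rw [addContact_semiElement_vIncl q hc] at hv
      rw [LinearEquiv.eq_symm_apply]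
      exact Subtype.ext (eq_sub_of_add_eq' (semiElement_injective hv))
  locally_trivial b := by
    let c := chartIndexAt b
    obtain ⟨Pr, hPr⟩ := exists_projection (m := m) κ (Module.finrank ℝ F - m)
    have hadd : ∀ v : TotalSpace (BilinModel κ m (Module.finrank ℝ F - m))
        (VFiber (F := F) (M := M) (m := m) κ), v.proj ∈ chartDomain c →
        addContact q (semiElement c q v.proj 0) (vIncl κ v) =
          semiElement c q v.proj (vPretriv κ c v).2.1 := by
      rintro ⟨P, v⟩ hP
      rw [vPretriv_apply κ c hP]
      exact (addContact_semiElement_vIncl q hP 0 v).trans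
        (congrArg (semiElement c q P) (zero_add _))
    refine ⟨chartDomain c, isOpen_chartDomain c, mem_chartDomain_chartIndexAt b,
      fun P => semiElement c q P 0, ?_, ?_, ?_, ?_⟩
    · intro P hP
      exact contMDiffWithinAt_semiElement q hP contMDiffWithinAt_id contMDiffWithinAt_const
    · exact fun P hP => ⟨(hS.2 c P hP 0).2 (zero_mem _), rfl⟩
    · intro v hv
      have h1 := (contMDiffWithinAt_vertical_iff (κ := κ) (c := c) (f := id) (s :=
        {v | v.proj ∈ chartDomain c}) hv).1 contMDiffWithinAt_id
      have h2 := (bilinModel κ m (Module.finrank ℝ F - m)).subtypeL.contDiff (n := ∞)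
      exact (contMDiffWithinAt_semiElement q hv h1.1
        (h2.contMDiff.contMDiffAt.comp_contMDiffWithinAt v h1.2)).congr
        (fun v' hv' => hadd v' hv') (hadd v hv)
    · refine ⟨fun z => verticalMk κ c z.pt (Pr (secondCoord c q z)), ?_, ?_⟩
      · rintro z ⟨hz, hzc⟩
        have h1 : z ∈ chartDomain (doubleIndex c q) := by
          obtain ⟨w, hw⟩ := hS.exists_eq hzc hz rfl
          rw [← hw]
          exact semiElement_mem_chartDomain q hzc _
        exact contMDiffWithinAt_verticalMk hzc (contMDiffAt_pt z).contMDiffWithinAt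
          (Pr.contDiff.contMDiff.contMDiffAt.comp_contMDiffWithinAt z
            (contMDiffAt_secondCoord q h1).contMDiffWithinAt)
      · rintro z ⟨hz, hzc⟩
        refine ⟨rfl, ?_⟩
        obtain ⟨w, hw⟩ := hS.exists_eq hzc hz rfl
        refine (hadd (verticalMk κ c z.pt (Pr (secondCoord c q z))) hzc).trans ?_
        rw [vPretriv_verticalMk κ hzc]
        change semiElement c q z.pt _ = z
        rw [eq_semiElement q (hS.1 hz) hzc] at hw
        rw [← semiElement_injective hw, hPr, semiElement_injective hw]
        exact (eq_semiElement q (hS.1 hz) hzc).symm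

end SecondOrderSets

/-! ### Holonomic and curvature components -/

section Decomposition

variable (m : ℕ) in
/-- The skew-symmetric part of a bilinear map. -/
def skewPart (k : ℕ) : (Rn m →L[ℝ] Rn m →L[ℝ] Rn k) →L[ℝ] BilinModel .skew m k :=
  LinearMap.toContinuousLinearMap
    { toFun := fun β => ⟨(2⁻¹ : ℝ) • (β - β.flip), fun s t => by
        change (2⁻¹ : ℝ) • (β s t - β t s) = -((2⁻¹ : ℝ) • (β t s - β s t))
        rw [← smul_neg, neg_sub]⟩
      map_add' := fun β γ => by
        apply Subtype.ext
        ext1 s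
        ext1 t
        change (2⁻¹ : ℝ) • (β s t + γ s t - (β t s + γ t s)) =
          (2⁻¹ : ℝ) • (β s t - β t s) + (2⁻¹ : ℝ) • (γ s t - γ t s)
        rw [← smul_add, add_sub_add_comm]
      map_smul' := fun r β => by
        apply Subtype.ext
        ext1 s
        ext1 t
        change (2⁻¹ : ℝ) • (r • β s t - r • β t s) = r • (2⁻¹ : ℝ) • (β s t - β t s)
        rw [← smul_sub, smul_comm] }

variable {m : ℕ}

theorem skewPart_apply {k : ℕ} (β : Rn m →L[ℝ] Rn m →L[ℝ] Rn k) (s t : Rn m) :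
    (skewPart m k β).1 s t = (2⁻¹ : ℝ) • (β s t - β t s) := rfl

theorem sub_skewPart_mem {k : ℕ} (β : Rn m →L[ℝ] Rn m →L[ℝ] Rn k) :
    β - (skewPart m k β).1 ∈ bilinModel .symmetric m k := by
  intro s t
  change β s t - (skewPart m k β).1 s t = β t s - (skewPart m k β).1 t s
  rw [skewPart_apply, skewPart_apply]
  module

theorem skewPart_add {k : ℕ} {β γ : Rn m →L[ℝ] Rn m →L[ℝ] Rn k}
    (hβ : β ∈ bilinModel .symmetric m k) (hγ : γ ∈ bilinModel .skew m k) :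
    (skewPart m k (β + γ)).1 = γ := by
  ext1 s
  ext1 t
  have h1 : β s t = β t s := hβ s t
  have h2 : γ t s = -γ s t := hγ t s
  rw [skewPart_apply]
  change (2⁻¹ : ℝ) • (β s t + γ s t - (β t s + γ t s)) = γ s t
  rw [h1, h2, add_sub_add_left_eq_sub, sub_neg_eq_add, smul_add, ← add_smul]
  norm_num

variable {F : Type*} [NormedAddCommGroup F] [NormedSpace ℝ F]
  {M : Type*} [TopologicalSpace M] [ChartedSpace F M] [IsManifold 𝓘(ℝ, F) ∞ M]
  [FiniteDimensional ℝ F]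

variable (q : (Rn (Module.finrank ℝ F - m) × (Rn m →L[ℝ] Rn (Module.finrank ℝ F - m))) ≃L[ℝ]
      Rn (Module.finrank ℝ (ContactModel F m) - m))

/-- The holonomic and the curvature component of a semiholonomic double contact element, in the
coordinates belonging to `c`. -/
def components (c : ChartIndex F M m) (z : DoubleContactElement F M m) :
    DoubleContactElement F M m × TotalSpace (BilinModel .skew m (Module.finrank ℝ F - m))
      (VFiber (F := F) (M := M) (m := m) .skew) :=
  (semiElement c q z.pt
      (secondCoord c q z - (skewPart m (Module.finrank ℝ F - m) (secondCoord c q z)).1),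
    verticalMk .skew c z.pt (skewPart m (Module.finrank ℝ F - m) (secondCoord c q z)))

theorem addContact_vIncl_eq {κ : Kind} {c : ChartIndex F M m}
    {p : DoubleContactElement F M m × TotalSpace (BilinModel κ m (Module.finrank ℝ F - m))
      (VFiber (F := F) (M := M) (m := m) κ)}
    (hz : p.1 ∈ semiholonomicContact F M m) (hp : p.2.proj = p.1.pt) (hc : p.1.pt ∈ chartDomain c) :
    addContact q p.1 (vIncl κ p.2) =
      semiElement c q p.1.pt (secondCoord c q p.1 + (vPretriv κ c p.2).2.1) := by
  obtain ⟨z, ⟨P, v⟩⟩ := p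
  obtain rfl : P = z.pt := hp
  have h := eq_semiElement q hz hc
  have h1 := addContact_semiElement_vIncl q hc (secondCoord c q z) v
  rw [← h] at h1
  refine h1.trans ?_
  rw [vPretriv_apply κ c hc]

theorem components_addContact {c : ChartIndex F M m}
    {p : DoubleContactElement F M m × TotalSpace (BilinModel .skew m (Module.finrank ℝ F - m))
      (VFiber (F := F) (M := M) (m := m) .skew)}
    (hz : p.1 ∈ holonomicContact F M m) (hp : p.2.proj = p.1.pt) (hc : p.1.pt ∈ chartDomain c) :
    components q c (addContact q p.1 (vIncl .skew p.2)) = p := by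
  rw [addContact_vIncl_eq q (holonomicContact_subset hz) hp hc]
  have h1 := eq_semiElement q (holonomicContact_subset hz) hc
  have h2 : secondCoord c q p.1 ∈ bilinModel .symmetric m (Module.finrank ℝ F - m) := by
    refine (semiElement_mem_holonomicContact_iff q hc _).1 ?_
    rwa [← h1]
  have h3 := skewPart_add h2 (vPretriv .skew c p.2).2.2
  rw [components, secondCoord_semiElement]
  obtain ⟨z, ⟨P, v⟩⟩ := p
  obtain rfl : P = z.pt := hp
  refine Prod.ext ?_ ?_
  · change semiElement c q z.pt _ = z
    rw [h3, add_sub_cancel_right]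
    exact h1.symm
  · have h4 : skewPart m (Module.finrank ℝ F - m)
      (secondCoord c q z + (vPretriv .skew c ⟨z.pt, v⟩).2.1) = (vPretriv .skew c ⟨z.pt, v⟩).2 :=
      Subtype.ext h3
    change verticalMk .skew c z.pt (skewPart m (Module.finrank ℝ F - m)
      (secondCoord c q z + (vPretriv .skew c ⟨z.pt, v⟩).2.1)) = _
    rw [h4]
    exact verticalMk_vPretriv .skew hc v

theorem components_fst_mem {c : ChartIndex F M m} {z : DoubleContactElement F M m}
    (hc : z.pt ∈ chartDomain c) : (components q c z).1 ∈ holonomicContact F M m :=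
  (semiElement_mem_holonomicContact_iff q hc _).2 (sub_skewPart_mem _)

theorem addContact_components {c : ChartIndex F M m} {z : DoubleContactElement F M m}
    (hz : z ∈ semiholonomicContact F M m) (hc : z.pt ∈ chartDomain c) :
    addContact q (components q c z).1 (vIncl .skew (components q c z).2) = z := by
  rw [addContact_vIncl_eq (c := c) q (holonomicContact_subset (components_fst_mem q hc)) rfl hc]
  change semiElement c q z.pt (secondCoord c q (semiElement c q z.pt _) +
    (vPretriv .skew c (verticalMk .skew c z.pt _)).2.1) = z
  rw [secondCoord_semiElement, vPretriv_verticalMk .skew hc, sub_add_cancel]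
  exact (eq_semiElement q hz hc).symm

/-- The components do not depend on the chart. -/
theorem components_eq {c c' : ChartIndex F M m} {z : DoubleContactElement F M m}
    (hz : z ∈ semiholonomicContact F M m) (hc : z.pt ∈ chartDomain c)
    (hc' : z.pt ∈ chartDomain c') : components q c z = components q c' z := by
  have h := components_addContact q (c := c) (p := components q c' z) (components_fst_mem q hc')
    rfl hc
  rwa [addContact_components q hz hc'] at h

/-- The inverse map splits the second order coordinates into their symmetric and skew-symmetric parts.
It is smooth near a point, as there it is given by the coordinates of one fixed chart. -/
theorem isDiffeomorphismOn_addContact :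
    IsDiffeomorphismOn
      (𝓘(ℝ, ContactModel (ContactModel F m) m).prod
        (𝓘(ℝ, ContactModel F m).prod 𝓘(ℝ, BilinModel .skew m (Module.finrank ℝ F - m))))
      𝓘(ℝ, ContactModel (ContactModel F m) m)
      (fun p : DoubleContactElement F M m ×
          TotalSpace (BilinModel .skew m (Module.finrank ℝ F - m))
            (VFiber (F := F) (M := M) (m := m) .skew) => addContact q p.1 (vIncl .skew p.2))
      {p | p.1 ∈ holonomicContact F M m ∧ p.2.proj = p.1.pt}
      (semiholonomicContact F M m) := by
  let g : DoubleContactElement F M m → DoubleContactElement F M m ×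
      TotalSpace (BilinModel .skew m (Module.finrank ℝ F - m))
        (VFiber (F := F) (M := M) (m := m) .skew) :=
    fun z => components q (chartIndexAt z.pt) z
  have hc : ∀ z : DoubleContactElement F M m, z.pt ∈ chartDomain (chartIndexAt z.pt) :=
    fun z => mem_chartDomain_chartIndexAt z.pt
  have hinv : InvOn g (fun p => addContact q p.1 (vIncl .skew p.2))
      {p | p.1 ∈ holonomicContact F M m ∧ p.2.proj = p.1.pt} (semiholonomicContact F M m) :=
    ⟨fun p hp => components_addContact q hp.1 hp.2 (hc _),
      fun z hz => addContact_components q hz (hc z)⟩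
  refine ⟨hinv.bijOn ?_ fun z _ => ⟨components_fst_mem q (hc z), rfl⟩, ?_, g, hinv, ?_⟩
  · intro p hp
    change addContact q p.1 (vIncl .skew p.2) ∈ _
    rw [addContact_vIncl_eq (c := chartIndexAt p.1.pt) q (holonomicContact_subset hp.1) hp.2 (hc _)]
    exact semiElement_mem_semiholonomicContact q (hc _) _
  · intro p hp
    let c := chartIndexAt p.1.pt
    have h0 : ContMDiffWithinAt (𝓘(ℝ, ContactModel (ContactModel F m) m).prod
        (𝓘(ℝ, ContactModel F m).prod 𝓘(ℝ, BilinModel .skew m (Module.finrank ℝ F - m))))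
        𝓘(ℝ, ContactModel (ContactModel F m) m) ∞ Prod.fst
        {p : DoubleContactElement F M m ×
          TotalSpace (BilinModel .skew m (Module.finrank ℝ F - m))
            (VFiber (F := F) (M := M) (m := m) .skew) |
          p.1 ∈ holonomicContact F M m ∧ p.2.proj = p.1.pt} p := contMDiffWithinAt_fst
    have h1 := (contMDiffAt_pt p.1).comp_contMDiffWithinAt p h0
    have h2 : p.1 ∈ chartDomain (doubleIndex c q) := by
      rw [eq_semiElement q (holonomicContact_subset hp.1) (hc p.1)]
      exact semiElement_mem_chartDomain q (hc p.1) _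
    have h3 := (contMDiffAt_secondCoord q h2).comp_contMDiffWithinAt p h0
    have h4 : p.2.proj ∈ chartDomain c := by
      rw [hp.2]
      exact hc p.1
    have h5 := ((contMDiffWithinAt_vertical_iff (f := Prod.snd) (c := c) h4).1
      (contMDiffWithinAt_snd (I := 𝓘(ℝ, ContactModel (ContactModel F m) m)) (n := ∞)
        (s := {p : DoubleContactElement F M m ×
          TotalSpace (BilinModel .skew m (Module.finrank ℝ F - m))
            (VFiber (F := F) (M := M) (m := m) .skew) |
          p.1 ∈ holonomicContact F M m ∧ p.2.proj = p.1.pt}) (p := p))).2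
    have h6 := ((bilinModel .skew m (Module.finrank ℝ F - m)).subtypeL.contDiff
      (n := ∞)).contMDiff.contMDiffAt.comp_contMDiffWithinAt p h5
    have h7 := contMDiffWithinAt_semiElement q (c := c) (x := p) (hc p.1) h1 (h3.add h6)
    refine h7.congr_of_eventuallyEq ?_
      (addContact_vIncl_eq q (holonomicContact_subset hp.1) hp.2 (hc p.1))
    filter_upwards [self_mem_nhdsWithin, h1.continuousWithinAt.preimage_mem_nhdsWithin
      ((isOpen_chartDomain c).mem_nhds (hc p.1))] with p' hp' hp'c
    exact addContact_vIncl_eq q (holonomicContact_subset hp'.1) hp'.2 hp'c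
  · intro z hz
    let c := chartIndexAt z.pt
    have h1 : z ∈ chartDomain (doubleIndex c q) := by
      rw [eq_semiElement q hz (hc z)]
      exact semiElement_mem_chartDomain q (hc z) _
    have h2 := (contMDiffAt_secondCoord q h1).contMDiffWithinAt (s := semiholonomicContact F M m)
    have h3 := ((skewPart m (Module.finrank ℝ F - m)).contDiff
      (n := ∞)).contMDiff.contMDiffAt.comp_contMDiffWithinAt z h2
    have h4 := ((bilinModel .skew m (Module.finrank ℝ F - m)).subtypeL.contDiff
      (n := ∞)).contMDiff.contMDiffAt.comp_contMDiffWithinAt z h3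
    have h5 := (contMDiffAt_pt z).contMDiffWithinAt (s := semiholonomicContact F M m)
    have h6 := (contMDiffWithinAt_semiElement q (c := c) (hc z) h5 (h2.sub h4)).prodMk
      (contMDiffWithinAt_verticalMk (c := c) (hc z) h5 h3)
    refine h6.congr_of_eventuallyEq ?_ rfl
    filter_upwards [self_mem_nhdsWithin, h5.continuousWithinAt.preimage_mem_nhdsWithin
      ((isOpen_chartDomain c).mem_nhds (hc z))] with z' hz' hz'c
    exact components_eq q hz' (hc z') hz'c

end Decomposition

end DoubleContact

end

theorem mainTheorem1 (m n : ℕ) (hmn : m < n) (E : Type*) [TopologicalSpace E]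
    [ChartedSpace (EuclideanSpace ℝ (Fin n)) E]
    [IsManifold 𝓘(ℝ, EuclideanSpace ℝ (Fin n)) ∞ E] :
    -- the bundles `V^m J^m E` are the quotients of the bundles of vertical double velocities
    -- by the semiholonomic, holonomic and curvature subgroups of the principal jet group
    (∀ κ : Kind,
      (∀ v : TotalSpace (BilinModel κ m (Module.finrank ℝ (EuclideanSpace ℝ (Fin n)) - m))
          (VFiber (F := EuclideanSpace ℝ (Fin n)) (M := E) (m := m) κ),
        ∃ (u : Velocity m 𝓘(ℝ, EuclideanSpace ℝ (Fin n)) E) (hu : IsRegular u)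
          (β : Rn m →L[ℝ] Rn m →L[ℝ] TangentSpace 𝓘(ℝ, EuclideanSpace ℝ (Fin n)) u.proj)
          (hβ : κ.Holds (fun s t => β s t)), verticalClass κ u hu β hβ = v) ∧
      (∀ (u : Velocity m 𝓘(ℝ, EuclideanSpace ℝ (Fin n)) E) (hu : IsRegular u)
        (β : Rn m →L[ℝ] Rn m →L[ℝ] TangentSpace 𝓘(ℝ, EuclideanSpace ℝ (Fin n)) u.proj)
        (hβ : κ.Holds (fun s t => β s t))
        (u' : Velocity m 𝓘(ℝ, EuclideanSpace ℝ (Fin n)) E) (hu' : IsRegular u')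
        (β' : Rn m →L[ℝ] Rn m →L[ℝ] TangentSpace 𝓘(ℝ, EuclideanSpace ℝ (Fin n)) u'.proj)
        (hβ' : κ.Holds (fun s t => β' s t)),
        verticalClass κ u hu β hβ = verticalClass κ u' hu' β' hβ' ↔
          ∃ (A : Rn m ≃L[ℝ] Rn m) (B : Rn m →L[ℝ] Rn m →L[ℝ] Rn m),
            κ.Holds (fun s t => B s t) ∧
            verticalVelocity u' β' = doubleVelocityAct (verticalVelocity u β) A A B)) ∧
    -- the semiholonomic and the holonomic double contact elements form submanifolds
    IsSubmanifold (ContactModel (ContactModel (EuclideanSpace ℝ (Fin n)) m) m)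
      (semiholonomicContact (EuclideanSpace ℝ (Fin n)) E m)
      (n + m * (n - m) + m * m * (n - m)) ∧
    IsSubmanifold (ContactModel (ContactModel (EuclideanSpace ℝ (Fin n)) m) m)
      (holonomicContact (EuclideanSpace ℝ (Fin n)) E m)
      (n + m * (n - m) + m * (m + 1) / 2 * (n - m)) ∧
    ∃ add : DoubleContactElement (EuclideanSpace ℝ (Fin n)) E m →
        TotalSpace (BilinModel .all m (Module.finrank ℝ (EuclideanSpace ℝ (Fin n)) - m))
          (VFiber (F := EuclideanSpace ℝ (Fin n)) (M := E) (m := m) .all) →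
        DoubleContactElement (EuclideanSpace ℝ (Fin n)) E m,
      -- the action on double contact elements is the one induced by the addition of vertical
      -- double velocities to semiholonomic double velocities
      (∀ (W : DoubleVelocity (EuclideanSpace ℝ (Fin n)) E m)
        (z : DoubleContactElement (EuclideanSpace ℝ (Fin n)) E m) (hu : IsRegular W.proj)
        (β : Rn m →L[ℝ] Rn m →L[ℝ] TangentSpace 𝓘(ℝ, EuclideanSpace ℝ (Fin n)) W.proj.proj),
        IsSemiholonomic W → Represents W z →
          Represents (addVertical W β) (add z (verticalClass .all W.proj hu β trivial))) ∧
      -- the affine bundle structures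
      IsAffineBundle (ContactModel (ContactModel (EuclideanSpace ℝ (Fin n)) m) m)
        (ContactModel (EuclideanSpace ℝ (Fin n)) m)
        (semiholonomicContact (EuclideanSpace ℝ (Fin n)) E m) ContactElement.pt add ∧
      IsAffineBundle (ContactModel (ContactModel (EuclideanSpace ℝ (Fin n)) m) m)
        (ContactModel (EuclideanSpace ℝ (Fin n)) m)
        (holonomicContact (EuclideanSpace ℝ (Fin n)) E m) ContactElement.pt
        (fun z v => add z (vIncl .symmetric v)) ∧
      -- the decomposition into holonomic and curvature components
      IsDiffeomorphismOn
        (𝓘(ℝ, ContactModel (ContactModel (EuclideanSpace ℝ (Fin n)) m) m).prod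
          (𝓘(ℝ, ContactModel (EuclideanSpace ℝ (Fin n)) m).prod
            𝓘(ℝ, BilinModel .skew m (Module.finrank ℝ (EuclideanSpace ℝ (Fin n)) - m))))
        𝓘(ℝ, ContactModel (ContactModel (EuclideanSpace ℝ (Fin n)) m) m)
        (fun p : DoubleContactElement (EuclideanSpace ℝ (Fin n)) E m ×
            TotalSpace (BilinModel .skew m (Module.finrank ℝ (EuclideanSpace ℝ (Fin n)) - m))
              (VFiber (F := EuclideanSpace ℝ (Fin n)) (M := E) (m := m) .skew) =>
          add p.1 (vIncl .skew p.2))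
        {p | p.1 ∈ holonomicContact (EuclideanSpace ℝ (Fin n)) E m ∧ p.2.proj = p.1.pt}
        (semiholonomicContact (EuclideanSpace ℝ (Fin n)) E m) := by
  have hn : Module.finrank ℝ (EuclideanSpace ℝ (Fin n)) = n := finrank_euclideanSpace_fin
  have hq : Module.finrank ℝ (Rn (Module.finrank ℝ (EuclideanSpace ℝ (Fin n)) - m) ×
      (Rn m →L[ℝ] Rn (Module.finrank ℝ (EuclideanSpace ℝ (Fin n)) - m))) =
      Module.finrank ℝ (Rn (Module.finrank ℝ (ContactModel (EuclideanSpace ℝ (Fin n)) m) - m)) := by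
    simp only [Module.finrank_prod, finrank_clm, finrank_euclideanSpace_fin]
    omega
  -- the transversal coordinates of double contact elements: those of `T_x E / P` and of
  -- `Hom(P, T_x E / P)`
  let q := ContinuousLinearEquiv.ofFinrankEq hq
  have hS := isSecondOrderSet_semiholonomicContact (M := E) q
  have hH := isSecondOrderSet_holonomicContact (M := E) q
  refine ⟨fun κ => ⟨fun v => ?_, fun u hu β hβ u' hu' β' hβ' =>
    verticalClass_eq_iff hu β hβ hu' β' hβ'⟩, hS.isSubmanifold ?_, hH.isSubmanifold ?_,
    addContact q, fun W z hu β hW hz => represents_addContact q hu β hW hz, hS.isAffineBundle,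
    hH.isAffineBundle, isDiffeomorphismOn_addContact q⟩
  · obtain ⟨P, v⟩ := v
    obtain ⟨u, hu, rfl⟩ := exists_contactOf_eq P
    obtain ⟨β, hβ, h⟩ := exists_verticalClass_eq hu v
    exact ⟨u, hu, β, hβ, h⟩
  · rw [finrank_bilinModel_all, hn]
  · rw [finrank_bilinModel_symmetric, hn]
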